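/- **Setting.** Let $a,b>0$ and let $(\gamma)$ be a non-increasing curve from $(a,0)$ to $(0,b)$ in the first quadrant, parametrized by arc length as $(s,t)=(L_1(\mu),L_2(\mu))$, $0\le\mu\le L$, with $L_1$ non-increasing, $L_2$ non-decreasing, meeting the coordinate axes only at its end points. Let $\mathbf P=\{P_0=(a,0),P_1,\dots,P_N,P_{N+1}=(0,b)\}$ be finitely many points of $(\gamma)$, in this order (the vertices), such that $(\gamma)$ is of class $C^2$ on each closed arc between consecutive vertices. Let $\vec n=(n_1,n_2)=(L_2',-L_1')$ be the outward unit normal off the vertices. Put $W(\sigma,\tau)=[0,\sigma]\times[0,\tau]$; let $G=\bigcup_{P\in(\gamma)}W(P)$ be the region bounded by the axes and $(\gamma)$, let $G_R$ be $G$ without the lines through vertices parallel to the axes, $E(s,t)=\{(\sigma,\tau)\in G:(s,t)\in W(\sigma,\tau)\}$ and $\gamma(s,t)=\{(\sigma,\tau)\in(\gamma):(s,t)\in W(\sigma,\tau)\}$. Derivatives of functions on $G$ at boundary points are taken within $G$, and repeated indices are summed. Let $f(s,t,x,p,q,u)\in\mathbb R^n$, $\Phi(s,t,x,p,q,u)\in\mathbb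 R$ and $\Phi_1(s,t,x,\eta)\in\mathbb R$ be of class $C^2$, and $\Phi_0(P,x)\in\mathbb R$ of class $C^1$ in $x$, where $x,p,q,\eta\in\mathbb R^n$ and $u\in\mathbb R^m$. Let $u:G\to\mathbb R^m$ be $C^1$ and let $x:G\to\mathbb R^n$ be a $C^2$ solution of $x_{st}=f(s,t,x,x_s,x_t,u)$ with prescribed values $x(s,0)=x_1(s)$, $x(0,t)=x_2(t)$. All derivatives of $f,\Phi$ below are evaluated at $(s,t,x,x_s,x_t,u)$, those of $\Phi_1$ at $(s,t,x,x_\mu)$ on $(\gamma)$, where $\varphi_\mu=-n_2\varphi_s+n_1\varphi_t$ is the tangential derivative; $D/Ds$, $D/Dt$, $D/D\mu$ are total derivatives. Let $R=(R^i_j(s,t,\sigma,\tau))$, defined for $(s,t)\in G$, $(\sigma,\tau)\in W(s,t)$, be the matrix-valued Riemann function, that is, the $C^1$ solution of $$R^i_{j,st}=f^i_{x^k}R^k_j+f^i_{p^k}R^k_{j,s}+f^i_{q^k}R^k_{j,t}\quad(s>\sigma,\ t>\tau),$$ $$\partial_sR^i_j(s,\tau,\sigma,\tau)=f^i_{q^k}(s,\tau)R^k_j(s,\tau,\sigma,\tau),\qquad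 \partial_tR^i_j(\sigma,t,\sigma,\tau)=f^i_{p^k}(\sigma,t)R^k_j(\sigma,t,\sigma,\tau),\qquad R^i_j(\sigma,\tau,\sigma,\tau)=\delta^i_j .$$ Set $F_i=\Phi_{x^i}-\frac{D}{Ds}\Phi_{p^i}-\frac{D}{Dt}\Phi_{q^i}$ on $G$; $F_{1,i}=n_1\Phi_{p^i}+n_2\Phi_{q^i}+\Phi_{1,x^i}-\frac{D}{D\mu}\Phi_{1,\eta^i}$ on $(\gamma)\setminus\mathbf P$; and $F_{0,i}(P_r)=\Phi_{0,x^i}(P_r,x(P_r))-V_r(\Phi_{1,\eta^i})$, where $V_r$ is the jump at $P_r$ (right limit minus left limit in $\mu$). The co-state is, for $(s,t)\in G$, $$\psi_j(s,t)=\iint_{E(s,t)}F_i(\sigma,\tau)R^i_j(\sigma,\tau,s,t)\,d\sigma\,d\tau+\int_{\gamma(s,t)}F_{1,i}(\sigma,\tau)R^i_j(\sigma,\tau,s,t)\,d\mu+\sum_{\substack{1\le r\le N\\(s,t)\in W(P_r)}}F_{0,i}(P_r)R^i_j(P_r,s,t),$$ and $H=\Phi+\psi_jf^j$ is the Hamiltonian.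 A flat part of $(\gamma)$ is a nondegenerate straight line segment contained in $(\gamma)$ and parallel to one of the axes; an oblique part of $(\gamma)$ is a connected subset of $(\gamma)$ that contains no such segment. **Theorem 4.1.** Let $P\in(\gamma)\setminus\mathbf P$ and $1\le j\le n$. (i) If $P$ lies in the interior, relative to $(\gamma)$, of a flat part of $(\gamma)$, then $\psi_j(P)$ is the limit of $\psi_j(s,t)$ as $(s,t)\to P$, $(s,t)\in\operatorname{int}G_R$; the restriction of $\psi_j$ to $(\gamma)$ is differentiable in the arc length at $P$; and at $P$ $$\bigl[n_1^2-n_2^2\bigr]\frac{\partial\psi_j}{\partial\mu}+n_1\frac{\partial H}{\partial p^j}+n_2\frac{\partial H}{\partial q^j}+\frac{\partial\Phi_1}{\partial x^j}-\frac{D}{D\mu}\frac{\partial\Phi_1}{\partial\eta^j}=0.\tag{4.1}$$ (ii) If $P$ lies in the interior, relative to $(\gamma)$, of an oblique part of $(\gamma)$, then, as $(s,t)\to P$ with $(s,t)\in\operatorname{int}G_R$, $$\psi_j(s,t)\to0;$$ if $n_2(P)\ne0$, then $\partial\psi_j/\partial s$ exists at all $(s,t)\in\operatorname{int}G_R$ close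 to $P$ and $$n_2(P)\,\frac{\partial\psi_j}{\partial s}(s,t)\to-F_{1,j}(P);$$ if $n_1(P)\ne0$, then $\partial\psi_j/\partial t$ exists at all $(s,t)\in\operatorname{int}G_R$ close to $P$ and $$n_1(P)\,\frac{\partial\psi_j}{\partial t}(s,t)\to-F_{1,j}(P).\tag{4.2}$$ -/

import Mathlib

open Set Filter Topology MeasureTheory

/-- The rectangle `W(σ, τ) = {(s, t) : 0 ≤ s ≤ σ, 0 ≤ t ≤ τ}`. -/
def quadRect (w : ℝ × ℝ) : Set (ℝ × ℝ) :=
  {z | 0 ≤ z.1 ∧ z.1 ≤ w.1 ∧ 0 ≤ z.2 ∧ z.2 ≤ w.2}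

/-- The boundary curve `(γ)` with its vertices.  The curve runs from `(a, 0)` to `(0, b)` as a
non-increasing graph, is parametrized by arc length on `[0, len]` as `s = L₁ μ`, `t = L₂ μ`,
meets the coordinate axes only at its end points, and is of class `C²` on each of the closed
arcs between consecutive vertices `P₀ = (a, 0), P₁, …, P_N, P_{N+1} = (0, b)`; the numbers
`vert r` are the arc length parameters of the vertices. -/
structure BoundaryCurve where
  a : ℝ
  b : ℝ
  a_pos : 0 < a
  b_pos : 0 < b
  len : ℝ
  L₁ : ℝ → ℝ
  L₂ : ℝ → ℝ
  N : ℕ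
  vert : Fin (N + 2) → ℝ
  vert_strictMono : StrictMono vert
  vert_zero : vert 0 = 0
  vert_last : vert (Fin.last (N + 1)) = len
  start : L₁ 0 = a ∧ L₂ 0 = 0
  finish : L₁ len = 0 ∧ L₂ len = b
  antitone_L₁ : AntitoneOn L₁ (Icc 0 len)
  monotone_L₂ : MonotoneOn L₂ (Icc 0 len)
  pos : ∀ μ ∈ Ioo 0 len, 0 < L₁ μ ∧ 0 < L₂ μ
  contDiffOn_L₁ : ∀ r : Fin (N + 1), ContDiffOn ℝ 2 L₁ (Icc (vert r.castSucc) (vert r.succ))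
  contDiffOn_L₂ : ∀ r : Fin (N + 1), ContDiffOn ℝ 2 L₂ (Icc (vert r.castSucc) (vert r.succ))
  arcLength : ∀ r : Fin (N + 1), ∀ μ ∈ Ioo (vert r.castSucc) (vert r.succ),
    deriv L₁ μ ^ 2 + deriv L₂ μ ^ 2 = 1

namespace BoundaryCurve

variable (C : BoundaryCurve)

/-- The point of `(γ)` with arc length parameter `μ`. -/
def point (μ : ℝ) : ℝ × ℝ := (C.L₁ μ, C.L₂ μ)

/-- The curve `(γ)` as a set. -/
def curve : Set (ℝ × ℝ) := C.point '' Icc 0 C.len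

/-- The vertices `P_r`, `0 ≤ r ≤ N + 1`. -/
def vertex (r : Fin (C.N + 2)) : ℝ × ℝ := C.point (C.vert r)

/-- The set of vertices. -/
def vertices : Set (ℝ × ℝ) := range C.vertex

/-- The region `G` in the first quadrant bounded by the segments `[0, a]`, `[0, b]` of the axes
and by `(γ)`: since `(γ)` is non-increasing, it is the union of the rectangles `W(P)`,
`P ∈ (γ)`. -/
def region : Set (ℝ × ℝ) := {z | ∃ w ∈ C.curve, z ∈ quadRect w}

/-- The regular part `G_R` of `G`: the lines through the vertices parallel to the axes are
removed. -/
def regularRegion : Set (ℝ × ℝ) :=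
  {z | z ∈ C.region ∧ ∀ r, z.1 ≠ (C.vertex r).1 ∧ z.2 ≠ (C.vertex r).2}

/-- First component of the outward unit normal: the unit tangent in the counterclockwise
direction is `(L₁', L₂')`, so the outward normal is `(L₂', -L₁')`. -/
noncomputable def n₁ (μ : ℝ) : ℝ := deriv C.L₂ μ

/-- Second component of the outward unit normal. -/
noncomputable def n₂ (μ : ℝ) : ℝ := -deriv C.L₁ μ

/-- `E(s, t) = {(σ, τ) ∈ G : (s, t) ∈ W(σ, τ)}`. -/
def upperSet (z : ℝ × ℝ) : Set (ℝ × ℝ) := {w | w ∈ C.region ∧ z ∈ quadRect w}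

/-- The arc `γ(s, t) = {(σ, τ) ∈ (γ) : (s, t) ∈ W(σ, τ)}`, in terms of the arc length
parameter. -/
def upperArc (z : ℝ × ℝ) : Set ℝ := {μ | μ ∈ Icc 0 C.len ∧ z ∈ quadRect (C.point μ)}

/-- A nondegenerate straight line segment parallel to one of the coordinate axes. -/
def IsAxisSegment (A : Set (ℝ × ℝ)) : Prop :=
  ∃ p q : ℝ × ℝ, p ≠ q ∧ (p.1 = q.1 ∨ p.2 = q.2) ∧ A = segment ℝ p q

/-- A flat part of `(γ)`. -/
def IsFlatPart (A : Set (ℝ × ℝ)) : Prop := A ⊆ C.curve ∧ IsAxisSegment A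

/-- An oblique part of `(γ)`: a connected part without segments parallel to an axis. -/
def IsObliquePart (A : Set (ℝ × ℝ)) : Prop :=
  A ⊆ C.curve ∧ IsConnected A ∧ ∀ B, IsAxisSegment B → ¬ B ⊆ A

/-- The interior of `A` in the relative topology of `(γ)`. -/
def relInterior (A : Set (ℝ × ℝ)) : Set (ℝ × ℝ) := {z | z ∈ C.curve ∧ A ∈ 𝓝[C.curve] z}

end BoundaryCurve

/-- The partial derivative `∂g/∂yⁱ`. -/
noncomputable def pd {n : ℕ} (g : (Fin n → ℝ) → ℝ) (y : Fin n → ℝ) (i : Fin n) : ℝ :=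
  fderiv ℝ g y (Pi.single i 1)

/-- The functions that define the control problem: the right-hand side `f(s, t, x, p, q, u)` of
the state equation, and the integrands `Φ(s, t, x, p, q, u)`, `Φ₁(s, t, x, η)` and the vertex
terms `Φ₀(P, x)` of the cost functional. -/
structure ControlData (n m : ℕ) where
  f : ℝ × ℝ → (Fin n → ℝ) → (Fin n → ℝ) → (Fin n → ℝ) → (Fin m → ℝ) → (Fin n → ℝ)
  Φ : ℝ × ℝ → (Fin n → ℝ) → (Fin n → ℝ) → (Fin n → ℝ) → (Fin m → ℝ) → ℝ
  Φ₁ : ℝ × ℝ → (Fin n → ℝ) → (Fin n → ℝ) → ℝ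
  Φ₀ : ℝ × ℝ → (Fin n → ℝ) → ℝ

namespace ControlData

variable {n m : ℕ} (D : ControlData n m)

/-- Continuous differentiability of the data. -/
structure IsSmooth : Prop where
  f : ContDiff ℝ 2 fun w : (ℝ × ℝ) × (Fin n → ℝ) × (Fin n → ℝ) × (Fin n → ℝ) × (Fin m → ℝ) =>
    D.f w.1 w.2.1 w.2.2.1 w.2.2.2.1 w.2.2.2.2
  Φ : ContDiff ℝ 2 fun w : (ℝ × ℝ) × (Fin n → ℝ) × (Fin n → ℝ) × (Fin n → ℝ) × (Fin m → ℝ) =>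
    D.Φ w.1 w.2.1 w.2.2.1 w.2.2.2.1 w.2.2.2.2
  Φ₁ : ContDiff ℝ 2 fun w : (ℝ × ℝ) × (Fin n → ℝ) × (Fin n → ℝ) => D.Φ₁ w.1 w.2.1 w.2.2
  Φ₀ : ∀ P, ContDiff ℝ 1 (D.Φ₀ P)

/-- The Hamiltonian `H = Φ + ψ_j f^j`. -/
def H (z : ℝ × ℝ) (x p q : Fin n → ℝ) (ψ : Fin n → ℝ) (u : Fin m → ℝ) : ℝ :=
  D.Φ z x p q u + ∑ j, ψ j * D.f z x p q u j

end ControlData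

/-- A control problem on `G` together with a control `u` and a state `x`. -/
structure ControlledPair (n m : ℕ) where
  C : BoundaryCurve
  D : ControlData n m
  u : ℝ × ℝ → (Fin m → ℝ)
  x : ℝ × ℝ → (Fin n → ℝ)

namespace ControlledPair

variable {n m : ℕ} (S : ControlledPair n m)

/-- Derivative with respect to `s` of a function on `G` (one-sided at boundary points); applied to
a composite function, it is the total derivative `D/Ds`. -/
noncomputable def ds {V : Type*} [NormedAddCommGroup V] [NormedSpace ℝ V]
    (g : ℝ × ℝ → V) (z : ℝ × ℝ) : V := fderivWithin ℝ g S.C.region z (1, 0)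

/-- Derivative with respect to `t` of a function on `G` (one-sided at boundary points). -/
noncomputable def dt {V : Type*} [NormedAddCommGroup V] [NormedSpace ℝ V]
    (g : ℝ × ℝ → V) (z : ℝ × ℝ) : V := fderivWithin ℝ g S.C.region z (0, 1)

/-- The state `x` is a `C²` solution of the Goursat-Darboux problem on `G` with control `u` (of
class `C¹`) and with data `x₁`, `x₂` on the axes. -/
structure IsTrajectory (x₁ x₂ : ℝ → (Fin n → ℝ)) : Prop where
  contDiffOn_u : ContDiffOn ℝ 1 S.u S.C.region
  contDiffOn_x : ContDiffOn ℝ 2 S.x S.C.region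
  state_eq : ∀ z ∈ interior S.C.region,
    S.dt (S.ds S.x) z = S.D.f z (S.x z) (S.ds S.x z) (S.dt S.x z) (S.u z)
  data₁ : ∀ s ∈ Icc 0 S.C.a, S.x (s, 0) = x₁ s
  data₂ : ∀ t ∈ Icc 0 S.C.b, S.x (0, t) = x₂ t

/-- `∂fⁱ/∂xᵏ` along the trajectory. -/
noncomputable def fx (i k : Fin n) (z : ℝ × ℝ) : ℝ :=
  pd (fun y => S.D.f z y (S.ds S.x z) (S.dt S.x z) (S.u z) i) (S.x z) k

/-- `∂fⁱ/∂pᵏ` along the trajectory. -/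
noncomputable def fp (i k : Fin n) (z : ℝ × ℝ) : ℝ :=
  pd (fun y => S.D.f z (S.x z) y (S.dt S.x z) (S.u z) i) (S.ds S.x z) k

/-- `∂fⁱ/∂qᵏ` along the trajectory. -/
noncomputable def fq (i k : Fin n) (z : ℝ × ℝ) : ℝ :=
  pd (fun y => S.D.f z (S.x z) (S.ds S.x z) y (S.u z) i) (S.dt S.x z) k

/-- `∂Φ/∂xⁱ` along the trajectory. -/
noncomputable def Φx (i : Fin n) (z : ℝ × ℝ) : ℝ :=
  pd (fun y => S.D.Φ z y (S.ds S.x z) (S.dt S.x z) (S.u z)) (S.x z) i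

/-- `∂Φ/∂pⁱ` along the trajectory. -/
noncomputable def Φp (i : Fin n) (z : ℝ × ℝ) : ℝ :=
  pd (fun y => S.D.Φ z (S.x z) y (S.dt S.x z) (S.u z)) (S.ds S.x z) i

/-- `∂Φ/∂qⁱ` along the trajectory. -/
noncomputable def Φq (i : Fin n) (z : ℝ × ℝ) : ℝ :=
  pd (fun y => S.D.Φ z (S.x z) (S.ds S.x z) y (S.u z)) (S.dt S.x z) i

/-- The tangential derivative `x_μ = -n₂ x_s + n₁ x_t` at the point of `(γ)` with parameter `μ`. -/
noncomputable def xμ (μ : ℝ) : Fin n → ℝ :=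
  -(S.C.n₂ μ) • S.ds S.x (S.C.point μ) + S.C.n₁ μ • S.dt S.x (S.C.point μ)

/-- `∂Φ₁/∂xⁱ` along `(γ)`. -/
noncomputable def Φ₁x (i : Fin n) (μ : ℝ) : ℝ :=
  pd (fun y => S.D.Φ₁ (S.C.point μ) y (S.xμ μ)) (S.x (S.C.point μ)) i

/-- `∂Φ₁/∂ηⁱ` along `(γ)`. -/
noncomputable def Φ₁η (i : Fin n) (μ : ℝ) : ℝ :=
  pd (fun y => S.D.Φ₁ (S.C.point μ) (S.x (S.C.point μ)) y) (S.xμ μ) i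

/-- `F_i = Φ_{xⁱ} - D/Ds Φ_{pⁱ} - D/Dt Φ_{qⁱ}` on `G`. -/
noncomputable def F (i : Fin n) (z : ℝ × ℝ) : ℝ :=
  S.Φx i z - S.ds (S.Φp i) z - S.dt (S.Φq i) z

/-- `F_{1,i} = n₁ Φ_{pⁱ} + n₂ Φ_{qⁱ} + Φ_{1,xⁱ} - D/Dμ Φ_{1,ηⁱ}` at the point of `(γ)` with
parameter `μ`. -/
noncomputable def F₁ (i : Fin n) (μ : ℝ) : ℝ :=
  S.C.n₁ μ * S.Φp i (S.C.point μ) + S.C.n₂ μ * S.Φq i (S.C.point μ) + S.Φ₁x i μ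
    - deriv (S.Φ₁η i) μ

/-- `F_{0,i}(P_r) = Φ_{0,xⁱ}(P_r, x(P_r)) - V_r(Φ_{1,ηⁱ})`, where `V_r` is the jump at `P_r` in
the direction of increasing arc length. -/
noncomputable def F₀ (i : Fin n) (r : Fin (S.C.N + 2)) : ℝ :=
  pd (S.D.Φ₀ (S.C.vertex r)) (S.x (S.C.vertex r)) i
    - (Function.rightLim (S.Φ₁η i) (S.C.vert r) - Function.leftLim (S.Φ₁η i) (S.C.vert r))

/-- `R w z i j = Rⁱ_j(w, z)`, for `w ∈ G` and `z ∈ W(w)`, is the (continuously differentiable)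
matrix-valued Riemann function of the linearized Goursat-Darboux problem.  The equations are
written for `z` off the axes; on the axes `R` is then determined by continuity. -/
structure IsRiemannFunction (R : ℝ × ℝ → ℝ × ℝ → Fin n → Fin n → ℝ) : Prop where
  contDiffOn : ∀ i j, ContDiffOn ℝ 1 (fun v : (ℝ × ℝ) × (ℝ × ℝ) => R v.1 v.2 i j)
    {v | v.1 ∈ S.C.region ∧ v.2 ∈ quadRect v.1}
  equation : ∀ z w : ℝ × ℝ, 0 < z.1 → 0 < z.2 → w ∈ interior S.C.region →
    z.1 < w.1 → z.2 < w.2 → ∀ i j,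
    HasDerivAt (fun t => deriv (fun s => R (s, t) z i j) w.1)
      (∑ k, (S.fx i k w * R w z k j
        + S.fp i k w * deriv (fun s => R (s, w.2) z k j) w.1
        + S.fq i k w * deriv (fun t => R (w.1, t) z k j) w.2)) w.2
  char_s : ∀ z : ℝ × ℝ, 0 < z.1 → 0 < z.2 → ∀ s, z.1 ≤ s → (s, z.2) ∈ S.C.region → ∀ i j,
    HasDerivWithinAt (fun s' => R (s', z.2) z i j)
      (∑ k, S.fq i k (s, z.2) * R (s, z.2) z k j)
      {s' | z.1 ≤ s' ∧ (s', z.2) ∈ S.C.region} s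
  char_t : ∀ z : ℝ × ℝ, 0 < z.1 → 0 < z.2 → ∀ t, z.2 ≤ t → (z.1, t) ∈ S.C.region → ∀ i j,
    HasDerivWithinAt (fun t' => R (z.1, t') z i j)
      (∑ k, S.fp i k (z.1, t) * R (z.1, t) z k j)
      {t' | z.2 ≤ t' ∧ (z.1, t') ∈ S.C.region} t
  diag : ∀ z ∈ S.C.region, 0 < z.1 → 0 < z.2 → ∀ i j, R z z i j = if i = j then 1 else 0

open scoped Classical in
/-- The co-state `ψ_j(s, t)` on `G`. -/
noncomputable def costate (R : ℝ × ℝ → ℝ × ℝ → Fin n → Fin n → ℝ) (z : ℝ × ℝ) (j : Fin n) : ℝ :=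
  (∫ w in S.C.upperSet z, ∑ i, S.F i w * R w z i j)
    + (∫ μ in S.C.upperArc z, ∑ i, S.F₁ i μ * R (S.C.point μ) z i j)
    + ∑ r : Fin S.C.N, if z ∈ quadRect (S.C.vertex r.succ.castSucc) then
        ∑ i, S.F₀ i r.succ.castSucc * R (S.C.vertex r.succ.castSucc) z i j else 0

/-- `∂H/∂pʲ` at the point `z`, along the trajectory and the co-state. -/
noncomputable def Hp (R : ℝ × ℝ → ℝ × ℝ → Fin n → Fin n → ℝ) (j : Fin n) (z : ℝ × ℝ) : ℝ :=
  pd (fun y => S.D.H z (S.x z) y (S.dt S.x z) (S.costate R z) (S.u z)) (S.ds S.x z) j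

/-- `∂H/∂qʲ` at the point `z`, along the trajectory and the co-state. -/
noncomputable def Hq (R : ℝ × ℝ → ℝ × ℝ → Fin n → Fin n → ℝ) (j : Fin n) (z : ℝ × ℝ) : ℝ :=
  pd (fun y => S.D.H z (S.x z) (S.ds S.x z) y (S.costate R z) (S.u z)) (S.dt S.x z) j

end ControlledPair

/-! The co-state at `z` only sees the parts of `G` and of the curve that lie above `z`. As `z` tends
to a point `P` of the curve, the two cases differ in what survives of these parts.

Flat part, say horizontal. Above a point `Q` of the segment there are only points of the same
horizontal line, so the area term vanishes and the co-state is a curve integral plus vertex terms.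
Along this line the characteristic equation is a linear differential equation, which makes the
kernel a transition matrix: `R(P', B) = R(P', Q) R(Q, B)`. Let `B` be a fixed later point of the
segment. Multiplying the row vector `ψ(Q)` by `R(Q, B)` freezes the second argument of the kernel at
`B`, and the product depends on `Q` only through the arc above `Q`. By the fundamental theorem of
calculus its derivative in arc length is `F₁ R(Q, B)`, while `R(Q, B)` has derivative `-f_q R(Q,
B)`. For `B` close to `Q` this matrix is invertible, hence `ψ' = F₁ + ψ f_q`, which is the asserted
identity for the normal `(0, 1)`. The kernel is never differentiated in its second argument, for
which no equation is assumed. The lemmas are `IsRegular.R_comp`, `hasDerivAt_of_vecMul_eq` and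
`horizontal_hasDerivAt`. The limit from inside `G` (`horizontal_tendsto`) holds because near `P` the
region stays below the line: the area above `z` is a thin strip, and the curve term converges by
domination.

Oblique part. Both coordinates are strictly monotone, so everything above `z` shrinks to `P`; the
densities are bounded, and `ψ → 0`. In the `s`-derivative, the change of the kernel and the moving
side of the region contribute at most a constant times measures that tend to zero. What survives is
the moving end of the arc, at the parameter `ν₀` with `L₁ ν₀ = s`: it contributes `F₁ R / L₁'(ν₀)`,
which tends to `-F₁ / n₂`. As `R(w, ·)` lives only below `w`, the Leibniz rule needs the special
form `hasDerivAt_integral_superlevel`.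

Vertical parts and `t`-derivatives follow by reflection in the diagonal (`costate_swap`). All of
this is done for an abstract `CostateData` with a curve parametrized by `ℝ`, and carried over by
`toData_isRegular` and `costate_eq_toData`. -/

/-! ### Auxiliary results on differential equations, measures and parameter integrals -/

/-- A linear system of ordinary differential equations with continuous coefficients has at most
one solution with a given initial value. -/
theorem linear_ode_unique {n : ℕ} {A : ℝ → Fin n → Fin n → ℝ} {a b : ℝ}
    (hA : ∀ i k, ContinuousOn (fun s => A s i k) (Icc a b)) {y y' : ℝ → Fin n → ℝ}
    (hy : ∀ s ∈ Icc a b, ∀ i,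
      HasDerivWithinAt (fun s => y s i) (∑ k, A s i k * y s k) (Icc a b) s)
    (hy' : ∀ s ∈ Icc a b, ∀ i,
      HasDerivWithinAt (fun s => y' s i) (∑ k, A s i k * y' s k) (Icc a b) s)
    (h0 : y a = y' a) : EqOn y y' (Icc a b) := by
  have hbd : ∃ M : ℝ, 0 ≤ M ∧ ∀ s ∈ Icc a b, ∀ i k, |A s i k| ≤ M := by
    have : ∀ i k, ∃ M : ℝ, ∀ s ∈ Icc a b, |A s i k| ≤ M := fun i k =>
      isCompact_Icc.exists_bound_of_continuousOn (hA i k)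
    choose M hM using this
    refine ⟨∑ i, ∑ k, |M i k|, by positivity, fun s hs i k => (hM i k s hs).trans ?_⟩
    calc M i k ≤ |M i k| := le_abs_self _
      _ ≤ ∑ k, |M i k| :=
        Finset.single_le_sum (f := fun k => |M i k|) (fun _ _ => abs_nonneg _) (Finset.mem_univ k)
      _ ≤ ∑ i, ∑ k, |M i k| :=
        Finset.single_le_sum (f := fun i => ∑ k, |M i k|)
          (fun _ _ => Finset.sum_nonneg fun _ _ => abs_nonneg _) (Finset.mem_univ i)
  obtain ⟨M, hM0, hM⟩ := hbd
  have hcont : ∀ {u : ℝ → Fin n → ℝ}, (∀ s ∈ Icc a b, ∀ i,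
      HasDerivWithinAt (fun s => u s i) (∑ k, A s i k * u s k) (Icc a b) s) →
      ContinuousOn u (Icc a b) := fun hu =>
    continuousOn_pi.2 fun i s hs => (hu s hs i).continuousWithinAt
  have hder : ∀ {u : ℝ → Fin n → ℝ}, (∀ s ∈ Icc a b, ∀ i,
      HasDerivWithinAt (fun s => u s i) (∑ k, A s i k * u s k) (Icc a b) s) →
      ∀ s ∈ Ico a b, HasDerivWithinAt u (fun i => ∑ k, A s i k * u s k) (Ici s) s := by
    intro u hu s hs
    refine hasDerivWithinAt_pi.2 fun i => ?_
    refine (hu s (Ico_subset_Icc_self hs) i).mono_of_mem_nhdsWithin ?_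
    exact mem_of_superset (Icc_mem_nhdsGE hs.2) (Icc_subset_Icc_left hs.1)
  -- In the sup norm a matrix with entries bounded by `M` has Lipschitz constant `n * M`, since a
  -- row has `n` entries.
  refine ODE_solution_unique_of_mem_Icc_right (v := fun s u i => ∑ k, A s i k * u k)
    (s := fun _ => univ) (K := ⟨n * M, mul_nonneg n.cast_nonneg hM0⟩) (fun s hs => ?_) (hcont hy) (hder hy)
    (fun _ _ => trivial) (hcont hy') (hder hy') (fun _ _ => trivial) h0
  refine LipschitzOnWith.of_dist_le_mul fun u _ u' _ => ?_
  refine (dist_pi_le_iff (mul_nonneg (mul_nonneg n.cast_nonneg hM0) dist_nonneg)).2 fun i => ?_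
  rw [Real.dist_eq, ← Finset.sum_sub_distrib]
  calc |∑ k, (A s i k * u k - A s i k * u' k)|
      ≤ ∑ k : Fin n, |A s i k * u k - A s i k * u' k| := Finset.abs_sum_le_sum_abs _ _
    _ ≤ ∑ k : Fin n, M * dist u u' := by
        refine Finset.sum_le_sum fun k _ => ?_
        rw [← mul_sub, abs_mul]
        exact mul_le_mul (hM s (Ico_subset_Icc_self hs) i k) (dist_le_pi_dist u u' k)
          (abs_nonneg _) hM0
    _ = n * M * dist u u' := by simp [mul_assoc]

/-- If the sets `X z` shrink to a point, their measure tends to zero. -/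
theorem tendsto_measureReal_of_shrink {α ι : Type*} [MeasurableSpace α] [TopologicalSpace α]
    {m : Measure α} [m.OuterRegular] [NullSingletonClass m] {l : Filter ι} {X : ι → Set α} {p : α}
    (h : ∀ U ∈ 𝓝 p, ∀ᶠ z in l, X z ⊆ U) : Tendsto (fun z => m.real (X z)) l (𝓝 0) := by
  have : Tendsto (fun z => m (X z)) l (𝓝 0) := by
    refine ENNReal.tendsto_nhds_zero.2 fun ε hε => ?_
    obtain ⟨U, hU, hUo, hUm⟩ := Set.exists_isOpen_lt_of_lt (μ := m) {p} ε (by simpa using hε)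
    filter_upwards [h U (hUo.mem_nhds (hU rfl))] with z hz
    exact (measure_mono hz).trans hUm.le
  exact (ENNReal.tendsto_toReal ENNReal.zero_ne_top).comp this

/-- If `p ν * U ν = q ν` for row vectors `p`, `q` and matrices `U`, then `p` is differentiable
where `q` and `U` are and `U` is invertible. -/
theorem hasDerivAt_of_vecMul_eq {n : ℕ} {p q : ℝ → Fin n → ℝ}
    {U : ℝ → Matrix (Fin n) (Fin n) ℝ} {p' : Fin n → ℝ} {U' : Matrix (Fin n) (Fin n) ℝ} {μ : ℝ}
    (hU : ∀ i j, HasDerivAt (fun ν => U ν i j) (U' i j) μ)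
    (hq : ∀ j, HasDerivAt (fun ν => q ν j) (∑ i, (p' i * U μ i j + p μ i * U' i j)) μ)
    (hdet : (U μ).det ≠ 0) (h : ∀ᶠ ν in 𝓝 μ, ∀ j, ∑ i, p ν i * U ν i j = q ν j) :
    ∀ j, HasDerivAt (fun ν => p ν j) (p' j) μ := by
  have hUc : ContinuousAt U μ := continuousAt_pi.2 fun i => continuousAt_pi.2 fun j =>
    (hU i j).continuousAt
  have hdetc : ContinuousAt (fun ν => (U ν).det) μ :=
    (continuous_id.matrix_det.continuousAt (x := U μ)).comp hUc
  have hadj : ContinuousAt (fun ν => (U ν).adjugate) μ :=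
    (continuous_id.matrix_adjugate.continuousAt (x := U μ)).comp hUc
  have hne : ∀ᶠ ν in 𝓝 μ, (U ν).det ≠ 0 := hdetc.eventually_ne hdet
  have key : ∀ {ν : ℝ} (a : Fin n → ℝ) (k : Fin n), (U ν).det ≠ 0 →
      ∑ j, (∑ i, a i * U ν i j) * ((U ν).det⁻¹ * (U ν).adjugate j k) = a k := by
    intro ν a k hν
    have h1 : Matrix.vecMul (Matrix.vecMul a (U ν)) ((U ν).det⁻¹ • (U ν).adjugate) = a := by
      rw [Matrix.vecMul_vecMul, Matrix.mul_smul, Matrix.mul_adjugate, smul_smul,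
        inv_mul_cancel₀ hν, one_smul, Matrix.vecMul_one]
    simpa [Matrix.vecMul, dotProduct] using congrFun h1 k
  intro k
  rw [hasDerivAt_iff_tendsto_slope]
  -- No regularity of `p` is assumed. The difference quotients satisfy `slope q = slope p * U ν + p
  -- μ * slope U`, so `slope p = (slope q - p μ * slope U) * (U ν)⁻¹`, and everything on the right
  -- converges. The inverse is written with the adjugate to have its continuity.
  have hlim : Tendsto (fun ν => ∑ j, (slope (fun ν => q ν j) μ ν
      - ∑ i, p μ i * slope (fun ν => U ν i j) μ ν) * ((U ν).det⁻¹ * (U ν).adjugate j k))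
      (𝓝[≠] μ) (𝓝 (∑ j, (∑ i, (p' i * U μ i j + p μ i * U' i j) - ∑ i, p μ i * U' i j)
        * ((U μ).det⁻¹ * (U μ).adjugate j k))) := by
    refine tendsto_finsetSum _ fun j _ => Tendsto.mul (Tendsto.sub ?_ ?_) (Tendsto.mul ?_ ?_)
    · exact hasDerivAt_iff_tendsto_slope.1 (hq j)
    · exact tendsto_finsetSum _ fun i _ =>
        (hasDerivAt_iff_tendsto_slope.1 (hU i j)).const_mul _
    · exact ((hdetc.inv₀ hdet).tendsto).mono_left nhdsWithin_le_nhds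
    · have := (continuousAt_pi.1 ((continuousAt_pi.1 hadj) j)) k
      exact this.tendsto.mono_left nhdsWithin_le_nhds
  have hval : ∑ j, (∑ i, (p' i * U μ i j + p μ i * U' i j) - ∑ i, p μ i * U' i j)
        * ((U μ).det⁻¹ * (U μ).adjugate j k) = p' k := by
    rw [← key p' k hdet]
    refine Finset.sum_congr rfl fun j _ => ?_
    rw [Finset.sum_add_distrib, add_sub_cancel_right]
  rw [hval] at hlim
  refine hlim.congr' ?_
  filter_upwards [h.filter_mono nhdsWithin_le_nhds, hne.filter_mono nhdsWithin_le_nhds] with ν h1 h2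
  have h0 := h.self_of_nhds
  have h3 := key (fun i => slope (fun ν => p ν i) μ ν) k h2
  rw [← h3]
  refine Finset.sum_congr rfl fun j _ => ?_
  congr 1
  simp only [slope_def_field]
  rw [← h1 j, ← h0 j, ← Finset.sum_sub_distrib, Finset.sum_div, ← Finset.sum_sub_distrib]
  exact Finset.sum_congr rfl fun i _ => by ring

/-- Differentiation of an integral over the superlevel set `{s ≤ h}` whose integrand depends on
`s` as well. -/
theorem hasDerivAt_integral_superlevel {X : Type*} [MeasurableSpace X] {m : Measure X}
    [IsFiniteMeasure m] {h : X → ℝ} (hh : Measurable h) {k : X → ℝ → ℝ} {s₀ δ Λ B' : ℝ}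
    (hδ : 0 < δ) (hΛ : 0 ≤ Λ)
    (hmeas : ∀ s, s₀ - δ < s →
      AEStronglyMeasurable (fun w => k w s) (m.restrict {w | s ≤ h w}))
    (hdiag : AEStronglyMeasurable (fun w => k w (h w)) m)
    (hlow : ∀ᵐ w ∂m, s₀ - δ < h w)
    (hbound : ∀ᵐ w ∂m, ∀ s, s₀ - δ < s → s ≤ h w → |k w s| ≤ Λ)
    (hlip : ∀ᵐ w ∂m, ∀ s s', s₀ - δ < s → s ≤ s' → s' ≤ h w → |k w s' - k w s| ≤ Λ * (s' - s))
    (hdiff : ∀ᵐ w ∂m, s₀ < h w → DifferentiableAt ℝ (k w) s₀)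
    (hnull : m {w | h w = s₀} = 0)
    (hB : HasDerivAt (fun s => ∫ w in {w | s ≤ h w}, k w (h w) ∂m) B' s₀) :
    ∃ d, |d| ≤ Λ * m.real {w | s₀ ≤ h w} ∧
      HasDerivAt (fun s => ∫ w in {w | s ≤ h w}, k w s ∂m) (d + B') s₀ := by
  have hset : ∀ s, MeasurableSet {w | s ≤ h w} := fun s => measurableSet_le measurable_const hh
  -- Subtracting the value at the exit time `h w` makes the integrand vanish at the edge of the
  -- superlevel set, so its extension by zero is still Lipschitz in `s` and dominated
  -- differentiation applies. The subtracted part has an integrand free of `s`; its derivative is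
  -- the hypothesis `hB`.
  set φ : ℝ → X → ℝ := fun s => indicator {w | s ≤ h w} fun w => k w s - k w (h w) with hφ
  have hφm : ∀ s, s₀ - δ < s → AEStronglyMeasurable (φ s) m := fun s hs =>
    (aestronglyMeasurable_indicator_iff (hset s)).2 ((hmeas s hs).sub hdiag.restrict)
  have hdiagI : Integrable (fun w => k w (h w)) m := by
    refine Integrable.of_bound hdiag Λ ?_
    filter_upwards [hlow, hbound] with w h1 h2 using h2 _ h1 le_rfl
  have hnear : Ioi (s₀ - δ) ∈ 𝓝 s₀ := Ioi_mem_nhds (by linarith)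
  have hφlip : ∀ᵐ w ∂m, LipschitzOnWith (Real.nnabs Λ) (fun s => φ s w) (Ioi (s₀ - δ)) := by
    filter_upwards [hlip] with w hw
    have hmono : ∀ s s', s₀ - δ < s → s ≤ s' → |φ s' w - φ s w| ≤ Λ * (s' - s) := by
      intro s s' hs hss
      simp only [hφ, indicator_apply, mem_ofPred_eq]
      by_cases h1 : s' ≤ h w
      · rw [if_pos h1, if_pos (hss.trans h1)]
        simpa using hw s s' hs hss h1
      · rw [if_neg h1]
        by_cases h2 : s ≤ h w
        · rw [if_pos h2, zero_sub, neg_sub]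
          refine (hw s (h w) hs h2 le_rfl).trans ?_
          exact mul_le_mul_of_nonneg_left (by linarith [not_le.1 h1]) hΛ
        · rw [if_neg h2]
          simpa using mul_nonneg hΛ (sub_nonneg.2 hss)
    refine LipschitzOnWith.of_dist_le_mul fun s hs s' hs' => ?_
    rw [Real.coe_nnabs, abs_of_nonneg hΛ, Real.dist_eq, Real.dist_eq]
    rcases le_total s s' with h1 | h1
    · rw [abs_sub_comm, abs_sub_comm s, abs_of_nonneg (sub_nonneg.2 h1)]
      exact hmono s s' hs h1
    · rw [abs_of_nonneg (sub_nonneg.2 h1)]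
      exact hmono s' s hs' h1
  have hφI : ∀ s, s₀ - δ < s → Integrable (φ s) m := by
    intro s hs
    refine Integrable.of_bound (hφm s hs) (Λ + Λ) ?_
    filter_upwards [hlow, hbound] with w h1 h2
    simp only [hφ, indicator_apply, mem_ofPred_eq]
    split_ifs with h3
    · exact (norm_sub_le _ _).trans (add_le_add (h2 s hs h3) (h2 _ h1 le_rfl))
    · simpa using hΛ
  have hne : ∀ᵐ w ∂m, h w ≠ s₀ := by
    rw [ae_iff]
    simpa using hnull
  have hzero : ∀ w, h w < s₀ → HasDerivAt (fun s => φ s w) 0 s₀ := by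
    intro w hw
    refine (hasDerivAt_const s₀ (0 : ℝ)).congr_of_eventuallyEq ?_
    filter_upwards [Ioi_mem_nhds hw] with s hs
    exact indicator_of_notMem (s := {w | s ≤ h w}) (fun h1 => not_le.2 (mem_Ioi.1 hs) h1) _
  have hder : ∀ᵐ w ∂m, HasDerivAt (fun s => φ s w) (deriv (fun s => φ s w) s₀) s₀ := by
    filter_upwards [hne, hdiff] with w h1 h2
    rcases lt_or_gt_of_ne h1 with h3 | h3
    · exact (hzero w h3).differentiableAt.hasDerivAt
    · refine DifferentiableAt.hasDerivAt (((h2 h3).sub_const (k w (h w))).congr_of_eventuallyEq ?_)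
      filter_upwards [Iio_mem_nhds h3] with s hs
      exact indicator_of_mem (s := {w | s ≤ h w}) (mem_ofPred_eq ▸ (mem_Iio.1 hs).le) _
  -- The derivative is measurable as an almost everywhere limit of difference quotients along a
  -- sequence.
  have hseq : Tendsto (fun N : ℕ => s₀ + 1 / ((N : ℝ) + 1)) atTop (𝓝[≠] s₀) := by
    refine tendsto_nhdsWithin_iff.2 ⟨?_, Eventually.of_forall fun N => ?_⟩
    · simpa using tendsto_one_div_add_atTop_nhds_zero_nat.const_add s₀
    · have : 0 < 1 / ((N : ℝ) + 1) := by positivity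
      simp only [mem_compl_iff, mem_singleton_iff]
      linarith
  have hderm : AEStronglyMeasurable (fun w => deriv (fun s => φ s w) s₀) m := by
    refine aestronglyMeasurable_of_tendsto_ae atTop
      (f := fun (N : ℕ) w => slope (fun s => φ s w) s₀ (s₀ + 1 / ((N : ℝ) + 1))) (fun N => ?_) ?_
    · have : 0 < 1 / ((N : ℝ) + 1) := by positivity
      simp only [slope_def_field]
      simp only [div_eq_mul_inv]
      exact ((hφm (s₀ + 1 / ((N : ℝ) + 1)) (by linarith)).sub
        (hφm s₀ (by linarith))).mul_const _
    · filter_upwards [hder] with w hw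
      exact (hasDerivAt_iff_tendsto_slope.1 hw).comp hseq
  have hφd := (hasDerivAt_integral_of_dominated_loc_of_lip (bound := fun _ => Λ) hnear
    (by filter_upwards [hnear] with s hs using hφm s hs) (hφI s₀ (by linarith)) hderm hφlip
    (integrable_const _) hder).2
  refine ⟨∫ w, deriv (fun s => φ s w) s₀ ∂m, ?_, ?_⟩
  -- Where `h w < s₀` the function `φ · w` vanishes near `s₀`, so only the superlevel set enters the
  -- bound.
  · have h1 : ∫ w, deriv (fun s => φ s w) s₀ ∂m
        = ∫ w in {w | s₀ ≤ h w}, deriv (fun s => φ s w) s₀ ∂m := by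
      refine (setIntegral_eq_integral_of_forall_compl_eq_zero fun w hw => ?_).symm
      exact (hzero w (not_le.1 hw)).deriv
    rw [h1, ← Real.norm_eq_abs]
    refine norm_setIntegral_le_of_norm_le_const_ae (measure_lt_top _ _) ?_
    filter_upwards [ae_restrict_of_ae hφlip] with w hw
    have := norm_deriv_le_of_lipschitzOn hnear hw
    simpa [abs_of_nonneg hΛ] using this
  · refine (hφd.add hB).congr_of_eventuallyEq ?_
    filter_upwards [hnear] with s hs
    have hint : Integrable (fun w => k w s) (m.restrict {w | s ≤ h w}) := by
      refine Integrable.of_bound (hmeas s hs) Λ ?_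
      refine (ae_restrict_iff' (hset s)).2 ?_
      filter_upwards [hbound] with w hw h1 using hw s hs h1
    have h1 : ∫ w, φ s w ∂m = ∫ w in {w | s ≤ h w}, (k w s - k w (h w)) ∂m :=
      integral_indicator (hset s)
    simp only [Pi.add_apply]
    rw [h1, integral_sub hint hdiagI.restrict, sub_add_cancel]

/-! ### The abstract co-state: compactness, bounds and measurability -/

/-- The ingredients of the co-state formula: a curve `(L₁, L₂)`, parametrized by the whole real
line and positive only on a bounded set of parameters, the marked parameters `v`, the densities
`F`, `F₁`, `F₀`, the kernel `R` and the coefficients `A`, `B` of its characteristic equations. -/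
structure CostateData (n : ℕ) where
  L₁ : ℝ → ℝ
  L₂ : ℝ → ℝ
  N : ℕ
  v : Fin N → ℝ
  F : Fin n → ℝ × ℝ → ℝ
  F₁ : Fin n → ℝ → ℝ
  F₀ : Fin n → Fin N → ℝ
  R : ℝ × ℝ → ℝ × ℝ → Fin n → Fin n → ℝ
  A : ℝ × ℝ → Fin n → Fin n → ℝ
  B : ℝ × ℝ → Fin n → Fin n → ℝ

namespace CostateData

variable {n : ℕ} (D : CostateData n)

/-- The point of the curve with parameter `ν`. -/
def γ (ν : ℝ) : ℝ × ℝ := (D.L₁ ν, D.L₂ ν)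

/-- The part of the open quadrant below the curve. -/
def G : Set (ℝ × ℝ) := {w | 0 < w.1 ∧ 0 < w.2 ∧ ∃ ν, w ≤ D.γ ν}

/-- The domain of the kernel. -/
def T : Set ((ℝ × ℝ) × (ℝ × ℝ)) := {v | 0 < v.2.1 ∧ 0 < v.2.2 ∧ v.2 ≤ v.1 ∧ v.1 ∈ D.G}

/-- The points of `G` above `z`. -/
def E (z : ℝ × ℝ) : Set (ℝ × ℝ) := {w | w ∈ D.G ∧ z ≤ w}

/-- The parameters of the points of the curve above `z`. -/
def arc (z : ℝ × ℝ) : Set ℝ := {ν | z ≤ D.γ ν}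

/-- The density of the area term. -/
def k (j : Fin n) (w z : ℝ × ℝ) : ℝ := ∑ i, D.F i w * D.R w z i j

/-- The density of the curve term. -/
def κ (j : Fin n) (ν : ℝ) (z : ℝ × ℝ) : ℝ := ∑ i, D.F₁ i ν * D.R (D.γ ν) z i j

open scoped Classical in
/-- The co-state. -/
noncomputable def costate (z : ℝ × ℝ) (j : Fin n) : ℝ :=
  (∫ w in D.E z, D.k j w z) + (∫ ν in D.arc z, D.κ j ν z)
    + ∑ r, if z ≤ D.γ (D.v r) then ∑ i, D.F₀ i r * D.R (D.γ (D.v r)) z i j else 0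

/-- The hypotheses on the data. -/
structure IsRegular : Prop where
  cont₁ : Continuous D.L₁
  cont₂ : Continuous D.L₂
  anti : Antitone D.L₁
  mono : Monotone D.L₂
  bdd : Bornology.IsBounded {ν | 0 < D.L₁ ν ∧ 0 < D.L₂ ν}
  F_cont : ∀ i, ContinuousOn (D.F i) D.G
  F₁_cont : ∀ i ν, 0 < D.L₁ ν → 0 < D.L₂ ν → (∀ r, D.v r ≠ ν) → ContinuousAt (D.F₁ i) ν
  F₁_bdd : ∀ i, ∀ q : ℝ × ℝ, 0 < q.1 → 0 < q.2 → ∃ M, ∀ ν, q ≤ D.γ ν → |D.F₁ i ν| ≤ M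
  R_smooth : ∀ i j, ContDiffOn ℝ 1 (fun v : (ℝ × ℝ) × (ℝ × ℝ) => D.R v.1 v.2 i j) D.T
  A_cont : ∀ i k, ContinuousOn (fun w => D.A w i k) D.G
  B_cont : ∀ i k, ContinuousOn (fun w => D.B w i k) D.G
  char_s : ∀ z : ℝ × ℝ, 0 < z.1 → 0 < z.2 → ∀ s, z.1 ≤ s → (s, z.2) ∈ D.G → ∀ i j,
    HasDerivWithinAt (fun s' => D.R (s', z.2) z i j)
      (∑ k, D.A (s, z.2) i k * D.R (s, z.2) z k j) {s' | z.1 ≤ s' ∧ (s', z.2) ∈ D.G} s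
  char_t : ∀ z : ℝ × ℝ, 0 < z.1 → 0 < z.2 → ∀ t, z.2 ≤ t → (z.1, t) ∈ D.G → ∀ i j,
    HasDerivWithinAt (fun t' => D.R (z.1, t') z i j)
      (∑ k, D.B (z.1, t) i k * D.R (z.1, t) z k j) {t' | z.2 ≤ t' ∧ (z.1, t') ∈ D.G} t
  diag : ∀ z ∈ D.G, ∀ i j, D.R z z i j = if i = j then 1 else 0

variable {D}

theorem mem_arc {ν : ℝ} {z : ℝ × ℝ} : ν ∈ D.arc z ↔ z ≤ D.γ ν := Iff.rfl

theorem mem_arc' {ν : ℝ} {z : ℝ × ℝ} : ν ∈ D.arc z ↔ z.1 ≤ D.L₁ ν ∧ z.2 ≤ D.L₂ ν := Iff.rfl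

theorem γ_mem_G {ν : ℝ} (h₁ : 0 < D.L₁ ν) (h₂ : 0 < D.L₂ ν) : D.γ ν ∈ D.G :=
  ⟨h₁, h₂, ν, le_rfl⟩

theorem mem_G_of_le {w z : ℝ × ℝ} (hw : w ∈ D.G) (h₁ : 0 < z.1) (h₂ : 0 < z.2) (h : z ≤ w) :
    z ∈ D.G := by
  obtain ⟨_, _, ν, hν⟩ := hw
  exact ⟨h₁, h₂, ν, h.trans hν⟩

theorem γ_mem_G_of_le {z : ℝ × ℝ} (h₁ : 0 < z.1) (h₂ : 0 < z.2) {ν : ℝ} (h : z ≤ D.γ ν) :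
    D.γ ν ∈ D.G :=
  γ_mem_G (h₁.trans_le h.1) (h₂.trans_le h.2)

theorem γ_mem_E {z : ℝ × ℝ} (h₁ : 0 < z.1) (h₂ : 0 < z.2) {ν : ℝ} (h : ν ∈ D.arc z) :
    D.γ ν ∈ D.E z := ⟨γ_mem_G_of_le h₁ h₂ h, h⟩

theorem E_anti {z z' : ℝ × ℝ} (h : z ≤ z') : D.E z' ⊆ D.E z := fun _ hw => ⟨hw.1, h.trans hw.2⟩

theorem arc_anti {z z' : ℝ × ℝ} (h : z ≤ z') : D.arc z' ⊆ D.arc z := fun _ hw =>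
  h.trans (mem_arc.1 hw)

namespace IsRegular

theorem continuous_γ (hD : D.IsRegular) : Continuous D.γ := hD.cont₁.prodMk hD.cont₂

theorem isClosed_arc (hD : D.IsRegular) (z : ℝ × ℝ) : IsClosed (D.arc z) := isClosed_le continuous_const hD.continuous_γ

theorem isCompact_arc (hD : D.IsRegular) {z : ℝ × ℝ} (h₁ : 0 < z.1) (h₂ : 0 < z.2) : IsCompact (D.arc z) :=
  Metric.isCompact_of_isClosed_isBounded (hD.isClosed_arc z)
    (hD.bdd.subset fun _ hν => ⟨h₁.trans_le (mem_arc'.1 hν).1, h₂.trans_le (mem_arc'.1 hν).2⟩)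

/-- `G` is not closed, but a lower bound `q` off the axes keeps the pairs away from the missing
edges. Adding a parameter `ν` with `w ≤ γ ν` as a witness turns the set into a projection of a
closed set, bounded because `ν` runs in the compact arc above `q`. -/
theorem isCompact_kernel (hD : D.IsRegular) {q : ℝ × ℝ} (h₁ : 0 < q.1) (h₂ : 0 < q.2) :
    IsCompact {v : (ℝ × ℝ) × (ℝ × ℝ) | q ≤ v.2 ∧ v.2 ≤ v.1 ∧ v.1 ∈ D.G} := by
  obtain ⟨c, hc⟩ := ((hD.isCompact_arc h₁ h₂).image hD.continuous_γ).isBounded.bddAbove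
  have hK : IsCompact {v : ((ℝ × ℝ) × (ℝ × ℝ)) × ℝ |
      q ≤ v.1.2 ∧ v.1.2 ≤ v.1.1 ∧ v.1.1 ≤ D.γ v.2} := by
    refine ((isCompact_Icc (a := q) (b := c)).prod (isCompact_Icc (a := q) (b := c))).prod
      (hD.isCompact_arc h₁ h₂) |>.of_isClosed_subset ?_ ?_
    · have hc := hD.continuous_γ
      have h1 : IsClosed {v : ((ℝ × ℝ) × (ℝ × ℝ)) × ℝ | q ≤ v.1.2} :=
        isClosed_le continuous_const (by fun_prop)
      have h2 : IsClosed {v : ((ℝ × ℝ) × (ℝ × ℝ)) × ℝ | v.1.2 ≤ v.1.1} :=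
        isClosed_le (by fun_prop) (by fun_prop)
      have h3 : IsClosed {v : ((ℝ × ℝ) × (ℝ × ℝ)) × ℝ | v.1.1 ≤ D.γ v.2} :=
        isClosed_le (by fun_prop) (by fun_prop)
      exact h1.inter (h2.inter h3)
    · rintro ⟨⟨w, z⟩, ν⟩ ⟨hz, hzw, hw⟩
      have hν : ν ∈ D.arc q := mem_arc.2 ((hz.trans hzw).trans hw)
      have := hc (mem_image_of_mem _ hν)
      exact ⟨⟨⟨hz.trans hzw, hw.trans this⟩, ⟨hz, (hzw.trans hw).trans this⟩⟩, hν⟩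
  convert hK.image continuous_fst using 1
  ext ⟨w, z⟩
  constructor
  · rintro ⟨hz, hzw, _, _, ν, hν⟩
    exact ⟨⟨⟨w, z⟩, ν⟩, ⟨hz, hzw, hν⟩, rfl⟩
  · rintro ⟨⟨⟨w', z'⟩, ν⟩, ⟨hz, hzw, hν⟩, h⟩
    obtain ⟨rfl, rfl⟩ := Prod.mk.inj h
    exact ⟨hz, hzw, h₁.trans_le (hz.trans hzw).1, h₂.trans_le (hz.trans hzw).2, ν, hν⟩

theorem isCompact_E (hD : D.IsRegular) {q : ℝ × ℝ} (h₁ : 0 < q.1) (h₂ : 0 < q.2) : IsCompact (D.E q) := by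
  convert (hD.isCompact_kernel h₁ h₂).image continuous_fst using 1
  ext w
  constructor
  · rintro ⟨hw, hq⟩
    exact ⟨⟨w, w⟩, ⟨hq, le_rfl, hw⟩, rfl⟩
  · rintro ⟨⟨w', z'⟩, ⟨hz, hzw, hν⟩, rfl⟩
    exact ⟨hν, hz.trans hzw⟩

theorem continuousOn_R (hD : D.IsRegular) (i j : Fin n) :
    ContinuousOn (fun v : (ℝ × ℝ) × (ℝ × ℝ) => D.R v.1 v.2 i j) D.T :=
  (hD.R_smooth i j).continuousOn

theorem continuousOn_k (hD : D.IsRegular) (j : Fin n) :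
    ContinuousOn (fun v : (ℝ × ℝ) × (ℝ × ℝ) => D.k j v.1 v.2) D.T :=
  continuousOn_finsetSum _ fun i _ =>
    ((hD.F_cont i).comp continuousOn_fst fun _ hv => hv.2.2.2).mul (hD.continuousOn_R i j)

theorem exists_bound_R (hD : D.IsRegular) {q : ℝ × ℝ} (h₁ : 0 < q.1) (h₂ : 0 < q.2) : ∃ M, 0 ≤ M ∧
    ∀ w z, q ≤ z → z ≤ w → w ∈ D.G → ∀ i j, |D.R w z i j| ≤ M := by
  have : ∀ i j, ∃ M, ∀ v ∈ {v : (ℝ × ℝ) × (ℝ × ℝ) | q ≤ v.2 ∧ v.2 ≤ v.1 ∧ v.1 ∈ D.G},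
      ‖D.R v.1 v.2 i j‖ ≤ M := fun i j =>
    (hD.isCompact_kernel h₁ h₂).exists_bound_of_continuousOn ((hD.continuousOn_R i j).mono
      fun v hv => ⟨h₁.trans_le hv.1.1, h₂.trans_le hv.1.2, hv.2⟩)
  choose M hM using this
  refine ⟨∑ i, ∑ j, |M i j|, by positivity, fun w z hz hzw hw i j =>
    (hM i j (w, z) ⟨hz, hzw, hw⟩).trans ?_⟩
  calc M i j ≤ |M i j| := le_abs_self _
    _ ≤ ∑ j, |M i j| :=
      Finset.single_le_sum (f := fun k => |M i k|) (fun _ _ => abs_nonneg _) (Finset.mem_univ j)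
    _ ≤ ∑ i, ∑ j, |M i j| :=
      Finset.single_le_sum (f := fun i => ∑ k, |M i k|)
        (fun _ _ => Finset.sum_nonneg fun _ _ => abs_nonneg _) (Finset.mem_univ i)

theorem exists_bound_F (hD : D.IsRegular) {q : ℝ × ℝ} (h₁ : 0 < q.1) (h₂ : 0 < q.2) : ∃ M, 0 ≤ M ∧
    (∀ w, q ≤ w → w ∈ D.G → ∀ i, |D.F i w| ≤ M) ∧ ∀ ν, q ≤ D.γ ν → ∀ i, |D.F₁ i ν| ≤ M := by
  have : ∀ i, ∃ M, ∀ w ∈ D.E q, ‖D.F i w‖ ≤ M := fun i =>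
    (hD.isCompact_E h₁ h₂).exists_bound_of_continuousOn ((hD.F_cont i).mono fun v hv => hv.1)
  choose M hM using this
  choose M' hM' using fun i => hD.F₁_bdd i q h₁ h₂
  have hle : ∀ i, M i ≤ ∑ i, (|M i| + |M' i|) ∧ M' i ≤ ∑ i, (|M i| + |M' i|) := by
    intro i
    have := Finset.single_le_sum (f := fun i => |M i| + |M' i|) (s := Finset.univ)
      (fun _ _ => by positivity) (Finset.mem_univ i)
    constructor <;> linarith [le_abs_self (M i), le_abs_self (M' i), abs_nonneg (M i),
      abs_nonneg (M' i)]
  exact ⟨∑ i, (|M i| + |M' i|), by positivity,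
    fun w hw hwG i => (hM i w ⟨hwG, hw⟩).trans (hle i).1,
    fun ν hν i => (hM' i ν hν).trans (hle i).2⟩

/-- One constant serves for both densities and for every corner above `q`; later `q` is half of the
limit point. -/
theorem exists_bound_density (hD : D.IsRegular) {q : ℝ × ℝ} (h₁ : 0 < q.1) (h₂ : 0 < q.2) (j : Fin n) : ∃ M, 0 ≤ M ∧
    (∀ w z, q ≤ z → w ∈ D.E z → |D.k j w z| ≤ M) ∧
    ∀ ν z, q ≤ z → ν ∈ D.arc z → |D.κ j ν z| ≤ M := by
  obtain ⟨M, hM0, hM⟩ := hD.exists_bound_R h₁ h₂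
  obtain ⟨M', hM'0, hF, hF₁⟩ := hD.exists_bound_F h₁ h₂
  have hsum : ∀ f g : Fin n → ℝ, (∀ i, |f i| ≤ M') → (∀ i, |g i| ≤ M) →
      |∑ i, f i * g i| ≤ n * (M' * M) := by
    intro f g hf hg
    calc |∑ i, f i * g i| ≤ ∑ i, |f i * g i| := Finset.abs_sum_le_sum_abs _ _
      _ ≤ ∑ _i : Fin n, M' * M := Finset.sum_le_sum fun i _ => by
          rw [abs_mul]
          exact mul_le_mul (hf i) (hg i) (abs_nonneg _) hM'0
      _ = n * (M' * M) := by simp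
  refine ⟨n * (M' * M), by positivity, fun w z hz hw => hsum _ _ ?_ ?_,
    fun ν z hz hν => hsum _ _ ?_ ?_⟩
  · exact fun i => hF w (hz.trans hw.2) hw.1 i
  · exact fun i => hM w z hz hw.2 hw.1 i j
  · exact fun i => hF₁ ν (hz.trans (mem_arc.1 hν)) i
  · have hz₁ := h₁.trans_le hz.1
    have hz₂ := h₂.trans_le hz.2
    exact fun i => hM _ z hz (mem_arc.1 hν) (γ_mem_G_of_le hz₁ hz₂ (mem_arc.1 hν)) i j

theorem measurableSet_arc (hD : D.IsRegular) (z : ℝ × ℝ) : MeasurableSet (D.arc z) := (hD.isClosed_arc z).measurableSet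

/-- A density along the curve composed with the kernel is measurable. -/
theorem aestronglyMeasurable_arc (hD : D.IsRegular) {q : ℝ × ℝ} (h₁ : 0 < q.1) (h₂ : 0 < q.2) {ζ : ℝ → ℝ × ℝ}
    (hζ : Continuous ζ) {S : Set ℝ} (hS : MeasurableSet S) (hSq : S ⊆ D.arc q)
    (hζS : ∀ ν ∈ S, 0 < (ζ ν).1 ∧ 0 < (ζ ν).2 ∧ ζ ν ≤ D.γ ν) (i j : Fin n) :
    AEStronglyMeasurable (fun ν => D.F₁ i ν * D.R (D.γ ν) (ζ ν) i j) (volume.restrict S) := by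
  -- `F₁` may jump at the marked parameters. They are finitely many, hence null, and off them the
  -- integrand is continuous.
  have hfin : (range D.v).Finite := finite_range _
  have hnull : volume (range D.v) = 0 := hfin.measure_zero _
  have hset : (S \ range D.v : Set ℝ) =ᵐ[volume] S := sdiff_null_ae_eq_self hnull
  rw [← Measure.restrict_congr_set hset]
  refine ContinuousOn.aestronglyMeasurable (fun ν hν => ?_) (hS.diff hfin.measurableSet)
  have hq := mem_arc'.1 (hSq hν.1)
  have hp := hζS ν hν.1
  refine ContinuousWithinAt.mul (hD.F₁_cont i ν (h₁.trans_le hq.1) (h₂.trans_le hq.2)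
    (fun r hr => hν.2 ⟨r, hr⟩)).continuousWithinAt ?_
  refine (hD.continuousOn_R i j (D.γ ν, ζ ν) ⟨hp.1, hp.2.1, hp.2.2,
    γ_mem_G_of_le hp.1 hp.2.1 hp.2.2⟩).comp
    (f := fun ν => (D.γ ν, ζ ν)) (hD.continuous_γ.prodMk hζ).continuousWithinAt fun ν' hν' => ?_
  have hp' := hζS ν' hν'.1
  exact ⟨hp'.1, hp'.2.1, hp'.2.2, γ_mem_G_of_le hp'.1 hp'.2.1 hp'.2.2⟩

theorem integrableOn_arc (hD : D.IsRegular) {q : ℝ × ℝ} (h₁ : 0 < q.1) (h₂ : 0 < q.2) {z : ℝ × ℝ} (hz : q ≤ z)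
    {S : Set ℝ} (hS : MeasurableSet S) (hSz : S ⊆ D.arc z) (i j : Fin n) :
    IntegrableOn (fun ν => D.F₁ i ν * D.R (D.γ ν) z i j) S := by
  obtain ⟨M, hM0, hM⟩ := hD.exists_bound_R h₁ h₂
  obtain ⟨M', hM'0, hF, hF₁⟩ := hD.exists_bound_F h₁ h₂
  have hz₁ := h₁.trans_le hz.1
  have hz₂ := h₂.trans_le hz.2
  refine IntegrableOn.of_bound (C := M' * M) ?_ ?_ ?_
  · exact (measure_mono hSz).trans_lt (hD.isCompact_arc hz₁ hz₂).measure_lt_top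
  · exact hD.aestronglyMeasurable_arc hz₁ hz₂ continuous_const hS hSz
      (fun ν hν => ⟨hz₁, hz₂, hSz hν⟩) i j
  · refine (ae_restrict_iff' hS).2 (Eventually.of_forall fun ν hν => ?_)
    have h := mem_arc.1 (hSz hν)
    rw [Real.norm_eq_abs, abs_mul]
    exact mul_le_mul (hF₁ ν (hz.trans h) i) (hM _ z hz h (γ_mem_G_of_le hz₁ hz₂ h) i j)
      (abs_nonneg _) hM'0

end IsRegular

end CostateData

/-! ### Horizontal parts: transition property and limit of the co-state -/

namespace CostateData

variable {n : ℕ} {D : CostateData n}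

/-- Along a horizontal line the kernel is a transition matrix. -/
theorem IsRegular.R_comp (hD : D.IsRegular) {z : ℝ × ℝ} (h₁ : 0 < z.1) (h₂ : 0 < z.2) {s₁ s₂ : ℝ}
    (hs₁ : z.1 ≤ s₁) (hs₂ : s₁ ≤ s₂) (hG : (s₂, z.2) ∈ D.G) (i j : Fin n) :
    D.R (s₂, z.2) z i j = ∑ k, D.R (s₂, z.2) (s₁, z.2) i k * D.R (s₁, z.2) z k j := by
  have hseg : ∀ s ∈ Icc s₁ s₂, (s, z.2) ∈ D.G := fun s hs =>
    mem_G_of_le hG ((h₁.trans_le hs₁).trans_le hs.1) h₂ ⟨hs.2, le_rfl⟩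
  -- As functions of `s`, both sides solve the characteristic equation along the line, and they
  -- agree at `s₁` because the kernel is the identity on the diagonal.
  have key := linear_ode_unique (A := fun s => D.A (s, z.2)) (a := s₁) (b := s₂)
    (y := fun s i => D.R (s, z.2) z i j)
    (y' := fun s i => ∑ k, D.R (s, z.2) (s₁, z.2) i k * D.R (s₁, z.2) z k j)
    (fun i k => (hD.A_cont i k).comp (by fun_prop) hseg) (fun s hs i => ?_) (fun s hs i => ?_) ?_
  · exact congrFun (key ⟨hs₂, le_rfl⟩) i
  · refine (hD.char_s z h₁ h₂ s (hs₁.trans hs.1) (hseg s hs) i j).mono fun s' hs' => ?_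
    exact ⟨hs₁.trans hs'.1, hseg s' hs'⟩
  · have h : ∀ k, HasDerivWithinAt (fun s => D.R (s, z.2) (s₁, z.2) i k)
        (∑ l, D.A (s, z.2) i l * D.R (s, z.2) (s₁, z.2) l k) (Icc s₁ s₂) s := fun k =>
      (hD.char_s (s₁, z.2) (h₁.trans_le hs₁) h₂ s hs.1 (hseg s hs) i k).mono
        fun s' hs' => ⟨hs'.1, hseg s' hs'⟩
    refine (HasDerivWithinAt.fun_sum (u := Finset.univ)
      (fun k _ => (h k).mul_const (D.R (s₁, z.2) z k j))).congr_deriv ?_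
    simp only [Finset.mul_sum, Finset.sum_mul]
    rw [Finset.sum_comm]
    exact Finset.sum_congr rfl fun _ _ => Finset.sum_congr rfl fun _ _ => by ring
  · funext i
    simp [hD.diag _ (hseg s₁ ⟨le_rfl, hs₂⟩)]

/-- Near the parameter `μ` the curve is a horizontal segment, parametrized by arc length. -/
def IsHorizontalAt (D : CostateData n) (μ : ℝ) : Prop :=
  0 < D.L₁ μ ∧ 0 < D.L₂ μ ∧ (∀ r, D.v r ≠ μ) ∧
    ∃ δ > 0, ∀ ν ∈ Icc (μ - δ) (μ + δ), D.L₂ ν = D.L₂ μ ∧ D.L₁ ν = D.L₁ μ - (ν - μ)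

section Horizontal

variable {μ δ : ℝ}

/-- Monotonicity carries strictness from the small interval to all parameters: `ν` is replaced by
the nearer of itself and the end of the interval. -/
theorem horizontal_strict (hD : D.IsRegular)
    (hδ : ∀ ν ∈ Icc (μ - δ) (μ + δ), D.L₂ ν = D.L₂ μ ∧ D.L₁ ν = D.L₁ μ - (ν - μ))
    {ν' : ℝ} (hν' : ν' ∈ Ioo (μ - δ) (μ + δ)) :
    (∀ ν, ν' < ν → D.L₁ ν < D.L₁ ν') ∧ ∀ ν, ν < ν' → D.L₁ ν' < D.L₁ ν := by
  have h' := (hδ ν' ⟨hν'.1.le, hν'.2.le⟩).2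
  constructor
  · intro ν hν
    have h1 : ν' < min ν (μ + δ) := lt_min hν hν'.2
    have h2 := (hδ (min ν (μ + δ)) ⟨hν'.1.le.trans h1.le, min_le_right _ _⟩).2
    have h3 := hD.anti (min_le_left ν (μ + δ))
    linarith
  · intro ν hν
    have h1 : max ν (μ - δ) < ν' := max_lt hν hν'.1
    have h2 := (hδ (max ν (μ - δ)) ⟨le_max_right _ _, h1.le.trans hν'.2.le⟩).2
    have h3 := hD.anti (le_max_left ν (μ - δ))
    linarith

/-- Parameters beyond `μ + δ` have abscissa at most `L₁ μ - δ`. So a curve point above `z` comes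
before `μ + δ`, where the height does not exceed that of the segment. -/
theorem horizontal_le (hD : D.IsRegular) (hδ0 : 0 < δ)
    (hδ : ∀ ν ∈ Icc (μ - δ) (μ + δ), D.L₂ ν = D.L₂ μ ∧ D.L₁ ν = D.L₁ μ - (ν - μ))
    {z : ℝ × ℝ} (hz : z ∈ D.G) (hz₁ : D.L₁ μ - δ < z.1) : z.2 ≤ D.L₂ μ := by
  obtain ⟨_, _, ν, hν⟩ := hz
  have h1 := hδ (μ + δ) ⟨by linarith, le_rfl⟩
  have h2 : ν < μ + δ := by
    by_contra h
    have h3 := hD.anti (not_lt.1 h)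
    have h4 : z.1 ≤ D.L₁ ν := hν.1
    linarith
  exact (hν.2.trans (hD.mono h2.le)).trans h1.1.le

/-- Dominated convergence needs the indicator of the arc to stabilize at every `ν ≠ μ`. The
borderline case is an earlier point at the height of the segment: it remains above `z` because no
point of `G` near `γ μ` rises over that height. -/
theorem horizontal_eventually (hD : D.IsRegular) (hH : D.IsHorizontalAt μ) {ν : ℝ} (hν : ν ≠ μ) :
    (D.γ μ ≤ D.γ ν ∧ ∀ᶠ z in 𝓝[D.G] (D.γ μ), z ≤ D.γ ν) ∨
      (¬ D.γ μ ≤ D.γ ν ∧ ∀ᶠ z in 𝓝[D.G] (D.γ μ), ¬ z ≤ D.γ ν) := by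
  obtain ⟨h₁, h₂, -, δ, hδ0, hδ⟩ := hH
  have hst := horizontal_strict hD hδ (ν' := μ) ⟨by linarith, by linarith⟩
  have hfst : Tendsto Prod.fst (𝓝[D.G] (D.γ μ)) (𝓝 (D.L₁ μ)) :=
    (continuous_fst.tendsto (D.γ μ)).mono_left nhdsWithin_le_nhds
  have hsnd : Tendsto Prod.snd (𝓝[D.G] (D.γ μ)) (𝓝 (D.L₂ μ)) :=
    (continuous_snd.tendsto (D.γ μ)).mono_left nhdsWithin_le_nhds
  rcases lt_or_gt_of_ne hν with h | h
  · have h3 := hst.2 ν h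
    rcases lt_or_ge (D.L₂ ν) (D.L₂ μ) with h4 | h4
    · right
      refine ⟨fun h5 => not_le.2 h4 h5.2, ?_⟩
      filter_upwards [hsnd.eventually_const_lt h4] with z hz h5 using not_le.2 hz h5.2
    · left
      refine ⟨⟨h3.le, h4⟩, ?_⟩
      filter_upwards [hfst.eventually_lt_const h3, self_mem_nhdsWithin,
        hfst.eventually_const_lt (show D.L₁ μ - δ < D.L₁ μ by linarith)] with z h5 h6 h7
      exact ⟨h5.le, (horizontal_le hD hδ0 hδ h6 h7).trans h4⟩
  · right
    have h3 := hst.1 ν h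
    refine ⟨fun h5 => not_le.2 h3 h5.1, ?_⟩
    filter_upwards [hfst.eventually_const_lt h3] with z hz h5 using not_le.2 hz h5.1

-- The coefficients `c` are left free so that one statement covers the integrand of the curve term
-- and the vertex terms.
open scoped Classical in
theorem horizontal_tendsto_term (hD : D.IsRegular) (hH : D.IsHorizontalAt μ) {ν : ℝ} (hν : ν ≠ μ)
    (c : Fin n → ℝ) (j : Fin n) :
    Tendsto (fun z => if z ≤ D.γ ν then ∑ i, c i * D.R (D.γ ν) z i j else 0) (𝓝[D.G] (D.γ μ))
      (𝓝 (if D.γ μ ≤ D.γ ν then ∑ i, c i * D.R (D.γ ν) (D.γ μ) i j else 0)) := by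
  rcases horizontal_eventually hD hH hν with ⟨h, hev⟩ | ⟨h, hev⟩
  · rw [if_pos h]
    have hlim : Tendsto (fun z => ∑ i, c i * D.R (D.γ ν) z i j) (𝓝[D.G] (D.γ μ))
        (𝓝 (∑ i, c i * D.R (D.γ ν) (D.γ μ) i j)) := by
      refine tendsto_finsetSum _ fun i _ => Tendsto.const_mul _ ?_
      have h1 := hD.continuousOn_R i j (D.γ ν, D.γ μ) ⟨hH.1, hH.2.1, h, γ_mem_G_of_le hH.1 hH.2.1 h⟩
      refine h1.tendsto.comp (f := fun z => (D.γ ν, z)) (tendsto_nhdsWithin_iff.2 ⟨?_, ?_⟩)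
      · exact (tendsto_const_nhds.prodMk_nhds tendsto_id).mono_left nhdsWithin_le_nhds
      · filter_upwards [hev, self_mem_nhdsWithin] with z h2 h3
        exact ⟨h3.1, h3.2.1, h2, γ_mem_G_of_le h3.1 h3.2.1 h2⟩
    refine hlim.congr' ?_
    filter_upwards [hev] with z hz
    rw [if_pos hz]
  · rw [if_neg h]
    refine tendsto_const_nhds.congr' ?_
    filter_upwards [hev] with z hz
    rw [if_neg hz]

theorem horizontal_E_subset (hD : D.IsRegular) (hδ0 : 0 < δ)
    (hδ : ∀ ν ∈ Icc (μ - δ) (μ + δ), D.L₂ ν = D.L₂ μ ∧ D.L₁ ν = D.L₁ μ - (ν - μ))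
    {z : ℝ × ℝ} (hz₁ : D.L₁ μ - δ < z.1) : D.E z ⊆ {w | z.2 ≤ w.2 ∧ w.2 ≤ D.L₂ μ} := fun _ hw =>
  ⟨hw.2.2, horizontal_le hD hδ0 hδ hw.1 (hz₁.trans_le hw.2.1)⟩

theorem half_pos_le_eventually {p : ℝ × ℝ} (h₁ : 0 < p.1) (h₂ : 0 < p.2) :
    ∀ᶠ z in 𝓝 p, ((p.1 / 2, p.2 / 2) : ℝ × ℝ) ≤ z := by
  have hfst := (continuous_fst.tendsto p).eventually_const_lt (show p.1 / 2 < p.1 by linarith)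
  have hsnd := (continuous_snd.tendsto p).eventually_const_lt (show p.2 / 2 < p.2 by linarith)
  filter_upwards [hfst, hsnd] with z h3 h4 using ⟨h3.le, h4.le⟩

/-- The three terms converge separately: the area of a thin strip tends to zero, the curve term
converges by domination since `ν ≠ μ` almost everywhere, and no vertex has parameter `μ`. -/
theorem horizontal_tendsto (hD : D.IsRegular) (hH : D.IsHorizontalAt μ) (j : Fin n) :
    Tendsto (fun z => D.costate z j) (𝓝[D.G] (D.γ μ)) (𝓝 (D.costate (D.γ μ) j)) := by
  classical
  obtain ⟨h₁, h₂, hv, δ, hδ0, hδ⟩ := id hH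
  set q : ℝ × ℝ := (D.L₁ μ / 2, D.L₂ μ / 2) with hq
  have hq₁ : 0 < q.1 := half_pos h₁
  have hq₂ : 0 < q.2 := half_pos h₂
  have hqe : ∀ᶠ z in 𝓝[D.G] (D.γ μ), q ≤ z :=
    (half_pos_le_eventually (p := D.γ μ) h₁ h₂).filter_mono nhdsWithin_le_nhds
  obtain ⟨M, hM0, hMk, hMκ⟩ := hD.exists_bound_density hq₁ hq₂ j
  have hfst : Tendsto Prod.fst (𝓝[D.G] (D.γ μ)) (𝓝 (D.L₁ μ)) :=
    (continuous_fst.tendsto (D.γ μ)).mono_left nhdsWithin_le_nhds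
  have hsnd : Tendsto Prod.snd (𝓝[D.G] (D.γ μ)) (𝓝 (D.L₂ μ)) :=
    (continuous_snd.tendsto (D.γ μ)).mono_left nhdsWithin_le_nhds
  unfold costate
  refine Tendsto.add (Tendsto.add ?_ ?_) ?_
  · obtain ⟨c, hc⟩ := (hD.isCompact_E hq₁ hq₂).isBounded.bddAbove
    -- Above `z` the region lies in a strip of bounded width and of height `L₂ μ - z.2`. At `z = γ
    -- μ` the height is zero, so the limit value of the area term is zero as well.
    have hvol : ∀ z, q ≤ z → D.L₁ μ - δ < z.1 → z.2 ≤ D.L₂ μ →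
        |∫ w in D.E z, D.k j w z| ≤ M * (|c.1 - q.1| * (D.L₂ μ - z.2)) := by
      intro z hz hz₁ hz₂
      have hsub : D.E z ⊆ Icc q.1 c.1 ×ˢ Icc z.2 (D.L₂ μ) := fun w hw =>
        ⟨⟨hz.1.trans hw.2.1, (hc (E_anti hz hw)).1⟩, horizontal_E_subset hD hδ0 hδ hz₁ hw⟩
      have hE := hD.isCompact_E (hq₁.trans_le hz.1) (hq₂.trans_le hz.2)
      refine (norm_setIntegral_le_of_norm_le_const (f := fun w => D.k j w z)
        hE.measure_lt_top (fun w hw => hMk w z hz hw)).trans (mul_le_mul_of_nonneg_left ?_ hM0)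
      have hfin : volume (Icc q.1 c.1 ×ˢ Icc z.2 (D.L₂ μ)) ≠ ⊤ :=
        (isCompact_Icc.prod isCompact_Icc).measure_lt_top.ne
      refine (measureReal_mono hsub hfin).trans ?_
      rw [Measure.volume_eq_prod, measureReal_prod_prod, Real.volume_real_Icc,
        Real.volume_real_Icc_of_le hz₂]
      exact mul_le_mul_of_nonneg_right (max_le (le_abs_self _) (abs_nonneg _)) (sub_nonneg.2 hz₂)
    have hzero : ∫ w in D.E (D.γ μ), D.k j w (D.γ μ) = 0 := by
      have := hvol (D.γ μ) ⟨by simp only [hq, γ]; linarith, by simp only [hq, γ]; linarith⟩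
        (by simp only [γ]; linarith) le_rfl
      simpa [γ] using this
    rw [hzero]
    refine squeeze_zero_norm' (a := fun z : ℝ × ℝ => M * (|c.1 - q.1| * (D.L₂ μ - z.2))) ?_ ?_
    · filter_upwards [hqe, self_mem_nhdsWithin,
        hfst.eventually_const_lt (show D.L₁ μ - δ < D.L₁ μ by linarith)] with z h3 h4 h5
      exact hvol z h3 h5 (horizontal_le hD hδ0 hδ h4 h5)
    · simpa using ((hsnd.const_sub (D.L₂ μ)).const_mul |c.1 - q.1|).const_mul M
  · have hrepr : ∀ z, q ≤ z → ∫ ν in D.arc z, D.κ j ν z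
        = ∫ ν in D.arc q, if z ≤ D.γ ν then D.κ j ν z else 0 := by
      intro z hz
      have : (fun ν => if z ≤ D.γ ν then D.κ j ν z else 0)
          = indicator (D.arc z) fun ν => D.κ j ν z := by
        funext ν
        simp [indicator_apply, mem_arc]
      rw [this, setIntegral_indicator (hD.measurableSet_arc z),
        inter_eq_self_of_subset_right (arc_anti hz)]
    have hqμ : q ≤ D.γ μ := ⟨by simp only [hq, γ]; linarith, by simp only [hq, γ]; linarith⟩
    rw [hrepr _ hqμ]
    refine Tendsto.congr' (f₁ := fun z => ∫ ν in D.arc q, if z ≤ D.γ ν then D.κ j ν z else 0) ?_ ?_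
    · filter_upwards [hqe] with z hz using (hrepr z hz).symm
    · refine tendsto_integral_filter_of_dominated_convergence (fun _ => M) ?_ ?_ ?_ ?_
      · filter_upwards [hqe] with z hz
        have : (fun ν => if z ≤ D.γ ν then D.κ j ν z else 0)
            = indicator (D.arc z) fun ν => D.κ j ν z := by
          funext ν
          simp [indicator_apply, mem_arc]
        rw [this, aestronglyMeasurable_indicator_iff (hD.measurableSet_arc z),
          Measure.restrict_restrict (hD.measurableSet_arc z),
          inter_eq_self_of_subset_left (arc_anti hz)]
        exact (integrable_finsetSum _ fun i _ => hD.integrableOn_arc hq₁ hq₂ hz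
          (hD.measurableSet_arc z) Subset.rfl i j).aestronglyMeasurable
      · filter_upwards [hqe] with z hz
        refine Eventually.of_forall fun ν => ?_
        split_ifs with h
        · exact hMκ ν z hz h
        · simpa using hM0
      · exact integrableOn_const (hD.isCompact_arc hq₁ hq₂).measure_lt_top.ne
      · have hne : ∀ᵐ ν ∂(volume.restrict (D.arc q)), ν ≠ μ :=
          ae_restrict_of_ae (by simp [ae_iff])
        filter_upwards [hne] with ν hν
        exact horizontal_tendsto_term hD hH hν (fun i => D.F₁ i ν) j
  · exact tendsto_finsetSum _ fun r _ => horizontal_tendsto_term hD hH (hv r) (fun i => D.F₀ i r) j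

end Horizontal

end CostateData

/-! ### Differentiability of the co-state along a horizontal part -/

namespace CostateData

variable {n : ℕ} {D : CostateData n} {μ δ : ℝ}

theorem IsRegular.continuousAt_R_γ (hD : D.IsRegular) {z : ℝ × ℝ} (h₁ : 0 < z.1) (h₂ : 0 < z.2)
    (hμ : ∀ᶠ ν in 𝓝 μ, z ≤ D.γ ν) (i j : Fin n) :
    ContinuousAt (fun ν => D.R (D.γ ν) z i j) μ := by
  have hT : ∀ ν, z ≤ D.γ ν → (D.γ ν, z) ∈ D.T := fun ν h => ⟨h₁, h₂, h, γ_mem_G_of_le h₁ h₂ h⟩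
  refine (hD.continuousOn_R i j (D.γ μ, z) (hT μ hμ.self_of_nhds)).tendsto.comp
    (f := fun ν => (D.γ ν, z)) (tendsto_nhdsWithin_iff.2 ⟨?_, ?_⟩)
  · exact (hD.continuous_γ.prodMk continuous_const).tendsto μ
  · filter_upwards [hμ] with ν h using hT ν h

/-- The matrix tends to the identity as `β` decreases to `μ`. The point `β` has to come after `μ`,
since the second argument of the kernel must lie below the first. -/
theorem horizontal_exists_det_ne_zero (hD : D.IsRegular) (h₁ : 0 < D.L₁ μ) (h₂ : 0 < D.L₂ μ)
    (hδ0 : 0 < δ)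
    (hδ : ∀ ν ∈ Icc (μ - δ) (μ + δ), D.L₂ ν = D.L₂ μ ∧ D.L₁ ν = D.L₁ μ - (ν - μ)) :
    ∃ β ∈ Ioo μ (μ + δ), 0 < D.L₁ β ∧ 0 < D.L₂ β ∧
      Matrix.det (Matrix.of (D.R (D.γ μ) (D.γ β))) ≠ 0 := by
  have hpos : ∀ᶠ ν in 𝓝[>] μ, 0 < D.L₁ ν ∧ 0 < D.L₂ ν :=
    ((hD.cont₁.tendsto μ).eventually_const_lt h₁ |>.and
      ((hD.cont₂.tendsto μ).eventually_const_lt h₂)).filter_mono nhdsWithin_le_nhds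
  have hmem : ∀ᶠ ν in 𝓝[>] μ, ν ∈ Ioo μ (μ + δ) := Ioo_mem_nhdsGT (by linarith)
  have hlim : Tendsto (fun ν => Matrix.of (D.R (D.γ μ) (D.γ ν))) (𝓝[>] μ)
      (𝓝 (1 : Matrix (Fin n) (Fin n) ℝ)) := by
    refine tendsto_pi_nhds.2 fun i => tendsto_pi_nhds.2 fun j => ?_
    have h3 := hD.continuousOn_R i j (D.γ μ, D.γ μ) ⟨h₁, h₂, le_rfl, γ_mem_G h₁ h₂⟩
    have h4 : (1 : Matrix (Fin n) (Fin n) ℝ) i j = D.R (D.γ μ) (D.γ μ) i j := by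
      rw [hD.diag _ (γ_mem_G h₁ h₂), Matrix.one_apply]
    rw [h4]
    refine h3.tendsto.comp (f := fun ν => (D.γ μ, D.γ ν)) (tendsto_nhdsWithin_iff.2 ⟨?_, ?_⟩)
    · exact ((continuous_const.prodMk hD.continuous_γ).tendsto μ).mono_left nhdsWithin_le_nhds
    · filter_upwards [hpos, hmem] with ν h5 h6
      refine ⟨h5.1, h5.2, ⟨hD.anti h6.1.le, (hδ ν ⟨by linarith [h6.1], h6.2.le⟩).1.le⟩,
        γ_mem_G h₁ h₂⟩
  have hdet : Tendsto (fun ν => Matrix.det (Matrix.of (D.R (D.γ μ) (D.γ ν)))) (𝓝[>] μ)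
      (𝓝 (Matrix.det (1 : Matrix (Fin n) (Fin n) ℝ))) :=
    (continuous_id.matrix_det.tendsto (1 : Matrix (Fin n) (Fin n) ℝ)).comp hlim
  rw [Matrix.det_one] at hdet
  obtain ⟨β, h5, h6, h7⟩ := (hpos.and (hmem.and (hdet.eventually_ne one_ne_zero))).exists
  exact ⟨β, h6, h5.1, h5.2, h7⟩

theorem horizontal_integral_E (hD : D.IsRegular) (hδ0 : 0 < δ)
    (hδ : ∀ ν ∈ Icc (μ - δ) (μ + δ), D.L₂ ν = D.L₂ μ ∧ D.L₁ ν = D.L₁ μ - (ν - μ))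
    {ν : ℝ} (hν : ν ∈ Ioo (μ - δ) (μ + δ)) (f : ℝ × ℝ → ℝ) : ∫ w in D.E (D.γ ν), f w = 0 := by
  have hν' := hδ ν ⟨hν.1.le, hν.2.le⟩
  refine setIntegral_measure_zero _ (measure_mono_null (t := univ ×ˢ {D.L₂ μ}) (fun w hw => ?_) ?_)
  · have h := horizontal_E_subset hD hδ0 hδ (z := D.γ ν)
      (by simp only [γ]; linarith [hν'.2, hν.2]) hw
    exact ⟨trivial, le_antisymm h.2 (hν'.1 ▸ h.1)⟩
  · rw [Measure.volume_eq_prod, Measure.prod_prod]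
    simp

/-- A curve point above `γ ν` has a parameter at most `ν`, hence the same height. So the three
points lie on one horizontal line, even if `ν'` is outside the small interval. -/
theorem horizontal_R_comp (hD : D.IsRegular)
    (hδ : ∀ ν ∈ Icc (μ - δ) (μ + δ), D.L₂ ν = D.L₂ μ ∧ D.L₁ ν = D.L₁ μ - (ν - μ))
    {ν β ν' : ℝ} (hν : ν ∈ Ioo (μ - δ) (μ + δ)) (hβ : β ∈ Ioo (μ - δ) (μ + δ)) (hνβ : ν ≤ β)
    (h₁ : 0 < D.L₁ β) (h₂ : 0 < D.L₂ β) (hν' : D.γ ν ≤ D.γ ν') (i l : Fin n) :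
    D.R (D.γ ν') (D.γ β) i l = ∑ k, D.R (D.γ ν') (D.γ ν) i k * D.R (D.γ ν) (D.γ β) k l := by
  have hle : ν' ≤ ν := not_lt.1 fun h =>
    not_le.2 ((horizontal_strict hD hδ hν).1 ν' h) hν'.1
  have e1 := (hδ ν ⟨hν.1.le, hν.2.le⟩).1
  have e2 := (hδ β ⟨hβ.1.le, hβ.2.le⟩).1
  have e3 : D.L₂ ν' = D.L₂ ν := le_antisymm (hD.mono hle) hν'.2
  have h := hD.R_comp (z := D.γ β) h₁ h₂ (s₁ := D.L₁ ν) (s₂ := D.L₁ ν') (hD.anti hνβ) hν'.1 ?_ i l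
  · have h3 : (D.L₁ ν', (D.γ β).2) = D.γ ν' := Prod.ext rfl (by simp only [γ]; linarith)
    have h4 : (D.L₁ ν, (D.γ β).2) = D.γ ν := Prod.ext rfl (by simp only [γ]; linarith)
    rwa [h3, h4] at h
  · exact ⟨h₁.trans_le (hD.anti (hle.trans hνβ)), h₂, ν', le_rfl, by simp only [γ]; linarith⟩

/-- For `β` on the segment the arc above `γ β` consists of the `ν' ≤ β` with `L₂ μ ≤ L₂ ν'`. The
second condition does not involve `β`, so moving `β` only moves the right end, which is what the
fundamental theorem of calculus needs. -/
theorem horizontal_arc (hD : D.IsRegular)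
    (hδ : ∀ ν ∈ Icc (μ - δ) (μ + δ), D.L₂ ν = D.L₂ μ ∧ D.L₁ ν = D.L₁ μ - (ν - μ))
    {α ν : ℝ} (hα : α ∈ Ioo (μ - δ) (μ + δ)) (hν : ν ∈ Ioo (μ - δ) (μ + δ)) (h : α ≤ ν) :
    D.arc (D.γ ν) = D.arc (D.γ α) ∪ Ioc α ν ∧ Disjoint (D.arc (D.γ α)) (Ioc α ν) := by
  have hmem : ∀ β ∈ Ioo (μ - δ) (μ + δ), ∀ ν', ν' ∈ D.arc (D.γ β) ↔ ν' ≤ β ∧ D.L₂ μ ≤ D.L₂ ν' := by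
    intro β hβ ν'
    have e := (hδ β ⟨hβ.1.le, hβ.2.le⟩).1
    rw [mem_arc']
    simp only [γ, e]
    refine and_congr_left fun _ => ⟨fun h1 => ?_, fun h1 => hD.anti h1⟩
    exact not_lt.1 fun h2 => not_le.2 ((horizontal_strict hD hδ hβ).1 ν' h2) h1
  constructor
  · ext ν'
    rw [mem_union, hmem ν hν, hmem α hα, mem_Ioc]
    constructor
    · rintro ⟨h1, h2⟩
      rcases le_or_gt ν' α with h3 | h3
      · exact Or.inl ⟨h3, h2⟩
      · exact Or.inr ⟨h3, h1⟩
    · rintro (⟨h1, h2⟩ | ⟨h1, h2⟩)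
      · exact ⟨h1.trans h, h2⟩
      · exact ⟨h2, (hδ ν' ⟨hα.1.le.trans h1.le, h2.trans hν.2.le⟩).1.ge⟩
  · refine disjoint_left.2 fun ν' h1 h2 => ?_
    exact not_le.2 h2.1 ((hmem α hα ν').1 h1).1

/-- The sign comes from `L₁` decreasing at unit speed. The one-sided characteristic equation becomes
two-sided because the segment extends to both sides of `γ μ`. -/
theorem horizontal_hasDerivAt_R (hD : D.IsRegular) (h₁ : 0 < D.L₁ μ) (h₂ : 0 < D.L₂ μ)
    (hδ0 : 0 < δ)
    (hδ : ∀ ν ∈ Icc (μ - δ) (μ + δ), D.L₂ ν = D.L₂ μ ∧ D.L₁ ν = D.L₁ μ - (ν - μ))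
    {β : ℝ} (hβ : β ∈ Ioo μ (μ + δ)) (hβ₁ : 0 < D.L₁ β) (i j : Fin n) :
    HasDerivAt (fun ν => D.R (D.γ ν) (D.γ β) i j)
      (-∑ k, D.A (D.γ μ) i k * D.R (D.γ μ) (D.γ β) k j) μ := by
  have e := hδ β ⟨by linarith [hβ.1], hβ.2.le⟩
  have hγ : ∀ ν ∈ Icc (μ - δ) (μ + δ), (D.L₁ μ - (ν - μ), (D.γ β).2) = D.γ ν := fun ν hν =>
    Prod.ext (hδ ν hν).2.symm (by simp only [γ]; rw [e.1, (hδ ν hν).1])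
  have hγμ : (D.L₁ μ, (D.γ β).2) = D.γ μ := by simpa using hγ μ ⟨by linarith, by linarith⟩
  have h := hD.char_s (D.γ β) hβ₁ (show 0 < D.L₂ β by rw [e.1]; exact h₂) (D.L₁ μ)
    (hD.anti hβ.1.le) (hγμ ▸ γ_mem_G h₁ h₂) i j
  rw [hγμ] at h
  have hlow := hδ (μ - δ) ⟨le_rfl, by linarith⟩
  have hnhds : {s' | (D.γ β).1 ≤ s' ∧ (s', (D.γ β).2) ∈ D.G} ∈ 𝓝 (D.L₁ μ) := by
    have h3 : D.L₁ β < D.L₁ μ := by linarith [hβ.1]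
    have h4 : D.L₁ μ < D.L₁ (μ - δ) := by linarith
    filter_upwards [Ioo_mem_nhds h3 h4] with s hs
    refine ⟨hs.1.le, hβ₁.trans hs.1, ?_, μ - δ, hs.2.le, ?_⟩
    · simp only [γ, e.1]; exact h₂
    · simp only [γ, e.1, hlow.1]; exact le_rfl
  have h5 := h.hasDerivAt hnhds
  have h6 : HasDerivAt (fun ν => D.L₁ μ - (ν - μ)) (-1) μ := by
    simpa using ((hasDerivAt_id μ).sub_const μ).const_sub (D.L₁ μ)
  have h7 : HasDerivAt (fun ν => D.R (D.L₁ μ - (ν - μ), (D.γ β).2) (D.γ β) i j)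
      ((∑ k, D.A (D.γ μ) i k * D.R (D.γ μ) (D.γ β) k j) * (-1)) μ :=
    HasDerivAt.comp (h₂ := fun s' => D.R (s', (D.γ β).2) (D.γ β) i j) μ (by simpa using h5) h6
  rw [mul_neg_one] at h7
  refine h7.congr_of_eventuallyEq ?_
  filter_upwards [Icc_mem_nhds (show μ - δ < μ by linarith) (show μ < μ + δ by linarith)] with ν hν
  rw [hγ ν hν]

/-- The co-state is differentiable along a horizontal part of the curve. -/
theorem horizontal_hasDerivAt (hD : D.IsRegular) (hH : D.IsHorizontalAt μ) (j : Fin n) :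
    HasDerivAt (fun ν => D.costate (D.γ ν) j)
      (D.F₁ j μ + ∑ i, D.costate (D.γ μ) i * D.A (D.γ μ) i j) μ := by
  classical
  obtain ⟨h₁, h₂, hv, δ, hδ0, hδ⟩ := id hH
  -- The base point at which the second argument of the kernel is frozen.
  obtain ⟨β, hβ, hβ₁, hβ₂, hdet⟩ := horizontal_exists_det_ne_zero hD h₁ h₂ hδ0 hδ
  have hβ' : β ∈ Ioo (μ - δ) (μ + δ) := ⟨by linarith [hβ.1], hβ.2⟩
  set α := μ - δ / 2 with hα
  have hα' : α ∈ Ioo (μ - δ) (μ + δ) := ⟨by linarith, by linarith⟩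
  have hnear : ∀ᶠ ν in 𝓝 μ, ν ∈ Ioo α β := Ioo_mem_nhds (by linarith) hβ.1
  have hIoo : ∀ ν ∈ Icc α β, ν ∈ Ioo (μ - δ) (μ + δ) := fun ν hν =>
    ⟨hα'.1.trans_le hν.1, hν.2.trans_lt hβ.2⟩
  have hint : ∀ i l, IntegrableOn (fun ν => D.F₁ i ν * D.R (D.γ ν) (D.γ β) i l) (D.arc (D.γ β)) :=
    fun i l => hD.integrableOn_arc (q := D.γ β) hβ₁ hβ₂ le_rfl (hD.measurableSet_arc _) Subset.rfl i l
  have hκint : ∀ l, IntegrableOn (fun ν => D.κ l ν (D.γ β)) (D.arc (D.γ β)) := fun l =>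
    integrable_finsetSum _ fun i _ => hint i l
  have hle : ∀ ν ∈ Icc α β, D.γ β ≤ D.γ ν := fun ν hν =>
    ⟨hD.anti hν.2, by
      simp only [γ]
      rw [(hδ β ⟨hβ'.1.le, hβ'.2.le⟩).1,
        (hδ ν ⟨(hIoo ν hν).1.le, (hIoo ν hν).2.le⟩).1]⟩
  -- The co-state on the segment with the second argument of the kernel frozen at `γ β`: `ν` enters
  -- only through the arc and the active vertices.
  set q : ℝ → Fin n → ℝ := fun ν l => (∫ ν' in D.arc (D.γ ν), D.κ l ν' (D.γ β))
    + ∑ r, if D.γ ν ≤ D.γ (D.v r) then ∑ i, D.F₀ i r * D.R (D.γ (D.v r)) (D.γ β) i l else 0 with hq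
  refine hasDerivAt_of_vecMul_eq (p := fun ν => D.costate (D.γ ν)) (q := q)
    (U := fun ν => Matrix.of (D.R (D.γ ν) (D.γ β)))
    (U' := Matrix.of fun i l => -∑ k, D.A (D.γ μ) i k * D.R (D.γ μ) (D.γ β) k l)
    (p' := fun j => D.F₁ j μ + ∑ i, D.costate (D.γ μ) i * D.A (D.γ μ) i j)
    (fun i l => horizontal_hasDerivAt_R hD h₁ h₂ hδ0 hδ hβ hβ₁ i l) (fun l => ?_) hdet ?_ j
  -- The terms with `A` cancel, so the product rule for `ψ * R` leaves exactly the density of the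
  -- curve term.
  · have hval : ∑ i, ((D.F₁ i μ + ∑ k, D.costate (D.γ μ) k * D.A (D.γ μ) k i)
          * D.R (D.γ μ) (D.γ β) i l
        + D.costate (D.γ μ) i * -∑ k, D.A (D.γ μ) i k * D.R (D.γ μ) (D.γ β) k l)
        = D.κ l μ (D.γ β) := by
      simp only [add_mul, Finset.sum_add_distrib, mul_neg, Finset.sum_neg_distrib, κ,
        Finset.sum_mul, Finset.mul_sum]
      rw [Finset.sum_comm (f := fun i k => D.costate (D.γ μ) k * D.A (D.γ μ) k i
        * D.R (D.γ μ) (D.γ β) i l)]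
      simp only [mul_assoc]
      ring
    simp only [Matrix.of_apply]
    rw [hval]
    have hcont : ContinuousAt (fun ν => D.κ l ν (D.γ β)) μ := by
      refine tendsto_finsetSum _ fun i _ => Tendsto.mul (hD.F₁_cont i μ h₁ h₂ hv) ?_
      refine hD.continuousAt_R_γ hβ₁ hβ₂ ?_ i l
      filter_upwards [hnear] with ν hν using hle ν ⟨hν.1.le, hν.2.le⟩
    have hIcc : Icc α β ⊆ D.arc (D.γ β) := fun ν hν => hle ν hν
    have hftc : HasDerivAt (fun ν => ∫ ν' in α..ν, D.κ l ν' (D.γ β)) (D.κ l μ (D.γ β)) μ := by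
      refine intervalIntegral.integral_hasDerivAt_right ?_ ?_ hcont
      · rw [intervalIntegrable_iff_integrableOn_Ioc_of_le (by linarith)]
        exact (hκint l).mono_set (Ioc_subset_Icc_self.trans
          ((Icc_subset_Icc_right hβ.1.le).trans hIcc))
      · exact ⟨D.arc (D.γ β), mem_of_superset (Icc_mem_nhds (by linarith) hβ.1) hIcc,
          (hκint l).aestronglyMeasurable⟩
    -- The set of active vertices is constant near `μ`, so the vertex terms of `q` do not vary.
    have hvert : ∀ᶠ ν in 𝓝 μ, ∀ r, (D.γ ν ≤ D.γ (D.v r) ↔ D.γ μ ≤ D.γ (D.v r)) := by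
      refine eventually_all.2 fun r => ?_
      have htend : Tendsto D.γ (𝓝 μ) (𝓝[D.G] (D.γ μ)) := by
        refine tendsto_nhdsWithin_iff.2 ⟨hD.continuous_γ.tendsto μ, ?_⟩
        filter_upwards [hnear] with ν hν
        exact γ_mem_G_of_le hβ₁ hβ₂ (hle ν ⟨hν.1.le, hν.2.le⟩)
      rcases horizontal_eventually hD hH (hv r) with ⟨h, hev⟩ | ⟨h, hev⟩
      · filter_upwards [htend.eventually hev] with ν hν using iff_of_true hν h
      · filter_upwards [htend.eventually hev] with ν hν using iff_of_false hν h
    refine ((hftc.const_add (∫ ν' in D.arc (D.γ α), D.κ l ν' (D.γ β))).add_const (∑ r,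
      if D.γ μ ≤ D.γ (D.v r) then ∑ i, D.F₀ i r * D.R (D.γ (D.v r)) (D.γ β) i l else 0)
      ).congr_of_eventuallyEq ?_
    filter_upwards [hnear, hvert] with ν hν h3
    simp only [hq, h3]
    have harc := horizontal_arc hD hδ hα' (hIoo ν ⟨hν.1.le, hν.2.le⟩) hν.1.le
    rw [harc.1, setIntegral_union harc.2 measurableSet_Ioc, intervalIntegral.integral_of_le hν.1.le]
    · refine (hκint l).mono_set (arc_anti (hle α ⟨le_rfl, by linarith [hβ.1]⟩))
    · exact (hκint l).mono_set (Ioc_subset_Icc_self.trans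
          ((Icc_subset_Icc_right hν.2.le).trans hIcc))
  -- The area term is zero on the segment. The transition property, applied under the integral and
  -- in each vertex term, moves the second argument from `γ ν` to `γ β`.
  · filter_upwards [hnear] with ν hν l
    have hν' := hIoo ν ⟨hν.1.le, hν.2.le⟩
    have hcomp := fun ν' (h : D.γ ν ≤ D.γ ν') i =>
      horizontal_R_comp hD hδ hν' hβ' hν.2.le hβ₁ hβ₂ h i l
    have hexp : ∀ (c : Fin n → ℝ) ν', D.γ ν ≤ D.γ ν' →
        ∑ j, (∑ i, c i * D.R (D.γ ν') (D.γ ν) i j) * D.R (D.γ ν) (D.γ β) j l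
          = ∑ i, c i * D.R (D.γ ν') (D.γ β) i l := by
      intro c ν' h
      simp only [hcomp ν' h, Finset.sum_mul, Finset.mul_sum]
      rw [Finset.sum_comm]
      exact Finset.sum_congr rfl fun _ _ => Finset.sum_congr rfl fun _ _ => by ring
    have hlν := hle ν ⟨hν.1.le, hν.2.le⟩
    have hIν : ∀ j, IntegrableOn (fun ν' => D.κ j ν' (D.γ ν)) (D.arc (D.γ ν)) := fun j =>
      integrable_finsetSum _ fun i _ => hD.integrableOn_arc (q := D.γ β) hβ₁ hβ₂ hlν
        (hD.measurableSet_arc _) Subset.rfl i j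
    simp only [costate, Matrix.of_apply, horizontal_integral_E hD hδ0 hδ hν', zero_add, add_mul,
      Finset.sum_add_distrib, hq]
    congr 1
    · calc ∑ j, (∫ ν' in D.arc (D.γ ν), D.κ j ν' (D.γ ν)) * D.R (D.γ ν) (D.γ β) j l
          = ∫ ν' in D.arc (D.γ ν), ∑ j, D.κ j ν' (D.γ ν) * D.R (D.γ ν) (D.γ β) j l := by
            rw [integral_finsetSum _ fun j _ => (hIν j).mul_const _]
            simp only [integral_mul_const]
        _ = ∫ ν' in D.arc (D.γ ν), D.κ l ν' (D.γ β) :=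
            setIntegral_congr_fun (hD.measurableSet_arc _) fun ν' h => hexp _ ν' h
    · simp only [Finset.sum_mul]
      rw [Finset.sum_comm]
      refine Finset.sum_congr rfl fun r _ => ?_
      split_ifs with h
      · simpa only [Finset.sum_mul] using hexp (fun i => D.F₀ i r) _ h
      · simp

/-! ### Oblique parts: the co-state tends to zero -/

/-- Near the parameter `μ` the curve is strictly monotone in both coordinates. -/
def IsObliqueAt (D : CostateData n) (μ : ℝ) : Prop :=
  0 < D.L₁ μ ∧ 0 < D.L₂ μ ∧ (∀ r, D.v r ≠ μ) ∧
    ∃ δ > 0, StrictAntiOn D.L₁ (Icc (μ - δ) (μ + δ)) ∧ StrictMonoOn D.L₂ (Icc (μ - δ) (μ + δ))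

theorem oblique_strict (hD : D.IsRegular) (hδ : StrictAntiOn D.L₁ (Icc (μ - δ) (μ + δ)))
    {ν' : ℝ} (hν' : ν' ∈ Ioo (μ - δ) (μ + δ)) :
    (∀ ν, ν' < ν → D.L₁ ν < D.L₁ ν') ∧ ∀ ν, ν < ν' → D.L₁ ν' < D.L₁ ν := by
  have hm : ν' ∈ Icc (μ - δ) (μ + δ) := ⟨hν'.1.le, hν'.2.le⟩
  constructor
  · intro ν hν
    have h1 : ν' < min ν (μ + δ) := lt_min hν hν'.2
    exact (hD.anti (min_le_left ν (μ + δ))).trans_lt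
      (hδ hm ⟨hν'.1.le.trans h1.le, min_le_right _ _⟩ h1)
  · intro ν hν
    have h1 : max ν (μ - δ) < ν' := max_lt hν hν'.1
    exact (hδ ⟨le_max_right _ _, h1.le.trans hν'.2.le⟩ hm h1).trans_le
      (hD.anti (le_max_left ν (μ - δ)))

/-- Once `z.1 > L₁ (μ + r)` and `z.2 > L₂ (μ - r)`, the first coordinate excludes parameters from `μ
+ r` on and the second those up to `μ - r`. Strict monotonicity makes both conditions hold near `γ
μ`. -/
theorem oblique_arc_subset (hD : D.IsRegular) (hO : D.IsObliqueAt μ) {U : Set ℝ} (hU : U ∈ 𝓝 μ) :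
    ∀ᶠ z in 𝓝 (D.γ μ), D.arc z ⊆ U := by
  obtain ⟨-, -, -, δ, hδ0, hδ₁, hδ₂⟩ := hO
  obtain ⟨ε, hε0, hε⟩ := Metric.mem_nhds_iff.1 hU
  set r := min (ε / 2) δ with hr
  have hr0 : 0 < r := lt_min (half_pos hε0) hδ0
  have hrδ : r ≤ δ := min_le_right _ _
  have hrε : r < ε := (min_le_left _ _).trans_lt (by linarith)
  have hμ : μ ∈ Icc (μ - δ) (μ + δ) := ⟨by linarith, by linarith⟩
  have h1 : D.L₁ (μ + r) < D.L₁ μ := hδ₁ hμ ⟨by linarith, by linarith⟩ (by linarith)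
  have h2 : D.L₂ (μ - r) < D.L₂ μ := hδ₂ ⟨by linarith, by linarith⟩ hμ (by linarith)
  filter_upwards [(continuous_fst.tendsto (D.γ μ)).eventually_const_lt h1,
    (continuous_snd.tendsto (D.γ μ)).eventually_const_lt h2] with z h3 h4 ν hν
  have hν := mem_arc'.1 hν
  refine hε ?_
  have h5 : ν < μ + r := not_le.1 fun h => not_le.2 (h3.trans_le hν.1) (hD.anti h)
  have h6 : μ - r < ν := not_le.1 fun h => not_le.2 (h4.trans_le hν.2) (hD.mono h)
  rw [Metric.mem_ball, Real.dist_eq, abs_lt]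
  constructor <;> linarith

/-- A point above `z` is squeezed between `z` and a curve point above `z`, and both are close to `γ
μ`. -/
theorem oblique_E_subset (hD : D.IsRegular) (hO : D.IsObliqueAt μ) {U : Set (ℝ × ℝ)}
    (hU : U ∈ 𝓝 (D.γ μ)) : ∀ᶠ z in 𝓝 (D.γ μ), D.E z ⊆ U := by
  obtain ⟨ε, hε0, hε⟩ := Metric.mem_nhds_iff.1 hU
  have hγ : D.γ ⁻¹' (Metric.ball (D.γ μ) ε) ∈ 𝓝 μ :=
    hD.continuous_γ.continuousAt.preimage_mem_nhds (Metric.ball_mem_nhds _ hε0)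
  filter_upwards [oblique_arc_subset hD hO hγ, Metric.ball_mem_nhds (D.γ μ) hε0] with z h1 h2 w hw
  obtain ⟨⟨_, _, ν, hν⟩, hzw⟩ := hw
  have h3 := h1 (mem_arc.2 (hzw.trans hν))
  refine hε ?_
  rw [mem_preimage, Metric.mem_ball, Prod.dist_eq, max_lt_iff, Real.dist_eq, Real.dist_eq, abs_lt,
    abs_lt] at h3
  rw [Metric.mem_ball, Prod.dist_eq, max_lt_iff, Real.dist_eq, Real.dist_eq, abs_lt, abs_lt] at h2 ⊢
  have h4 := hzw.1
  have h5 := hzw.2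
  have h6 := hν.1
  have h7 := hν.2
  refine ⟨⟨?_, ?_⟩, ?_, ?_⟩ <;> linarith [h2.1.1, h2.1.2, h2.2.1, h2.2.2, h3.1.1, h3.1.2, h3.2.1,
    h3.2.2]

theorem oblique_no_vertex (hD : D.IsRegular) (hO : D.IsObliqueAt μ) :
    ∀ᶠ z in 𝓝 (D.γ μ), ∀ r, ¬ z ≤ D.γ (D.v r) := by
  have h : (range D.v)ᶜ ∈ 𝓝 μ := (finite_range D.v).isClosed.isOpen_compl.mem_nhds
    fun ⟨r, hr⟩ => hO.2.2.1 r hr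
  filter_upwards [oblique_arc_subset hD hO h] with z hz r hr
  exact hz (mem_arc.2 hr) ⟨r, rfl⟩

theorem oblique_tendsto_measure_arc (hD : D.IsRegular) (hO : D.IsObliqueAt μ) :
    Tendsto (fun z => volume.real (D.arc z)) (𝓝 (D.γ μ)) (𝓝 0) :=
  tendsto_measureReal_of_shrink fun _ hU => oblique_arc_subset hD hO hU

theorem oblique_tendsto_measure_E (hD : D.IsRegular) (hO : D.IsObliqueAt μ) :
    Tendsto (fun z => volume.real (D.E z)) (𝓝 (D.γ μ)) (𝓝 0) :=
  tendsto_measureReal_of_shrink fun _ hU => oblique_E_subset hD hO hU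

theorem oblique_tendsto_measure_slice (hD : D.IsRegular) (hO : D.IsObliqueAt μ) :
    Tendsto (fun z : ℝ × ℝ => volume.real {τ | (z.1, τ) ∈ D.E z}) (𝓝 (D.γ μ)) (𝓝 0) :=
  tendsto_measureReal_of_shrink (p := D.L₂ μ) fun U hU => by
    have h : Prod.snd ⁻¹' U ∈ 𝓝 (D.γ μ) := continuous_snd.continuousAt.preimage_mem_nhds hU
    filter_upwards [oblique_E_subset hD hO h] with z hz τ hτ using hz hτ

/-- The co-state vanishes on an oblique part of the curve, as a limit. -/
theorem oblique_tendsto (hD : D.IsRegular) (hO : D.IsObliqueAt μ) (j : Fin n) :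
    Tendsto (fun z => D.costate z j) (𝓝 (D.γ μ)) (𝓝 0) := by
  classical
  have h₁ := hO.1
  have h₂ := hO.2.1
  set q : ℝ × ℝ := (D.L₁ μ / 2, D.L₂ μ / 2) with hq
  have hq₁ : 0 < q.1 := half_pos h₁
  have hq₂ : 0 < q.2 := half_pos h₂
  have hqe : ∀ᶠ z in 𝓝 (D.γ μ), q ≤ z := half_pos_le_eventually (p := D.γ μ) h₁ h₂
  obtain ⟨M, hM0, hMk, hMκ⟩ := hD.exists_bound_density hq₁ hq₂ j
  have hlim : Tendsto (fun z => M * volume.real (D.E z) + M * volume.real (D.arc z)) (𝓝 (D.γ μ))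
      (𝓝 0) := by
    simpa using ((oblique_tendsto_measure_E hD hO).const_mul M).add
      ((oblique_tendsto_measure_arc hD hO).const_mul M)
  refine squeeze_zero_norm' ?_ hlim
  filter_upwards [hqe, oblique_no_vertex hD hO] with z hz hv
  have hz₁ := hq₁.trans_le hz.1
  have hz₂ := hq₂.trans_le hz.2
  have hsum : ∑ r, (if z ≤ D.γ (D.v r) then ∑ i, D.F₀ i r * D.R (D.γ (D.v r)) z i j else 0)
      = 0 := Finset.sum_eq_zero fun r _ => if_neg (hv r)
  rw [costate, hsum, add_zero]
  refine (norm_add_le _ _).trans (add_le_add ?_ ?_)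
  · exact norm_setIntegral_le_of_norm_le_const (hD.isCompact_E hz₁ hz₂).measure_lt_top
      fun w hw => hMk w z hz hw
  · exact norm_setIntegral_le_of_norm_le_const (hD.isCompact_arc hz₁ hz₂).measure_lt_top
      fun ν hν => hMκ ν z hz hν

/-! ### Oblique parts: derivatives of the co-state -/

/-- Derivative of the integral over the part of the curve above a moving corner. -/
theorem hasDerivAt_integral_arc (hD : D.IsRegular) (hδ : StrictAntiOn D.L₁ (Icc (μ - δ) (μ + δ)))
    {a₀ s₀ t ν₀ d : ℝ} (ha : a₀ < s₀) (hν₀ : ν₀ ∈ Ioo (μ - δ) (μ + δ)) (hs₀ : D.L₁ ν₀ = s₀)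
    (ht : t < D.L₂ ν₀) (hd : HasStrictDerivAt D.L₁ d ν₀) (hd0 : d ≠ 0) {b : ℝ → ℝ}
    (hb : IntegrableOn b (D.arc (a₀, t))) (hbc : ContinuousAt b ν₀) :
    HasDerivAt (fun s => ∫ ν in D.arc (s, t), b ν) (b ν₀ * d⁻¹) s₀ := by
  -- An anchor before `ν₀` at which the condition on the second coordinate already holds. Beyond it
  -- only the first coordinate limits the arc, so moving `s` moves a single end point.
  obtain ⟨α, hα, hαt⟩ : ∃ α ∈ Ioo (μ - δ) ν₀, t < D.L₂ α := by
    have h1 : ∀ᶠ ν in 𝓝[<] ν₀, ν ∈ Ioo (μ - δ) ν₀ := Ioo_mem_nhdsLT hν₀.1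
    have h2 : ∀ᶠ ν in 𝓝[<] ν₀, t < D.L₂ ν :=
      ((hD.cont₂.tendsto ν₀).eventually_const_lt ht).filter_mono nhdsWithin_le_nhds
    exact (h1.and h2).exists
  have hmem : ∀ β ∈ Ioo (μ - δ) (μ + δ), ∀ ν, ν ∈ D.arc (D.L₁ β, t) ↔ ν ≤ β ∧ t ≤ D.L₂ ν := by
    intro β hβ ν
    rw [mem_arc']
    refine and_congr_left fun _ => ⟨fun h => ?_, fun h => hD.anti h⟩
    exact not_lt.1 fun h2 => not_le.2 ((oblique_strict hD hδ hβ).1 ν h2) h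
  have hα' : α ∈ Ioo (μ - δ) (μ + δ) := ⟨hα.1, hα.2.trans hν₀.2⟩
  have hnear : ∀ᶠ ν in 𝓝 ν₀, ν ∈ Ioo α (μ + δ) ∧ a₀ < D.L₁ ν :=
    (show ∀ᶠ ν in 𝓝 ν₀, ν ∈ Ioo α (μ + δ) from Ioo_mem_nhds hα.2 hν₀.2).and
      ((hD.cont₁.tendsto ν₀).eventually_const_lt (hs₀ ▸ ha))
  have hsub : ∀ ν, α ≤ ν → a₀ < D.L₁ ν → Icc α ν ⊆ D.arc (a₀, t) := fun ν _ h ν' h' =>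
    ⟨h.le.trans (hD.anti h'.2), hαt.le.trans (hD.mono h'.1)⟩
  have hftc : HasDerivAt (fun ν => ∫ ν' in α..ν, b ν') (b ν₀) ν₀ := by
    refine intervalIntegral.integral_hasDerivAt_right ?_ ?_ hbc
    · rw [intervalIntegrable_iff_integrableOn_Ioc_of_le hα.2.le]
      exact hb.mono_set (Ioc_subset_Icc_self.trans (hsub ν₀ hα.2.le (hs₀ ▸ ha)))
    · refine ⟨D.arc (a₀, t), ?_, hb.aestronglyMeasurable⟩
      filter_upwards [hnear] with ν hν
      exact hsub ν hν.1.1.le hν.2 ⟨hν.1.1.le, le_rfl⟩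
  have hrepr : ∀ ν ∈ Ioo α (μ + δ), a₀ < D.L₁ ν → ∫ ν' in D.arc (D.L₁ ν, t), b ν'
      = (∫ ν' in D.arc (D.L₁ α, t), b ν') + ∫ ν' in α..ν, b ν' := by
    intro ν hν haν
    have hν' : ν ∈ Ioo (μ - δ) (μ + δ) := ⟨hα.1.trans hν.1, hν.2⟩
    have hun : D.arc (D.L₁ ν, t) = D.arc (D.L₁ α, t) ∪ Ioc α ν := by
      ext ν'
      rw [mem_union, hmem ν hν', hmem α hα', mem_Ioc]
      constructor
      · rintro ⟨h1, h2⟩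
        rcases le_or_gt ν' α with h3 | h3
        · exact Or.inl ⟨h3, h2⟩
        · exact Or.inr ⟨h3, h1⟩
      · rintro (⟨h1, h2⟩ | ⟨h1, h2⟩)
        · exact ⟨h1.trans hν.1.le, h2⟩
        · exact ⟨h2, hαt.le.trans (hD.mono h1.le)⟩
    have hdis : Disjoint (D.arc (D.L₁ α, t)) (Ioc α ν) := disjoint_left.2 fun ν' h1 h2 =>
      not_le.2 h2.1 ((hmem α hα' ν').1 h1).1
    rw [hun, setIntegral_union hdis measurableSet_Ioc, intervalIntegral.integral_of_le hν.1.le]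
    · exact hb.mono_set (arc_anti ⟨haν.le.trans (hD.anti hν.1.le), le_rfl⟩)
    · exact hb.mono_set (Ioc_subset_Icc_self.trans (hsub ν hν.1.le haν))
  -- The end point of the arc as a function of `s` is a local inverse of `L₁`, whence the factor
  -- `d⁻¹`.
  set g := HasStrictDerivAt.localInverse D.L₁ d ν₀ hd hd0 with hg
  have hg' : HasDerivAt g d⁻¹ s₀ := hs₀ ▸ (hd.to_localInverse hd0).hasDerivAt
  have hgν : g s₀ = ν₀ := by
    rw [← hs₀]
    exact HasStrictFDerivAt.localInverse_apply_image _
  have hright : ∀ᶠ s in 𝓝 s₀, D.L₁ (g s) = s := by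
    rw [← hs₀]
    exact HasStrictFDerivAt.eventually_right_inverse _
  have hgt : Tendsto g (𝓝 s₀) (𝓝 ν₀) := by
    have := hg'.continuousAt.tendsto
    rwa [hgν] at this
  have hcomp : HasDerivAt (fun s => ∫ ν' in α..g s, b ν') (b ν₀ * d⁻¹) s₀ :=
    HasDerivAt.comp s₀ (h₂ := fun ν => ∫ ν' in α..ν, b ν') (hgν.symm ▸ hftc) hg'
  refine (hcomp.const_add (∫ ν' in D.arc (D.L₁ α, t), b ν')).congr_of_eventuallyEq ?_
  filter_upwards [hright, hgt.eventually hnear] with s h1 h2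
  rw [← hrepr (g s) h2.1 h2.2, h1]

/-- Derivative of the integral over the part of the region above a moving corner. -/
theorem hasDerivAt_integral_E (hD : D.IsRegular) (hδ : StrictAntiOn D.L₁ (Icc (μ - δ) (μ + δ)))
    {a₀ s₀ t ν₀ Λ : ℝ} (ha0 : 0 < a₀) (ht0 : 0 < t) (ha : a₀ < s₀)
    (hν₀ : ν₀ ∈ Ioo (μ - δ) (μ + δ)) (hs₀ : D.L₁ ν₀ = s₀)
    {b : ℝ × ℝ → ℝ} (hb : ContinuousOn b (D.E (a₀, t))) (hbΛ : ∀ w ∈ D.E (a₀, t), |b w| ≤ Λ) :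
    ∃ e, |e| ≤ Λ * volume.real {τ | (s₀, τ) ∈ D.E (s₀, t)} ∧
      HasDerivAt (fun s => ∫ w in D.E (s, t), b w) e s₀ := by
  classical
  have hE := hD.isCompact_E (q := (a₀, t)) ha0 ht0
  have hEm := hE.isClosed.measurableSet
  set f : ℝ × ℝ → ℝ := indicator (D.E (a₀, t)) b with hf
  have hfi : Integrable f (volume.prod volume) := by
    rw [← Measure.volume_eq_prod, hf, integrable_indicator_iff hEm]
    exact hb.integrableOn_compact hE
  set J : ℝ → ℝ := fun σ => ∫ τ, f (σ, τ) with hJ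
  have hJi : Integrable J volume := hfi.integral_prod_left
  -- By Fubini the area integral becomes a one-dimensional integral of slices, and its derivative is
  -- minus the slice at `s₀`, provided the slice integral is continuous there.
  have hrepr : ∀ s, a₀ ≤ s → ∫ w in D.E (s, t), b w = ∫ σ in Ioi s, J σ := by
    intro s hs
    have h1 : D.E (s, t) = D.E (a₀, t) ∩ (Ici s ×ˢ univ) := by
      ext w
      constructor
      · intro h
        exact ⟨⟨h.1, hs.trans h.2.1, h.2.2⟩, h.2.1, trivial⟩
      · rintro ⟨⟨h1, h2⟩, h3, -⟩
        exact ⟨h1, h3, h2.2⟩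
    rw [h1, inter_comm, ← setIntegral_indicator hEm, Measure.volume_eq_prod,
      setIntegral_prod _ hfi.integrableOn, integral_Ici_eq_integral_Ioi]
    simp [hJ, hf]
  have hslice : {τ | (s₀, τ) ∈ D.E (a₀, t)} = {τ | (s₀, τ) ∈ D.E (s₀, t)} := by
    ext τ
    exact ⟨fun h => ⟨h.1, le_rfl, h.2.2⟩, fun h => ⟨h.1, ha.le, h.2.2⟩⟩
  have hΛτ : ∀ σ τ, |f (σ, τ)| ≤ |Λ| := by
    intro σ τ
    simp only [hf, indicator_apply]
    split_ifs with h
    · exact (hbΛ _ h).trans (le_abs_self _)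
    · simp
  have hcontJ : ContinuousAt J s₀ := by
    obtain ⟨c, hc⟩ := hE.isBounded.bddAbove
    refine tendsto_integral_filter_of_dominated_convergence
      (indicator (Icc t c.2) fun _ => |Λ|) ?_ ?_ ?_ ?_
    · refine Eventually.of_forall fun σ => ?_
      have hm : MeasurableSet {τ | (σ, τ) ∈ D.E (a₀, t)} := hEm.preimage (by fun_prop)
      have : (fun τ => f (σ, τ)) = indicator {τ | (σ, τ) ∈ D.E (a₀, t)} fun τ => b (σ, τ) := by
        funext τ
        simp [hf, indicator_apply]
      rw [this, aestronglyMeasurable_indicator_iff hm]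
      exact (hb.comp (f := fun τ => (σ, τ)) (s := {τ | (σ, τ) ∈ D.E (a₀, t)}) (by fun_prop)
        fun τ hτ => hτ).aestronglyMeasurable hm
    · refine Eventually.of_forall fun σ => Eventually.of_forall fun τ => ?_
      by_cases h : (σ, τ) ∈ D.E (a₀, t)
      · have hτ : τ ∈ Icc t c.2 := ⟨h.2.2, (hc h).2⟩
        rw [indicator_of_mem hτ]
        exact hΛτ σ τ
      · simp only [hf, indicator_of_notMem h, norm_zero]
        exact indicator_nonneg (fun _ _ => abs_nonneg _) _
    · rw [integrable_indicator_iff measurableSet_Icc]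
      exact integrableOn_const (by simp)
    -- Only the height `L₂ ν₀` of the curve over `s₀` is critical. Below it a slightly earlier curve
    -- point has larger abscissa, so membership persists on both sides of `s₀`; outside the closed
    -- set, non-membership persists.
    · have hne : ∀ᵐ τ ∂(volume : Measure ℝ), τ ≠ D.L₂ ν₀ := by simp [ae_iff]
      filter_upwards [hne] with τ hτ
      have hout : (s₀, τ) ∉ D.E (a₀, t) → Tendsto (fun σ => f (σ, τ)) (𝓝 s₀) (𝓝 (f (s₀, τ))) := by
        intro h
        have h1 : ∀ᶠ σ in 𝓝 s₀, (σ, τ) ∉ D.E (a₀, t) :=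
          (show Continuous fun σ : ℝ => (σ, τ) by fun_prop).continuousAt.eventually
            (hE.isClosed.isOpen_compl.mem_nhds h)
        simp only [hf, indicator_of_notMem h]
        refine tendsto_const_nhds.congr' ?_
        filter_upwards [h1] with σ hσ
        rw [indicator_of_notMem hσ]
      by_cases hin : (s₀, τ) ∈ D.E (a₀, t)
      · have h2 : τ ≤ D.L₂ ν₀ := by
          obtain ⟨⟨_, _, ν, hν⟩, _⟩ := hin
          have h3 : ν ≤ ν₀ := not_lt.1 fun h4 =>
            not_le.2 ((oblique_strict hD hδ hν₀).1 ν h4) (hs₀ ▸ hν.1)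
          exact hν.2.trans (hD.mono h3)
        have h2' : τ < D.L₂ ν₀ := lt_of_le_of_ne h2 hτ
        have h4 : ∀ᶠ ν in 𝓝[<] ν₀, τ < D.L₂ ν ∧ ν < ν₀ :=
          (((hD.cont₂.tendsto ν₀).eventually_const_lt h2').filter_mono nhdsWithin_le_nhds).and
            self_mem_nhdsWithin
        obtain ⟨ν, hν1, hν2⟩ := h4.exists
        have h5 : s₀ < D.L₁ ν := hs₀ ▸ (oblique_strict hD hδ hν₀).2 ν hν2
        have h6 : ∀ᶠ σ in 𝓝 s₀, (σ, τ) ∈ D.E (a₀, t) := by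
          filter_upwards [Ioo_mem_nhds ha h5] with σ hσ
          exact ⟨⟨ha0.trans hσ.1, ht0.trans_le hin.2.2, ν, hσ.2.le, hν1.le⟩, hσ.1.le, hin.2.2⟩
        have h7 : ContinuousAt (fun σ => b (σ, τ)) s₀ := by
          refine (hb (s₀, τ) hin).tendsto.comp (f := fun σ => (σ, τ))
            (tendsto_nhdsWithin_iff.2 ⟨?_, h6⟩)
          exact (show Continuous fun σ : ℝ => (σ, τ) by fun_prop).tendsto s₀
        simp only [hf, indicator_of_mem hin]
        refine h7.tendsto.congr' ?_
        filter_upwards [h6] with σ hσ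
        rw [indicator_of_mem hσ]
      · exact hout hin
  refine ⟨-J s₀, ?_, ?_⟩
  · rw [abs_neg, ← hslice]
    have hm : MeasurableSet {τ | (s₀, τ) ∈ D.E (a₀, t)} := hEm.preimage (by fun_prop)
    have h1 : J s₀ = ∫ τ in {τ | (s₀, τ) ∈ D.E (a₀, t)}, b (s₀, τ) := by
      rw [← integral_indicator hm]
      simp [hJ, hf, indicator_apply]
    rw [h1]
    refine norm_setIntegral_le_of_norm_le_const (f := fun τ => b (s₀, τ)) ?_ fun τ hτ =>
      hbΛ (s₀, τ) hτ
    refine (measure_mono (t := Prod.snd '' D.E (a₀, t)) fun τ hτ => ?_).trans_lt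
      (hE.image continuous_snd).measure_lt_top
    exact ⟨(s₀, τ), hτ, rfl⟩
  · have hftc : HasDerivAt (fun s => ∫ σ in a₀..s, J σ) (J s₀) s₀ :=
      intervalIntegral.integral_hasDerivAt_right hJi.intervalIntegrable
        ⟨univ, univ_mem, hJi.aestronglyMeasurable.restrict⟩ hcontJ
    refine (hftc.const_sub (∫ σ in Ioi a₀, J σ)).congr_of_eventuallyEq ?_
    filter_upwards [Ioi_mem_nhds ha] with s hs
    have hs' : a₀ < s := hs
    rw [hrepr s hs'.le, ← intervalIntegral.integral_Ioi_sub_Ioi hJi.integrableOn hs'.le]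
    ring

/-- Being `C¹` on `T` at the corner `(p, p)` provides derivatives at nearby points of `T`, with norm
at most `‖f' (p, p)‖ + 1`. The derivative in the second argument is one-sided, since `R w` lives
only below `w`. -/
theorem IsRegular.exists_deriv_R (hD : D.IsRegular) {p : ℝ × ℝ} (hp : p ∈ D.G) (i j : Fin n) :
    ∃ Λ, 0 ≤ Λ ∧ ∀ᶠ v in 𝓝 (p, p), v ∈ D.T → ∃ d, |d| ≤ Λ ∧
      HasDerivWithinAt (fun s => D.R v.1 (s, v.2.2) i j) d (Iic v.1.1) v.2.1 := by
  have hpT : (p, p) ∈ D.T := ⟨hp.1, hp.2.1, le_rfl, hp⟩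
  have hc : ContDiffWithinAt ℝ (0 + 1) (fun v : (ℝ × ℝ) × (ℝ × ℝ) => D.R v.1 v.2 i j) D.T (p, p) := by
    simpa using hD.R_smooth i j (p, p) hpT
  rw [contDiffWithinAt_succ_iff_hasFDerivWithinAt (by simp)] at hc
  obtain ⟨u, hu, -, f', hf', hcf'⟩ := hc
  rw [insert_eq_of_mem hpT] at hu
  have hb : ∀ᶠ v in 𝓝[D.T] (p, p), ‖f' v‖ ≤ ‖f' (p, p)‖ + 1 := by
    have h1 : Tendsto (fun v => ‖f' v‖) (𝓝[u] (p, p)) (𝓝 ‖f' (p, p)‖) :=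
      hcf'.continuousWithinAt.norm
    exact ((h1.eventually_lt_const (lt_add_one _)).filter_mono (nhdsWithin_le_iff.2 hu)).mono
      fun _ h => h.le
  refine ⟨(‖f' (p, p)‖ + 1), by positivity, ?_⟩
  have hev := eventually_eventually_nhds.2 (eventually_nhdsWithin_iff.1
    ((show ∀ᶠ v in 𝓝[D.T] (p, p), v ∈ u from hu).and hb))
  filter_upwards [hev] with v hv hvT
  have h1 := hv.self_of_nhds hvT
  have huv : u ∈ 𝓝[D.T] v := eventually_nhdsWithin_iff.2 (hv.mono fun x hx hxT => (hx hxT).1)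
  have h2 := (hf' v h1.1).mono_of_mem_nhdsWithin huv
  have h3 : HasDerivWithinAt (fun s : ℝ => ((v.1, (s, v.2.2)) : (ℝ × ℝ) × (ℝ × ℝ)))
      (0, (1, 0)) (Ioc 0 v.1.1) v.2.1 :=
    (hasDerivWithinAt_const _ _ _).prodMk
      ((hasDerivWithinAt_id _ _).prodMk (hasDerivWithinAt_const _ _ _))
  have h4 : HasDerivWithinAt (fun s => D.R v.1 (s, v.2.2) i j) (f' v (0, (1, 0)))
      (Ioc 0 v.1.1) v.2.1 := by
    refine HasFDerivWithinAt.comp_hasDerivWithinAt (t := D.T) v.2.1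
      (l := fun v : (ℝ × ℝ) × (ℝ × ℝ) => D.R v.1 v.2 i j) h2 h3 fun s hs => ?_
    exact ⟨hs.1, hvT.2.1, ⟨hs.2, hvT.2.2.1.2⟩, hvT.2.2.2⟩
  refine ⟨f' v (0, (1, 0)), ?_, h4.mono_of_mem_nhdsWithin ?_⟩
  · refine ((f' v).le_opNorm _).trans ?_
    have h5 : ‖((0, (1, 0)) : (ℝ × ℝ) × (ℝ × ℝ))‖ = 1 := by simp [Prod.norm_def]
    rw [h5, mul_one]
    exact h1.2
  · filter_upwards [self_mem_nhdsWithin, mem_nhdsWithin_of_mem_nhds (Ioi_mem_nhds hvT.1)]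
      with s h5 h6 using ⟨h6, h5⟩

/-- The constant and the neighbourhood do not depend on the coefficients, only on their bound. They
therefore serve for all `w` and `ν` at once and for both densities. -/
theorem IsRegular.exists_deriv_sum (hD : D.IsRegular) {p : ℝ × ℝ} (hp : p ∈ D.G) (M : ℝ)
    (j : Fin n) : ∃ Λ, 0 ≤ Λ ∧ ∀ᶠ v in 𝓝 (p, p), v ∈ D.T → ∀ c : Fin n → ℝ, (∀ i, |c i| ≤ M) →
      ∃ d, |d| ≤ Λ ∧
        HasDerivWithinAt (fun s => ∑ i, c i * D.R v.1 (s, v.2.2) i j) d (Iic v.1.1) v.2.1 := by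
  choose Λ hΛ0 hΛ using fun i => hD.exists_deriv_R hp i j
  refine ⟨∑ i, |M| * Λ i, Finset.sum_nonneg fun i _ => mul_nonneg (abs_nonneg _) (hΛ0 i), ?_⟩
  filter_upwards [eventually_all.2 hΛ] with v hv hvT c hc
  choose d hd hd' using fun i => hv i hvT
  refine ⟨∑ i, c i * d i, ?_, HasDerivWithinAt.fun_sum fun i _ => (hd' i).const_mul _⟩
  refine (Finset.abs_sum_le_sum_abs _ _).trans (Finset.sum_le_sum fun i _ => ?_)
  rw [abs_mul]
  exact mul_le_mul ((hc i).trans (le_abs_self M)) (hd i) (abs_nonneg _) (abs_nonneg _)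

/-- Uniform regularity, in the second argument, of the densities near a point of the region. -/
theorem IsRegular.exists_lipschitz (hD : D.IsRegular) {p : ℝ × ℝ} (hp : p ∈ D.G) (M : ℝ)
    (j : Fin n) : ∃ Λ ρ, 0 ≤ Λ ∧ 0 < ρ ∧ ∀ w ∈ D.G, dist w p < ρ → ∀ t, 0 < t → t ≤ w.2 →
      |t - p.2| < ρ → ∀ c : Fin n → ℝ, (∀ i, |c i| ≤ M) →
      (∀ s s', 0 < s → p.1 - ρ < s → s ≤ s' → s' ≤ w.1 →
        |∑ i, c i * D.R w (s', t) i j - ∑ i, c i * D.R w (s, t) i j| ≤ Λ * (s' - s)) ∧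
      ∀ s, 0 < s → p.1 - ρ < s → s < w.1 →
        DifferentiableAt ℝ (fun s => ∑ i, c i * D.R w (s, t) i j) s := by
  obtain ⟨Λ, hΛ0, hΛ⟩ := hD.exists_deriv_sum hp M j
  obtain ⟨ρ, hρ0, hρ⟩ := Metric.eventually_nhds_iff.1 hΛ
  refine ⟨Λ, ρ, hΛ0, hρ0, fun w hw hwp t ht htw htp c hc => ?_⟩
  have hder : ∀ s, 0 < s → p.1 - ρ < s → s ≤ w.1 → ∃ d, |d| ≤ Λ ∧
      HasDerivWithinAt (fun s => ∑ i, c i * D.R w (s, t) i j) d (Iic w.1) s := by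
    intro s hs0 hs hsw
    refine hρ (y := (w, (s, t))) ?_ ⟨hs0, ht, ⟨hsw, htw⟩, hw⟩ c hc
    rw [Prod.dist_eq, Prod.dist_eq, Prod.dist_eq, max_lt_iff, max_lt_iff, max_lt_iff]
    rw [Prod.dist_eq, max_lt_iff] at hwp
    refine ⟨hwp, ?_, htp⟩
    have h1 := hwp.1
    rw [Real.dist_eq, abs_lt] at h1 ⊢
    constructor <;> linarith
  constructor
  · intro s s' hs0 hs hss hsw
    choose! d hd hd' using hder
    have h := Convex.norm_image_sub_le_of_norm_hasDerivWithin_le (s := Icc s s') (f' := d) (C := Λ)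
      (f := fun s => ∑ i, c i * D.R w (s, t) i j) (x := s) (y := s')
      (fun σ hσ => (hd' σ (hs0.trans_le hσ.1) (hs.trans_le hσ.1) (hσ.2.trans hsw)).mono
        fun _ h => h.2.trans hsw)
      (fun σ hσ => hd σ (hs0.trans_le hσ.1) (hs.trans_le hσ.1) (hσ.2.trans hsw))
      (convex_Icc s s') ⟨le_rfl, hss⟩ ⟨hss, le_rfl⟩
    rwa [Real.norm_eq_abs, Real.norm_eq_abs, abs_of_nonneg (sub_nonneg.2 hss)] at h
  · intro s hs0 hs hsw
    obtain ⟨d, -, hd⟩ := hder s hs0 hs hsw.le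
    exact (hd.hasDerivAt (Iic_mem_nhds hsw)).differentiableAt

/-- Derivative of the area term of the co-state. -/
theorem exists_hasDerivAt_area (hD : D.IsRegular) (hδ : StrictAntiOn D.L₁ (Icc (μ - δ) (μ + δ)))
    {j : Fin n} {a₁ s₀ t ν₀ Λ : ℝ} (ha0 : 0 < a₁) (ht0 : 0 < t) (ha : a₁ < s₀)
    (hν₀ : ν₀ ∈ Ioo (μ - δ) (μ + δ)) (hs₀ : D.L₁ ν₀ = s₀) (hΛ : 0 ≤ Λ)
    (hbound : ∀ w s, a₁ < s → w ∈ D.E (s, t) → |D.k j w (s, t)| ≤ Λ)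
    (hlip : ∀ w ∈ D.E (a₁, t), ∀ s s', a₁ < s → s ≤ s' → s' ≤ w.1 →
      |D.k j w (s', t) - D.k j w (s, t)| ≤ Λ * (s' - s))
    (hdiff : ∀ w ∈ D.E (a₁, t), s₀ < w.1 → DifferentiableAt ℝ (fun s => D.k j w (s, t)) s₀) :
    ∃ e, |e| ≤ Λ * (volume.real (D.E (s₀, t)) + volume.real {τ | (s₀, τ) ∈ D.E (s₀, t)}) ∧
      HasDerivAt (fun s => ∫ w in D.E (s, t), D.k j w (s, t)) e s₀ := by
  -- The gap between `a₁` and `a₂` gives the strict inequality `a₁ < w.1` on the set of integration,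
  -- where the kernel is also evaluated at the exit time `w.1`.
  set a₂ := (a₁ + s₀) / 2 with ha₂
  have h12 : a₁ < a₂ := by linarith
  have h20 : a₂ < s₀ := by linarith
  have ha₂0 : 0 < a₂ := ha0.trans h12
  have hE := hD.isCompact_E (q := (a₂, t)) ha₂0 ht0
  have hEm := hE.isClosed.measurableSet
  have hsub : D.E (a₂, t) ⊆ D.E (a₁, t) := E_anti ⟨h12.le, le_rfl⟩
  have hset : ∀ s, MeasurableSet {w : ℝ × ℝ | s ≤ w.1} := fun s =>
    measurableSet_le measurable_const measurable_fst
  have hinter : ∀ s, a₂ ≤ s → {w : ℝ × ℝ | s ≤ w.1} ∩ D.E (a₂, t) = D.E (s, t) := by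
    intro s hs
    ext w
    exact ⟨fun h => ⟨h.2.1, h.1, h.2.2.2⟩, fun h => ⟨h.2.1, h.1, hs.trans h.2.1, h.2.2⟩⟩
  have hrestrict : ∀ s, a₂ ≤ s →
      (volume.restrict (D.E (a₂, t))).restrict {w : ℝ × ℝ | s ≤ w.1} = volume.restrict (D.E (s, t)) :=
    fun s hs => by rw [Measure.restrict_restrict (hset s), hinter s hs]
  have hdiagc : ContinuousOn (fun w : ℝ × ℝ => D.k j w (w.1, t)) (D.E (a₂, t)) :=
    (hD.continuousOn_k j).comp (f := fun w : ℝ × ℝ => (w, (w.1, t))) (by fun_prop)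
      fun w hw => ⟨ha₂0.trans_le hw.2.1, ht0, ⟨le_rfl, hw.2.2⟩, hw.1⟩
  obtain ⟨e, he, hB⟩ := hasDerivAt_integral_E hD hδ ha₂0 ht0 h20 hν₀ hs₀ (Λ := Λ) hdiagc
    fun w hw => hbound w w.1 (h12.trans_le hw.2.1) ⟨hw.1, le_rfl, hw.2.2⟩
  have hfin : IsFiniteMeasure (volume.restrict (D.E (a₂, t))) :=
    ⟨by simpa using hE.measure_lt_top⟩
  have hnear : ∀ᶠ s in 𝓝 s₀, a₂ ≤ s := (lt_mem_nhds h20).mono fun _ h => h.le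
  have key := hasDerivAt_integral_superlevel (m := volume.restrict (D.E (a₂, t)))
    (h := Prod.fst) measurable_fst (k := fun w s => D.k j w (s, t)) (s₀ := s₀) (δ := s₀ - a₁)
    (Λ := Λ) (B' := e) (by linarith) hΛ ?_ (hdiagc.aestronglyMeasurable hEm) ?_ ?_ ?_ ?_ ?_ ?_
  · obtain ⟨e', he', hd⟩ := key
    refine ⟨e' + e, ?_, ?_⟩
    · rw [mul_add]
      refine (abs_add_le _ _).trans (add_le_add ?_ he)
      rwa [measureReal_restrict_apply (hset s₀), hinter s₀ h20.le] at he'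
    · refine hd.congr_of_eventuallyEq ?_
      filter_upwards [hnear] with s hs
      rw [hrestrict s hs]
  · intro s hs
    rw [Measure.restrict_restrict (hset s)]
    refine ContinuousOn.aestronglyMeasurable ?_ ((hset s).inter hEm)
    have hs1 : a₁ < s := by linarith
    exact (hD.continuousOn_k j).comp (f := fun w : ℝ × ℝ => (w, (s, t))) (by fun_prop)
      fun w hw => ⟨ha0.trans hs1, ht0, ⟨hw.1, hw.2.2.2⟩, hw.2.1⟩
  · refine (ae_restrict_iff' hEm).2 (Eventually.of_forall fun w hw => ?_)
    have : a₂ ≤ w.1 := hw.2.1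
    linarith
  · refine (ae_restrict_iff' hEm).2 (Eventually.of_forall fun w hw s hs hsw => ?_)
    exact hbound w s (by linarith) ⟨hw.1, hsw, hw.2.2⟩
  · refine (ae_restrict_iff' hEm).2 (Eventually.of_forall fun w hw s s' hs hss hsw => ?_)
    exact hlip w (hsub hw) s s' (by linarith) hss hsw
  · exact (ae_restrict_iff' hEm).2 (Eventually.of_forall fun w hw hsw => hdiff w (hsub hw) hsw)
  · refine le_antisymm ((Measure.restrict_le_self _).trans ?_) bot_le
    have : {w : ℝ × ℝ | w.1 = s₀} = {s₀} ×ˢ univ := by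
      ext w
      simp
    rw [this, Measure.volume_eq_prod, Measure.prod_prod]
    simp
  · refine hB.congr_of_eventuallyEq ?_
    filter_upwards [hnear] with s hs
    rw [hrestrict s hs]

/-- Derivative of the curve term of the co-state. -/
theorem exists_hasDerivAt_curve (hD : D.IsRegular) (hδ : StrictAntiOn D.L₁ (Icc (μ - δ) (μ + δ)))
    {j : Fin n} {a₁ s₀ t ν₀ Λ d : ℝ} (ha0 : 0 < a₁) (ht0 : 0 < t) (ha : a₁ < s₀)
    (hν₀ : ν₀ ∈ Ioo (μ - δ) (μ + δ)) (hs₀ : D.L₁ ν₀ = s₀) (ht : t < D.L₂ ν₀)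
    (hd : HasStrictDerivAt D.L₁ d ν₀) (hd0 : d ≠ 0) (hv : ∀ r, D.v r ≠ ν₀) (hΛ : 0 ≤ Λ)
    (hbound : ∀ ν s, a₁ < s → ν ∈ D.arc (s, t) → |D.κ j ν (s, t)| ≤ Λ)
    (hlip : ∀ ν ∈ D.arc (a₁, t), ∀ s s', a₁ < s → s ≤ s' → s' ≤ D.L₁ ν →
      |D.κ j ν (s', t) - D.κ j ν (s, t)| ≤ Λ * (s' - s))
    (hdiff : ∀ ν ∈ D.arc (a₁, t), s₀ < D.L₁ ν → DifferentiableAt ℝ (fun s => D.κ j ν (s, t)) s₀) :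
    ∃ e, |e| ≤ Λ * volume.real (D.arc (s₀, t)) ∧
      HasDerivAt (fun s => ∫ ν in D.arc (s, t), D.κ j ν (s, t)) (e + D.κ j ν₀ (s₀, t) * d⁻¹) s₀ := by
  set a₂ := (a₁ + s₀) / 2 with ha₂
  have h12 : a₁ < a₂ := by linarith
  have h20 : a₂ < s₀ := by linarith
  have ha₂0 : 0 < a₂ := ha0.trans h12
  have harc := hD.isCompact_arc (z := (a₂, t)) ha₂0 ht0
  have hm := harc.isClosed.measurableSet
  have hsub : D.arc (a₂, t) ⊆ D.arc (a₁, t) := arc_anti ⟨h12.le, le_rfl⟩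
  have hset : ∀ s, MeasurableSet {ν | s ≤ D.L₁ ν} := fun s =>
    measurableSet_le measurable_const hD.cont₁.measurable
  have hinter : ∀ s, a₂ ≤ s → {ν | s ≤ D.L₁ ν} ∩ D.arc (a₂, t) = D.arc (s, t) := by
    intro s hs
    ext ν
    exact ⟨fun h => ⟨h.1, h.2.2⟩, fun h => ⟨h.1, hs.trans h.1, h.2⟩⟩
  have hrestrict : ∀ s, a₂ ≤ s →
      (volume.restrict (D.arc (a₂, t))).restrict {ν | s ≤ D.L₁ ν} = volume.restrict (D.arc (s, t)) :=
    fun s hs => by rw [Measure.restrict_restrict (hset s), hinter s hs]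
  have hdiagm : AEStronglyMeasurable (fun ν => D.κ j ν (D.L₁ ν, t))
      (volume.restrict (D.arc (a₂, t))) :=
    Finset.aestronglyMeasurable_fun_sum _ fun i _ => hD.aestronglyMeasurable_arc (q := (a₂, t))
      (ζ := fun ν => (D.L₁ ν, t)) ha₂0 ht0 (hD.cont₁.prodMk continuous_const) hm Subset.rfl
      (fun ν hν => ⟨ha₂0.trans_le hν.1, ht0, le_rfl, hν.2⟩) i j
  have hdiagI : IntegrableOn (fun ν => D.κ j ν (D.L₁ ν, t)) (D.arc (a₂, t)) := by
    refine IntegrableOn.of_bound harc.measure_lt_top hdiagm Λ ?_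
    refine (ae_restrict_iff' hm).2 (Eventually.of_forall fun ν hν => ?_)
    exact hbound ν (D.L₁ ν) (h12.trans_le hν.1) ⟨le_rfl, hν.2⟩
  have h₁ : 0 < D.L₁ ν₀ := hs₀ ▸ ha0.trans ha
  have hcont : ContinuousAt (fun ν => D.κ j ν (D.L₁ ν, t)) ν₀ := by
    refine tendsto_finsetSum _ fun i _ => Tendsto.mul
      (hD.F₁_cont i ν₀ h₁ (ht0.trans ht) hv) ?_
    refine (hD.continuousOn_R i j (D.γ ν₀, (D.L₁ ν₀, t))
      ⟨h₁, ht0, ⟨le_rfl, ht.le⟩, γ_mem_G h₁ (ht0.trans ht)⟩).tendsto.comp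
      (f := fun ν => (D.γ ν, (D.L₁ ν, t))) (tendsto_nhdsWithin_iff.2 ⟨?_, ?_⟩)
    · exact (hD.continuous_γ.prodMk (hD.cont₁.prodMk continuous_const)).tendsto ν₀
    · filter_upwards [(hD.cont₁.tendsto ν₀).eventually_const_lt h₁,
        (hD.cont₂.tendsto ν₀).eventually_const_lt ht] with ν h3 h4
      exact ⟨h3, ht0, ⟨le_rfl, h4.le⟩, γ_mem_G h3 (ht0.trans h4)⟩
  have hB := hasDerivAt_integral_arc hD hδ h20 hν₀ hs₀ ht hd hd0 hdiagI hcont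
  have hfin : IsFiniteMeasure (volume.restrict (D.arc (a₂, t))) :=
    ⟨by simpa using harc.measure_lt_top⟩
  have hnear : ∀ᶠ s in 𝓝 s₀, a₂ ≤ s := (lt_mem_nhds h20).mono fun _ h => h.le
  have key := hasDerivAt_integral_superlevel (m := volume.restrict (D.arc (a₂, t)))
    (h := D.L₁) hD.cont₁.measurable (k := fun ν s => D.κ j ν (s, t)) (s₀ := s₀) (δ := s₀ - a₁)
    (Λ := Λ) (B' := D.κ j ν₀ (D.L₁ ν₀, t) * d⁻¹) (by linarith) hΛ ?_ hdiagm ?_ ?_ ?_ ?_ ?_ ?_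
  · obtain ⟨e', he', hd⟩ := key
    refine ⟨e', ?_, ?_⟩
    · rwa [measureReal_restrict_apply (hset s₀), hinter s₀ h20.le] at he'
    · rw [hs₀] at hd
      refine hd.congr_of_eventuallyEq ?_
      filter_upwards [hnear] with s hs
      rw [hrestrict s hs]
  · intro s hs
    have hs1 : a₁ < s := by linarith
    rw [Measure.restrict_restrict (hset s)]
    exact Finset.aestronglyMeasurable_fun_sum _ fun i _ => hD.aestronglyMeasurable_arc (q := (a₂, t))
      (ζ := fun _ => (s, t)) ha₂0 ht0 continuous_const ((hset s).inter hm) inter_subset_right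
      (fun ν hν => ⟨ha0.trans hs1, ht0, hν.1, hν.2.2⟩) i j
  · refine (ae_restrict_iff' hm).2 (Eventually.of_forall fun ν hν => ?_)
    have : a₂ ≤ D.L₁ ν := hν.1
    linarith
  · refine (ae_restrict_iff' hm).2 (Eventually.of_forall fun ν hν s hs hsw => ?_)
    exact hbound ν s (by linarith) ⟨hsw, hν.2⟩
  · refine (ae_restrict_iff' hm).2 (Eventually.of_forall fun w hw s s' hs hss hsw => ?_)
    exact hlip w (hsub hw) s s' (by linarith) hss hsw
  · exact (ae_restrict_iff' hm).2 (Eventually.of_forall fun w hw hsw => hdiff w (hsub hw) hsw)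
  · refine le_antisymm ((Measure.restrict_le_self _).trans ?_) bot_le
    have : {ν | D.L₁ ν = s₀} ⊆ {ν₀} := by
      intro ν hν
      have hst := oblique_strict hD hδ hν₀
      have hν' : D.L₁ ν = s₀ := hν
      rcases lt_trichotomy ν ν₀ with h | h | h
      · linarith [hst.2 ν h]
      · exact h
      · linarith [hst.1 ν h]
    exact (measure_mono this).trans (by simp)
  · refine hB.congr_of_eventuallyEq ?_
    filter_upwards [hnear] with s hs
    rw [hrestrict s hs]

/-- The `s`-derivative of the co-state near a point of an oblique part of the curve. -/
theorem oblique_exists_hasDerivAt (hD : D.IsRegular) (hO : D.IsObliqueAt μ) (j : Fin n) {d : ℝ → ℝ}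
    (hd : ∀ᶠ ν in 𝓝 μ, HasStrictDerivAt D.L₁ (d ν) ν ∧ d ν ≠ 0) :
    ∃ Λ, ∀ᶠ z : ℝ × ℝ in 𝓝 (D.γ μ), (∃ ν, z.1 < D.L₁ ν ∧ z.2 < D.L₂ ν) → ∃ ν₀ ∈ D.arc z,
      ∃ e, |e| ≤ Λ * (volume.real (D.E z) + volume.real {τ | (z.1, τ) ∈ D.E z}
        + volume.real (D.arc z)) ∧
      HasDerivAt (fun s => D.costate (s, z.2) j) (e + D.κ j ν₀ z * (d ν₀)⁻¹) z.1 := by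
  classical
  obtain ⟨h₁, h₂, hv, δ, hδ0, hδ₁, hδ₂⟩ := id hO
  set p := D.γ μ with hp
  set q : ℝ × ℝ := (D.L₁ μ / 2, D.L₂ μ / 2) with hq
  have hq₁ : 0 < q.1 := half_pos h₁
  have hq₂ : 0 < q.2 := half_pos h₂
  have hqe : ∀ᶠ z in 𝓝 p, q ≤ z := half_pos_le_eventually (p := D.γ μ) h₁ h₂
  obtain ⟨M, hM0, hMk, hMκ⟩ := hD.exists_bound_density hq₁ hq₂ j
  obtain ⟨M', hM'0, hF, hF₁⟩ := hD.exists_bound_F hq₁ hq₂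
  obtain ⟨Λ, ρ, hΛ0, hρ0, hlip⟩ := hD.exists_lipschitz (γ_mem_G h₁ h₂) M' j
  have hvn : (range D.v)ᶜ ∈ 𝓝 μ := (finite_range D.v).isClosed.isOpen_compl.mem_nhds
    fun ⟨r, hr⟩ => hv r hr
  have hgood := (hqe.and (Metric.ball_mem_nhds p hρ0)).and
    ((oblique_E_subset hD hO (Metric.ball_mem_nhds p hρ0)).and (oblique_arc_subset hD hO
      (inter_mem (inter_mem (Ioo_mem_nhds (show μ - δ < μ by linarith) (show μ < μ + δ by linarith))
        hvn) hd)))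
  -- Within distance `η` all requirements hold together: bounds, Lipschitz estimates, an arc inside
  -- the interval of strict monotonicity, no vertex, and an invertible derivative of `L₁`.
  obtain ⟨η, hη0, hη⟩ := Metric.eventually_nhds_iff.1 hgood
  refine ⟨Λ + M, ?_⟩
  filter_upwards [Metric.ball_mem_nhds p hη0] with z hz ⟨ν, hν₁, hν₂⟩
  obtain ⟨s₀, t⟩ := z
  simp only at hν₁ hν₂ ⊢
  rw [Metric.mem_ball, Prod.dist_eq, max_lt_iff, Real.dist_eq, Real.dist_eq] at hz
  have hz1 := abs_lt.1 hz.1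
  -- Halfway to the left edge of the ball, so that `(a₁, t)` is still in it. As the sets above a
  -- corner only shrink when `s` grows, its estimates hold for all `s ≥ a₁`.
  set a₁ := (s₀ + (p.1 - η)) / 2 with ha₁
  have ha : a₁ < s₀ := by linarith
  have hball : ∀ s, a₁ ≤ s → s ≤ s₀ → dist (s, t) p < η := by
    intro s hs hs'
    rw [Prod.dist_eq, max_lt_iff, Real.dist_eq, Real.dist_eq]
    refine ⟨abs_lt.2 ⟨?_, ?_⟩, hz.2⟩ <;> simp only <;> linarith
  obtain ⟨⟨hqz, hzρ⟩, hEz, hAz⟩ := hη (hball a₁ le_rfl ha.le)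
  have ha0 : 0 < a₁ := hq₁.trans_le hqz.1
  have ht0 : 0 < t := hq₂.trans_le hqz.2
  rw [Prod.dist_eq, max_lt_iff, Real.dist_eq, Real.dist_eq] at hzρ
  have haρ : p.1 - ρ < a₁ := by
    have := (abs_lt.1 hzρ.1).1
    simp only at this
    linarith
  have htρ : |t - p.2| < ρ := hzρ.2
  have hνarc : ν ∈ D.arc (a₁, t) := ⟨(ha.trans hν₁).le, hν₂.le⟩
  have hνI := (hAz hνarc).1.1
  -- Otherwise `μ + δ` would lie in an arc contained in the open interval. Hence `L₁` takes the
  -- value `s₀` between `ν` and `μ + δ`; that parameter is the moving end of the arc.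
  have hδs : D.L₁ (μ + δ) < s₀ := by
    by_contra h
    have h3 : μ + δ ∈ D.arc (a₁, t) :=
      ⟨ha.le.trans (not_lt.1 h), hν₂.le.trans (hD.mono hνI.2.le)⟩
    exact lt_irrefl _ (hAz h3).1.1.2
  obtain ⟨ν₀, hν₀, hs₀⟩ : ∃ ν₀ ∈ Icc ν (μ + δ), D.L₁ ν₀ = s₀ :=
    intermediate_value_Icc' hνI.2.le hD.cont₁.continuousOn ⟨hδs.le, hν₁.le⟩
  have htν₀ : t < D.L₂ ν₀ := hν₂.trans_le (hD.mono hν₀.1)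
  have hν₀arc : ν₀ ∈ D.arc (s₀, t) := ⟨hs₀.ge, htν₀.le⟩
  obtain ⟨⟨hν₀I, hν₀v⟩, hν₀d⟩ := hAz (arc_anti (z := (a₁, t)) (z' := (s₀, t)) ⟨ha.le, le_rfl⟩ hν₀arc)
  have hqs : ∀ s, a₁ < s → q ≤ (s, t) := fun s hs => ⟨hqz.1.trans hs.le, hqz.2⟩
  obtain ⟨e₁, he₁, hd₁⟩ := exists_hasDerivAt_area hD hδ₁ (j := j) (Λ := Λ + M) ha0 ht0 ha hν₀I hs₀
    (by positivity) (fun w s hs hw => (hMk w _ (hqs s hs) hw).trans (by linarith))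
    (fun w hw s s' hs hss hsw => by
      refine ((hlip w hw.1 (hEz hw) t ht0 hw.2.2 htρ (fun i => D.F i w)
        (hF w (hqz.trans hw.2) hw.1)).1 s s' (ha0.trans hs) (haρ.trans hs) hss hsw).trans ?_
      exact mul_le_mul_of_nonneg_right (by linarith) (sub_nonneg.2 hss))
    (fun w hw hsw => (hlip w hw.1 (hEz hw) t ht0 hw.2.2 htρ (fun i => D.F i w)
        (hF w (hqz.trans hw.2) hw.1)).2 s₀ (ha0.trans ha) (haρ.trans ha) hsw)
  obtain ⟨e₂, he₂, hd₂⟩ := exists_hasDerivAt_curve hD hδ₁ (j := j) (Λ := Λ + M) ha0 ht0 ha hν₀I hs₀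
    htν₀ hν₀d.1 hν₀d.2 (fun r hr => hν₀v ⟨r, hr⟩)
    (by positivity) (fun w s hs hw => (hMκ w _ (hqs s hs) hw).trans (by linarith))
    (fun w hw s s' hs hss hsw => by
      have hw' := γ_mem_E (z := (a₁, t)) ha0 ht0 hw
      refine ((hlip _ hw'.1 (hEz hw') t ht0 hw'.2.2 htρ (fun i => D.F₁ i w)
        (hF₁ w (hqz.trans hw))).1 s s' (ha0.trans hs) (haρ.trans hs) hss hsw).trans ?_
      exact mul_le_mul_of_nonneg_right (by linarith) (sub_nonneg.2 hss))
    (fun w hw hsw => by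
      have hw' := γ_mem_E (z := (a₁, t)) ha0 ht0 hw
      exact (hlip _ hw'.1 (hEz hw') t ht0 hw'.2.2 htρ (fun i => D.F₁ i w)
        (hF₁ w (hqz.trans hw))).2 s₀ (ha0.trans ha) (haρ.trans ha) hsw)
  refine ⟨ν₀, hν₀arc, e₁ + e₂, ?_, ?_⟩
  · refine (abs_add_le _ _).trans ((add_le_add he₁ he₂).trans (le_of_eq ?_))
    ring
  · have h := hd₁.add hd₂
    rw [← add_assoc] at h
    refine h.congr_of_eventuallyEq ?_
    filter_upwards [Ioi_mem_nhds ha] with s hs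
    have hsum : ∑ r, (if (s, t) ≤ D.γ (D.v r) then
        ∑ i, D.F₀ i r * D.R (D.γ (D.v r)) (s, t) i j else 0) = 0 := by
      refine Finset.sum_eq_zero fun r _ => if_neg fun hr => ?_
      have hr' : D.v r ∈ D.arc (a₁, t) := ⟨(le_of_lt (mem_Ioi.1 hs)).trans hr.1, hr.2⟩
      exact (hAz hr').1.2 ⟨r, rfl⟩
    simp only [costate, Pi.add_apply]
    rw [hsum, add_zero]

/-- The limit of the `s`-derivative of the co-state on an oblique part of the curve. -/
theorem oblique_tendsto_deriv (hD : D.IsRegular) (hO : D.IsObliqueAt μ) (j : Fin n) {d : ℝ → ℝ}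
    (hd : ∀ᶠ ν in 𝓝 μ, HasStrictDerivAt D.L₁ (d ν) ν) (hd0 : d μ ≠ 0) (hdc : ContinuousAt d μ) :
    (∀ᶠ z : ℝ × ℝ in 𝓝[{z | ∃ ν, z.1 < D.L₁ ν ∧ z.2 < D.L₂ ν}] (D.γ μ),
      DifferentiableAt ℝ (fun s => D.costate (s, z.2) j) z.1) ∧
    Tendsto (fun z : ℝ × ℝ => deriv (fun s => D.costate (s, z.2) j) z.1)
      (𝓝[{z | ∃ ν, z.1 < D.L₁ ν ∧ z.2 < D.L₂ ν}] (D.γ μ)) (𝓝 (D.F₁ j μ * (d μ)⁻¹)) := by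
  obtain ⟨Λ, hΛ⟩ := oblique_exists_hasDerivAt hD hO j (hd.and (hdc.eventually_ne hd0))
  set l := 𝓝[{z : ℝ × ℝ | ∃ ν, z.1 < D.L₁ ν ∧ z.2 < D.L₂ ν}] (D.γ μ) with hl
  have hle : l ≤ 𝓝 (D.γ μ) := nhdsWithin_le_nhds
  have hex : ∀ᶠ z : ℝ × ℝ in l, ∃ ν₀, ν₀ ∈ D.arc z ∧
      ∃ e, |e| ≤ Λ * (volume.real (D.E z) + volume.real {τ | (z.1, τ) ∈ D.E z}
        + volume.real (D.arc z)) ∧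
      HasDerivAt (fun s => D.costate (s, z.2) j) (e + D.κ j ν₀ z * (d ν₀)⁻¹) z.1 :=
    eventually_nhdsWithin_iff.2 hΛ
  -- The end parameter is chosen as a function of `z`; it tends to `μ` because the arcs shrink to
  -- `μ`.
  obtain ⟨N, hN⟩ := skolem.1 hex
  refine ⟨?_, ?_⟩
  · filter_upwards [hN] with z hz
    obtain ⟨-, e, -, he⟩ := hz
    exact he.differentiableAt
  obtain ⟨e, he⟩ := skolem.1 (hN.mono fun z hz => hz.2)
  have hNμ : Tendsto N l (𝓝 μ) := by
    refine tendsto_def.2 fun U hU => ?_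
    filter_upwards [hN, (oblique_arc_subset hD hO hU).filter_mono hle] with z h1 h2 using h2 h1.1
  have he0 : Tendsto e l (𝓝 0) := by
    have hlim : Tendsto (fun z : ℝ × ℝ => Λ * (volume.real (D.E z)
        + volume.real {τ | (z.1, τ) ∈ D.E z} + volume.real (D.arc z))) l (𝓝 0) := by
      simpa using (((oblique_tendsto_measure_E hD hO).add
        (oblique_tendsto_measure_slice hD hO)).add
        (oblique_tendsto_measure_arc hD hO) |>.mono_left hle).const_mul Λ
    refine squeeze_zero_norm' ?_ hlim
    filter_upwards [he] with z hz using hz.1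
  have hpos : ∀ᶠ z : ℝ × ℝ in l, 0 < z.1 ∧ 0 < z.2 :=
    (((continuous_fst.tendsto (D.γ μ)).eventually_const_lt hO.1).and
      ((continuous_snd.tendsto (D.γ μ)).eventually_const_lt hO.2.1)).filter_mono hle
  have hκ : Tendsto (fun z => D.κ j (N z) z) l (𝓝 (D.F₁ j μ)) := by
    have hG := γ_mem_G hO.1 hO.2.1
    have hval : D.F₁ j μ = ∑ i, D.F₁ i μ * D.R (D.γ μ) (D.γ μ) i j := by
      simp [hD.diag _ hG]
    rw [hval]
    refine tendsto_finsetSum _ fun i _ => Tendsto.mul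
      ((hD.F₁_cont i μ hO.1 hO.2.1 hO.2.2.1).tendsto.comp hNμ) ?_
    refine (hD.continuousOn_R i j (D.γ μ, D.γ μ) ⟨hO.1, hO.2.1, le_rfl, hG⟩).tendsto.comp
      (f := fun z => (D.γ (N z), z)) (tendsto_nhdsWithin_iff.2 ⟨?_, ?_⟩)
    · exact ((hD.continuous_γ.tendsto μ).comp hNμ).prodMk_nhds (tendsto_id.mono_left hle)
    · filter_upwards [hpos, hN] with z h1 h2
      exact ⟨h1.1, h1.2, h2.1, γ_mem_G_of_le h1.1 h1.2 h2.1⟩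
  have hlim := he0.add (hκ.mul ((hdc.tendsto.comp hNμ).inv₀ hd0))
  rw [zero_add] at hlim
  refine hlim.congr' ?_
  filter_upwards [he] with z hz using hz.2.deriv.symm

/-! ### Reflection in the diagonal -/

/-- The data with the two coordinates exchanged and the orientation of the curve reversed. -/
def swap (D : CostateData n) : CostateData n where
  L₁ ν := D.L₂ (-ν)
  L₂ ν := D.L₁ (-ν)
  N := D.N
  v r := -D.v r
  F i w := D.F i w.swap
  F₁ i ν := D.F₁ i (-ν)
  F₀ := D.F₀
  R w z := D.R w.swap z.swap
  A w := D.B w.swap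
  B w := D.A w.swap

theorem swap_γ (ν : ℝ) : D.swap.γ ν = (D.γ (-ν)).swap := rfl

theorem mem_swap_G {w : ℝ × ℝ} : w ∈ D.swap.G ↔ w.swap ∈ D.G := by
  constructor
  · rintro ⟨h1, h2, ν, h3⟩
    exact ⟨h2, h1, -ν, h3.2, h3.1⟩
  · rintro ⟨h1, h2, ν, h3⟩
    refine ⟨h2, h1, -ν, ?_, ?_⟩
    · simpa [swap, γ] using h3.2
    · simpa [swap, γ] using h3.1

theorem swap_arc (z : ℝ × ℝ) : D.swap.arc z = (fun ν => -ν) ⁻¹' D.arc z.swap := by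
  ext ν
  exact ⟨fun h => ⟨h.2, h.1⟩, fun h => ⟨h.2, h.1⟩⟩

theorem swap_E (z : ℝ × ℝ) : D.swap.E z = Prod.swap ⁻¹' D.E z.swap := by
  ext w
  exact ⟨fun h => ⟨mem_swap_G.1 h.1, h.2.2, h.2.1⟩, fun h => ⟨mem_swap_G.2 h.1, h.2.2, h.2.1⟩⟩

/-- Lebesgue measure is invariant under exchange of the coordinates and under change of sign of the
parameter. Reversing the orientation keeps the first coordinate non-increasing. -/
theorem costate_swap (z : ℝ × ℝ) (j : Fin n) : D.swap.costate z j = D.costate z.swap j := by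
  classical
  unfold costate
  congr 1
  · congr 1
    · rw [swap_E]
      have hmp : MeasurePreserving (Prod.swap : ℝ × ℝ → ℝ × ℝ) volume volume :=
        Measure.measurePreserving_swap
      exact hmp.setIntegral_preimage_emb MeasurableEquiv.prodComm.measurableEmbedding
        (fun w => D.k j w z.swap) _
    · rw [swap_arc]
      exact (Measure.measurePreserving_neg (volume : Measure ℝ)).setIntegral_preimage_emb
        (MeasurableEquiv.neg ℝ).measurableEmbedding (fun ν => D.κ j ν z.swap) (D.arc z.swap)
  · refine Finset.sum_congr rfl fun r _ => ?_
    have h' : D.swap.γ (D.swap.v r) = (D.γ (D.v r)).swap := by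
      rw [swap_γ]
      change (D.γ (- -D.v r)).swap = _
      rw [neg_neg]
    have h : z ≤ (D.γ (D.v r)).swap ↔ z.swap ≤ D.γ (D.v r) :=
      ⟨fun h => ⟨h.2, h.1⟩, fun h => ⟨h.2, h.1⟩⟩
    rw [h']
    exact if_congr h rfl rfl

theorem IsRegular.swap (hD : D.IsRegular) : D.swap.IsRegular where
  cont₁ := hD.cont₂.comp continuous_neg
  cont₂ := hD.cont₁.comp continuous_neg
  anti := fun _ _ h => hD.mono (neg_le_neg h)
  mono := fun _ _ h => hD.anti (neg_le_neg h)
  bdd := by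
    refine hD.bdd.neg.subset fun ν hν => ?_
    exact ⟨hν.2, hν.1⟩
  F_cont := fun i => (hD.F_cont i).comp continuous_swap.continuousOn fun _ h => mem_swap_G.1 h
  F₁_cont := fun i ν h₁ h₂ hv => by
    refine ContinuousAt.comp (f := fun ν : ℝ => -ν) (g := D.F₁ i)
      (hD.F₁_cont i (-ν) h₂ h₁ fun r hr => hv r ?_) continuous_neg.continuousAt
    change -D.v r = ν
    rw [hr, neg_neg]
  F₁_bdd := fun i q h₁ h₂ => by
    obtain ⟨M, hM⟩ := hD.F₁_bdd i q.swap h₂ h₁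
    exact ⟨M, fun ν hν => hM (-ν) ⟨hν.2, hν.1⟩⟩
  R_smooth := fun i j => by
    refine ContDiffOn.comp (g := fun v : (ℝ × ℝ) × (ℝ × ℝ) => D.R v.1 v.2 i j)
      (f := fun v : (ℝ × ℝ) × (ℝ × ℝ) => (v.1.swap, v.2.swap)) (hD.R_smooth i j) ?_ ?_
    · have : ContDiff ℝ 1 (fun v : (ℝ × ℝ) × (ℝ × ℝ) => ((v.1.2, v.1.1), (v.2.2, v.2.1))) := by
        fun_prop
      exact this.contDiffOn
    · exact fun v hv => ⟨hv.2.1, hv.1, ⟨hv.2.2.1.2, hv.2.2.1.1⟩, mem_swap_G.1 hv.2.2.2⟩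
  A_cont := fun i k => (hD.B_cont i k).comp continuous_swap.continuousOn fun _ h => mem_swap_G.1 h
  B_cont := fun i k => (hD.A_cont i k).comp continuous_swap.continuousOn fun _ h => mem_swap_G.1 h
  char_s := fun z h₁ h₂ s hs hG i j => by
    refine (hD.char_t z.swap h₂ h₁ s hs (mem_swap_G.1 hG) i j).mono fun s' h => ?_
    exact ⟨h.1, mem_swap_G.1 h.2⟩
  char_t := fun z h₁ h₂ s hs hG i j => by
    refine (hD.char_s z.swap h₂ h₁ s hs (mem_swap_G.1 hG) i j).mono fun s' h => ?_
    exact ⟨h.1, mem_swap_G.1 h.2⟩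
  diag := fun z hz i j => hD.diag z.swap (mem_swap_G.1 hz) i j

/-- Near the parameter `μ` the curve is a vertical segment, parametrized by arc length. -/
def IsVerticalAt (D : CostateData n) (μ : ℝ) : Prop :=
  0 < D.L₁ μ ∧ 0 < D.L₂ μ ∧ (∀ r, D.v r ≠ μ) ∧
    ∃ δ > 0, ∀ ν ∈ Icc (μ - δ) (μ + δ), D.L₁ ν = D.L₁ μ ∧ D.L₂ ν = D.L₂ μ + (ν - μ)

theorem IsVerticalAt.swap (h : D.IsVerticalAt μ) : D.swap.IsHorizontalAt (-μ) := by
  obtain ⟨h₁, h₂, hv, δ, hδ0, hδ⟩ := h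
  refine ⟨by simpa [CostateData.swap] using h₂, by simpa [CostateData.swap] using h₁,
    fun r hr => hv r (neg_injective hr), δ, hδ0, fun ν hν => ?_⟩
  have h := hδ (-ν) ⟨by linarith [hν.2], by linarith [hν.1]⟩
  simp only [CostateData.swap, neg_neg]
  refine ⟨h.1, h.2.trans ?_⟩
  ring

theorem IsObliqueAt.swap (h : D.IsObliqueAt μ) : D.swap.IsObliqueAt (-μ) := by
  obtain ⟨h₁, h₂, hv, δ, hδ0, hδ₁, hδ₂⟩ := h
  have hmem : ∀ ν ∈ Icc (-μ - δ) (-μ + δ), -ν ∈ Icc (μ - δ) (μ + δ) := fun ν hν =>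
    ⟨by linarith [hν.2], by linarith [hν.1]⟩
  exact ⟨by simpa [CostateData.swap] using h₂, by simpa [CostateData.swap] using h₁,
    fun r hr => hv r (neg_injective hr), δ, hδ0,
    fun a ha b hb hab => hδ₂ (hmem b hb) (hmem a ha) (neg_lt_neg hab),
    fun a ha b hb hab => hδ₁ (hmem b hb) (hmem a ha) (neg_lt_neg hab)⟩

theorem vertical_tendsto (hD : D.IsRegular) (hV : D.IsVerticalAt μ) (j : Fin n) :
    Tendsto (fun z => D.costate z j) (𝓝[D.G] (D.γ μ)) (𝓝 (D.costate (D.γ μ) j)) := by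
  have h := horizontal_tendsto hD.swap hV.swap j
  have hγ : D.swap.γ (-μ) = (D.γ μ).swap := by simp [swap_γ]
  rw [hγ] at h
  simp only [costate_swap, Prod.swap_swap] at h
  have hs : Tendsto Prod.swap (𝓝[D.G] (D.γ μ)) (𝓝[D.swap.G] (D.γ μ).swap) := by
    refine tendsto_nhdsWithin_iff.2
      ⟨(continuous_swap.tendsto _).mono_left nhdsWithin_le_nhds, ?_⟩
    filter_upwards [self_mem_nhdsWithin] with z hz
    exact mem_swap_G.2 (by simpa using hz)
  refine (h.comp hs).congr fun z => ?_
  simp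

/-- The co-state is differentiable along a vertical part of the curve. -/
theorem vertical_hasDerivAt (hD : D.IsRegular) (hV : D.IsVerticalAt μ) (j : Fin n) :
    HasDerivAt (fun ν => D.costate (D.γ ν) j)
      (-(D.F₁ j μ + ∑ i, D.costate (D.γ μ) i * D.B (D.γ μ) i j)) μ := by
  have h := horizontal_hasDerivAt hD.swap hV.swap j
  simp only [costate_swap, swap_γ, Prod.swap_swap, neg_neg] at h
  -- The reversal of the parameter is the source of the minus sign.
  have h2 := HasDerivAt.comp μ (h₂ := fun ν => D.costate (D.γ (-ν)) j) (h := fun ν : ℝ => -ν)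
    h (hasDerivAt_neg μ)
  have h3 : D.swap.F₁ j (-μ) = D.F₁ j μ := by simp [CostateData.swap]
  rw [h3, mul_neg_one] at h2
  refine (h2.congr_of_eventuallyEq (Eventually.of_forall fun ν => ?_))
  simp

/-- The limit of the `t`-derivative of the co-state on an oblique part of the curve. -/
theorem oblique_tendsto_deriv_snd (hD : D.IsRegular) (hO : D.IsObliqueAt μ) (j : Fin n)
    {d : ℝ → ℝ} (hd : ∀ᶠ ν in 𝓝 μ, HasStrictDerivAt D.L₂ (d ν) ν) (hd0 : d μ ≠ 0)
    (hdc : ContinuousAt d μ) :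
    (∀ᶠ z : ℝ × ℝ in 𝓝[{z | ∃ ν, z.1 < D.L₁ ν ∧ z.2 < D.L₂ ν}] (D.γ μ),
      DifferentiableAt ℝ (fun t => D.costate (z.1, t) j) z.2) ∧
    Tendsto (fun z : ℝ × ℝ => deriv (fun t => D.costate (z.1, t) j) z.2)
      (𝓝[{z | ∃ ν, z.1 < D.L₁ ν ∧ z.2 < D.L₂ ν}] (D.γ μ)) (𝓝 (-(D.F₁ j μ * (d μ)⁻¹))) := by
  have hneg : Tendsto (fun ν : ℝ => -ν) (𝓝 (-μ)) (𝓝 μ) := by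
    simpa using (continuous_neg.tendsto (-μ))
  -- The first coordinate of the reflected curve is `L₂ (-ν)`, so its derivative is `-d (-ν)`.
  have h := oblique_tendsto_deriv hD.swap hO.swap j (d := fun ν => -d (-ν)) ?_ ?_ ?_
  · have hγ : D.swap.γ (-μ) = (D.γ μ).swap := by simp [swap_γ]
    rw [hγ] at h
    simp only [costate_swap, neg_neg, Prod.swap_prod_mk] at h
    have hs : Tendsto Prod.swap (𝓝[{z | ∃ ν, z.1 < D.L₁ ν ∧ z.2 < D.L₂ ν}] (D.γ μ))
        (𝓝[{z | ∃ ν, z.1 < D.swap.L₁ ν ∧ z.2 < D.swap.L₂ ν}] (D.γ μ).swap) := by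
      refine tendsto_nhdsWithin_iff.2
        ⟨(continuous_swap.tendsto _).mono_left nhdsWithin_le_nhds, ?_⟩
      filter_upwards [self_mem_nhdsWithin] with z hz
      obtain ⟨ν, h1, h2⟩ := hz
      refine ⟨-ν, ?_, ?_⟩ <;> simpa [CostateData.swap]
    have h3 : D.swap.F₁ j (-μ) = D.F₁ j μ := by simp [CostateData.swap]
    rw [h3, inv_neg, mul_neg] at h
    refine ⟨?_, (h.2.comp hs).congr fun z => ?_⟩
    · filter_upwards [hs.eventually h.1] with z hz
      simpa only [Prod.fst_swap, Prod.snd_swap] using hz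
    · simp only [Function.comp_apply, Prod.fst_swap, Prod.snd_swap]
  · filter_upwards [hneg.eventually hd] with ν hν
    have := HasStrictDerivAt.comp ν hν (hasStrictDerivAt_neg ν)
    rw [mul_neg_one] at this
    exact this
  · simpa using hd0
  · have : ContinuousAt d (- -μ) := by simpa using hdc
    exact (this.comp (f := fun ν : ℝ => -ν) continuous_neg.continuousAt).neg

end CostateData

/-! ### Arcs of the boundary curve and the region off the axes -/

namespace BoundaryCurve

variable (C : BoundaryCurve)

theorem len_pos : 0 < C.len := by
  rw [← C.vert_zero, ← C.vert_last]
  exact C.vert_strictMono (Fin.last_pos)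

theorem vert_nonneg (r : Fin (C.N + 2)) : 0 ≤ C.vert r := by
  rw [← C.vert_zero]
  exact C.vert_strictMono.monotone (Fin.zero_le r)

theorem vert_le_len (r : Fin (C.N + 2)) : C.vert r ≤ C.len := by
  rw [← C.vert_last]
  exact C.vert_strictMono.monotone (Fin.le_last r)

theorem exists_mem_arc {μ : ℝ} (hμ : μ ∈ Icc 0 C.len) :
    ∃ r : Fin (C.N + 1), μ ∈ Icc (C.vert r.castSucc) (C.vert r.succ) := by
  have key : ∀ k : Fin (C.N + 2), μ ≤ C.vert k →
      ∃ r : Fin (C.N + 1), μ ∈ Icc (C.vert r.castSucc) (C.vert r.succ) := by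
    intro k
    induction k using Fin.induction with
    | zero =>
      intro h
      rw [C.vert_zero] at h
      refine ⟨0, ?_, h.trans (C.vert_nonneg _)⟩
      rw [Fin.castSucc_zero, C.vert_zero]
      exact hμ.1
    | succ k ih =>
      intro h
      rcases le_total μ (C.vert k.castSucc) with h' | h'
      · exact ih h'
      · exact ⟨k, h', h⟩
  exact key (Fin.last _) (C.vert_last ▸ hμ.2)

theorem exists_mem_open_arc {μ : ℝ} (hμ : μ ∈ Icc 0 C.len) (hv : ∀ r, C.vert r ≠ μ) :
    ∃ r : Fin (C.N + 1), μ ∈ Ioo (C.vert r.castSucc) (C.vert r.succ) := by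
  obtain ⟨r, h⟩ := C.exists_mem_arc hμ
  exact ⟨r, lt_of_le_of_ne h.1 (hv _), lt_of_le_of_ne h.2 (hv _).symm⟩

theorem continuousOn_of_arcs {f : ℝ → ℝ}
    (hf : ∀ r : Fin (C.N + 1), ContinuousOn f (Icc (C.vert r.castSucc) (C.vert r.succ))) :
    ContinuousOn f (Icc 0 C.len) := by
  have key : ∀ k : Fin (C.N + 2), ContinuousOn f (Icc 0 (C.vert k)) := by
    intro k
    induction k using Fin.induction with
    | zero => simp [C.vert_zero]
    | succ k ih =>
      have h := ih.union_of_isClosed (hf k) isClosed_Icc isClosed_Icc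
      rwa [Icc_union_Icc_eq_Icc (C.vert_nonneg _)
        (C.vert_strictMono.monotone (Fin.castSucc_lt_succ (i := k)).le)] at h
  exact C.vert_last ▸ key (Fin.last _)

/-- The nearest point of the parameter interval. -/
noncomputable def clamp (ν : ℝ) : ℝ := max 0 (min C.len ν)

theorem clamp_mem (ν : ℝ) : C.clamp ν ∈ Icc 0 C.len :=
  ⟨le_max_left _ _, max_le C.len_pos.le (min_le_left _ _)⟩

theorem clamp_of_mem {ν : ℝ} (h : ν ∈ Icc 0 C.len) : C.clamp ν = ν := by
  rw [clamp, min_eq_right h.2, max_eq_right h.1]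

theorem clamp_monotone : Monotone C.clamp := fun _ _ h => max_le_max le_rfl (min_le_min le_rfl h)

theorem continuous_clamp : Continuous C.clamp := by
  unfold clamp
  fun_prop

/-- Parameters outside the interval are sent to the end points of the curve, which lie on the axes.
Extending the curve to `ℝ` thus adds nothing above a point off the axes. -/
theorem mem_Ioo_of_pos {ν : ℝ} (h₁ : 0 < C.L₁ (C.clamp ν)) (h₂ : 0 < C.L₂ (C.clamp ν)) :
    ν ∈ Ioo 0 C.len := by
  constructor
  · by_contra h
    have : C.clamp ν = 0 := by
      rw [clamp]
      exact max_eq_left ((min_le_right _ _).trans (not_lt.1 h))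
    rw [this, C.start.2] at h₂
    exact lt_irrefl _ h₂
  · by_contra h
    have : C.clamp ν = C.len := by
      rw [clamp, min_eq_left (not_lt.1 h), max_eq_right C.len_pos.le]
    rw [this, C.finish.1] at h₁
    exact lt_irrefl _ h₁

theorem arc_subset (r : Fin (C.N + 1)) :
    Icc (C.vert r.castSucc) (C.vert r.succ) ⊆ Icc 0 C.len :=
  Icc_subset_Icc (C.vert_nonneg _) (C.vert_le_len _)

theorem open_arc_subset (r : Fin (C.N + 1)) :
    Ioo (C.vert r.castSucc) (C.vert r.succ) ⊆ Ioo 0 C.len :=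
  Ioo_subset_Ioo (C.vert_nonneg _) (C.vert_le_len _)

/-- The closed arc between consecutive vertices, without the end points of the curve. -/
def innerArc (r : Fin (C.N + 1)) : Set ℝ :=
  Icc (C.vert r.castSucc) (C.vert r.succ) ∩ Ioo 0 C.len

theorem open_arc_subset_innerArc (r : Fin (C.N + 1)) :
    Ioo (C.vert r.castSucc) (C.vert r.succ) ⊆ C.innerArc r :=
  fun _ h => ⟨Ioo_subset_Icc_self h, C.open_arc_subset r h⟩

theorem innerArc_mem_nhds {r : Fin (C.N + 1)} {ν : ℝ}
    (h : ν ∈ Ioo (C.vert r.castSucc) (C.vert r.succ)) : C.innerArc r ∈ 𝓝 ν :=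
  mem_of_superset (isOpen_Ioo.mem_nhds h) (C.open_arc_subset_innerArc r)

theorem uniqueDiffOn_innerArc (r : Fin (C.N + 1)) : UniqueDiffOn ℝ (C.innerArc r) := by
  refine uniqueDiffOn_convex ((convex_Icc _ _).inter (convex_Ioo _ _)) ?_
  have h : C.vert r.castSucc < C.vert r.succ := C.vert_strictMono (Fin.castSucc_lt_succ (i := r))
  exact (nonempty_Ioo.2 h).mono (isOpen_Ioo.subset_interior_iff.2 (C.open_arc_subset_innerArc r))

/-- The part of the region off the coordinate axes. -/
def posRegion : Set (ℝ × ℝ) := C.region ∩ {z | 0 < z.1 ∧ 0 < z.2}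

theorem isOpen_pos : IsOpen {z : ℝ × ℝ | 0 < z.1 ∧ 0 < z.2} :=
  (isOpen_lt continuous_const continuous_fst).inter (isOpen_lt continuous_const continuous_snd)

theorem point_mem_posRegion {ν : ℝ} (h : ν ∈ Ioo 0 C.len) : C.point ν ∈ C.posRegion :=
  ⟨⟨C.point ν, ⟨ν, Ioo_subset_Icc_self h, rfl⟩, (C.pos ν h).1.le, le_rfl, (C.pos ν h).2.le, le_rfl⟩,
    C.pos ν h⟩

/-- Each point `z` is the upper corner of the rectangle between `z / 2` and `z`, which is contained
in the set. Derivatives within the region are thus unique also at its boundary points on the curve.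
-/
theorem uniqueDiffOn_posRegion : UniqueDiffOn ℝ C.posRegion := by
  rintro z ⟨⟨w, hw, hz⟩, h₁, h₂⟩
  have hlt₁ : z.1 / 2 < z.1 := by linarith
  have hlt₂ : z.2 / 2 < z.2 := by linarith
  have hint : (interior (Icc (z.1 / 2) z.1 ×ˢ Icc (z.2 / 2) z.2)).Nonempty := by
    rw [interior_prod_eq, interior_Icc, interior_Icc]
    exact (nonempty_Ioo.2 hlt₁).prod (nonempty_Ioo.2 hlt₂)
  refine (uniqueDiffWithinAt_convex ((convex_Icc (z.1 / 2) z.1).prod (convex_Icc (z.2 / 2) z.2))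
    hint (subset_closure ⟨⟨hlt₁.le, le_rfl⟩, hlt₂.le, le_rfl⟩)).mono ?_
  rintro y ⟨hy₁, hy₂⟩
  have h3 : 0 < y.1 := (half_pos h₁).trans_le hy₁.1
  have h4 : 0 < y.2 := (half_pos h₂).trans_le hy₂.1
  exact ⟨⟨w, hw, h3.le, hy₁.2.trans hz.2.1, h4.le, hy₂.2.trans hz.2.2.2⟩, h3, h4⟩

end BoundaryCurve

/-! ### Regularity along a trajectory -/

/-- The chain rule for partial derivatives. -/
theorem pd_comp {n : ℕ} {E : Type*} [NormedAddCommGroup E] [NormedSpace ℝ E] {g : E → ℝ}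
    (hg : Differentiable ℝ g) {l : (Fin n → ℝ) → E} {l' : (Fin n → ℝ) →L[ℝ] E} {y : Fin n → ℝ}
    (hl : HasFDerivAt l l' y) (i : Fin n) :
    pd (fun y => g (l y)) y i = fderiv ℝ g (l y) (l' (Pi.single i 1)) :=
  congrArg (fun l => l (Pi.single i 1)) ((hg (l y)).hasFDerivAt.comp y hl).fderiv

/-- Partial derivatives of a function of five variables with respect to the second one. -/
theorem pd_slot₂ {n m : ℕ}
    {g : (ℝ × ℝ) × (Fin n → ℝ) × (Fin n → ℝ) × (Fin n → ℝ) × (Fin m → ℝ) → ℝ}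
    (hg : Differentiable ℝ g) (z : ℝ × ℝ) (x p q : Fin n → ℝ) (u : Fin m → ℝ) (i : Fin n) :
    pd (fun y => g (z, y, p, q, u)) x i
      = fderiv ℝ g (z, x, p, q, u) (0, Pi.single i 1, 0, 0, 0) :=
  pd_comp hg
    ((hasFDerivAt_const z x).prodMk ((hasFDerivAt_id x).prodMk ((hasFDerivAt_const p x).prodMk
      ((hasFDerivAt_const q x).prodMk (hasFDerivAt_const u x))))) i

theorem pd_slot₃ {n m : ℕ}
    {g : (ℝ × ℝ) × (Fin n → ℝ) × (Fin n → ℝ) × (Fin n → ℝ) × (Fin m → ℝ) → ℝ}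
    (hg : Differentiable ℝ g) (z : ℝ × ℝ) (x p q : Fin n → ℝ) (u : Fin m → ℝ) (i : Fin n) :
    pd (fun y => g (z, x, y, q, u)) p i
      = fderiv ℝ g (z, x, p, q, u) (0, 0, Pi.single i 1, 0, 0) :=
  pd_comp hg
    ((hasFDerivAt_const z p).prodMk ((hasFDerivAt_const x p).prodMk ((hasFDerivAt_id p).prodMk
      ((hasFDerivAt_const q p).prodMk (hasFDerivAt_const u p))))) i

theorem pd_slot₄ {n m : ℕ}
    {g : (ℝ × ℝ) × (Fin n → ℝ) × (Fin n → ℝ) × (Fin n → ℝ) × (Fin m → ℝ) → ℝ}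
    (hg : Differentiable ℝ g) (z : ℝ × ℝ) (x p q : Fin n → ℝ) (u : Fin m → ℝ) (i : Fin n) :
    pd (fun y => g (z, x, p, y, u)) q i
      = fderiv ℝ g (z, x, p, q, u) (0, 0, 0, Pi.single i 1, 0) :=
  pd_comp hg
    ((hasFDerivAt_const z q).prodMk ((hasFDerivAt_const x q).prodMk ((hasFDerivAt_const p q).prodMk
      ((hasFDerivAt_id q).prodMk (hasFDerivAt_const u q))))) i

/-- Partial derivatives of a function of three variables. -/
theorem pd_mid {n : ℕ} {g : (ℝ × ℝ) × (Fin n → ℝ) × (Fin n → ℝ) → ℝ}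
    (hg : Differentiable ℝ g) (z : ℝ × ℝ) (x p : Fin n → ℝ) (i : Fin n) :
    pd (fun y => g (z, y, p)) x i = fderiv ℝ g (z, x, p) (0, Pi.single i 1, 0) :=
  pd_comp hg
    ((hasFDerivAt_const z x).prodMk ((hasFDerivAt_id x).prodMk (hasFDerivAt_const p x))) i

theorem pd_last {n : ℕ} {g : (ℝ × ℝ) × (Fin n → ℝ) × (Fin n → ℝ) → ℝ}
    (hg : Differentiable ℝ g) (z : ℝ × ℝ) (x p : Fin n → ℝ) (i : Fin n) :
    pd (fun y => g (z, x, y)) p i = fderiv ℝ g (z, x, p) (0, 0, Pi.single i 1) :=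
  pd_comp hg
    ((hasFDerivAt_const z p).prodMk ((hasFDerivAt_const x p).prodMk (hasFDerivAt_id p))) i

namespace ControlledPair

variable {n m : ℕ} {S : ControlledPair n m}

/-- The open quadrant is a neighbourhood of the point, so intersecting with it does not change the
derivative within the region. This permits work on `posRegion`. -/
theorem ds_eq {V : Type*} [NormedAddCommGroup V] [NormedSpace ℝ V] (g : ℝ × ℝ → V) {z : ℝ × ℝ}
    (hz : z ∈ S.C.posRegion) : S.ds g z = fderivWithin ℝ g S.C.posRegion z (1, 0) := by
  rw [ds, BoundaryCurve.posRegion, fderivWithin_inter (BoundaryCurve.isOpen_pos.mem_nhds hz.2)]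

theorem dt_eq {V : Type*} [NormedAddCommGroup V] [NormedSpace ℝ V] (g : ℝ × ℝ → V) {z : ℝ × ℝ}
    (hz : z ∈ S.C.posRegion) : S.dt g z = fderivWithin ℝ g S.C.posRegion z (0, 1) := by
  rw [dt, BoundaryCurve.posRegion, fderivWithin_inter (BoundaryCurve.isOpen_pos.mem_nhds hz.2)]

theorem contDiffOn_ds {V : Type*} [NormedAddCommGroup V] [NormedSpace ℝ V] {g : ℝ × ℝ → V}
    {k l : WithTop ℕ∞} (hg : ContDiffOn ℝ k g S.C.posRegion) (hkl : l + 1 ≤ k) :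
    ContDiffOn ℝ l (S.ds g) S.C.posRegion :=
  ((hg.fderivWithin S.C.uniqueDiffOn_posRegion hkl).clm_apply contDiffOn_const).congr
    fun _ hz => ds_eq g hz

theorem contDiffOn_dt {V : Type*} [NormedAddCommGroup V] [NormedSpace ℝ V] {g : ℝ × ℝ → V}
    {k l : WithTop ℕ∞} (hg : ContDiffOn ℝ k g S.C.posRegion) (hkl : l + 1 ≤ k) :
    ContDiffOn ℝ l (S.dt g) S.C.posRegion :=
  ((hg.fderivWithin S.C.uniqueDiffOn_posRegion hkl).clm_apply contDiffOn_const).congr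
    fun _ hz => dt_eq g hz

variable {x₁ x₂ : ℝ → (Fin n → ℝ)}

theorem IsTrajectory.contDiffOn_pos (hx : S.IsTrajectory x₁ x₂) :
    ContDiffOn ℝ 2 S.x S.C.posRegion := hx.contDiffOn_x.mono inter_subset_left

theorem IsTrajectory.contDiffOn_jet (hx : S.IsTrajectory x₁ x₂) :
    ContDiffOn ℝ 1 (fun z => (z, S.x z, S.ds S.x z, S.dt S.x z, S.u z)) S.C.posRegion :=
  contDiffOn_id.prodMk ((hx.contDiffOn_pos.of_le (by norm_num)).prodMk
    ((contDiffOn_ds hx.contDiffOn_pos (by norm_num)).prodMk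
      ((contDiffOn_dt hx.contDiffOn_pos (by norm_num)).prodMk
        (hx.contDiffOn_u.mono inter_subset_left))))

/-- Partial derivatives of smooth functions along a trajectory are of class `C¹`. -/
theorem IsTrajectory.contDiffOn_fderiv_jet (hx : S.IsTrajectory x₁ x₂)
    {g : (ℝ × ℝ) × (Fin n → ℝ) × (Fin n → ℝ) × (Fin n → ℝ) × (Fin m → ℝ) → ℝ}
    (hg : ContDiff ℝ 2 g) (e : (ℝ × ℝ) × (Fin n → ℝ) × (Fin n → ℝ) × (Fin n → ℝ) × (Fin m → ℝ)) :
    ContDiffOn ℝ 1 (fun z => fderiv ℝ g (z, S.x z, S.ds S.x z, S.dt S.x z, S.u z) e)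
      S.C.posRegion :=
  ((hg.fderiv_right (m := 1) (by norm_num)).comp_contDiffOn hx.contDiffOn_jet).clm_apply
    contDiffOn_const

theorem contDiff_f_apply (hD : S.D.IsSmooth) (i : Fin n) : ContDiff ℝ 2
    fun w : (ℝ × ℝ) × (Fin n → ℝ) × (Fin n → ℝ) × (Fin n → ℝ) × (Fin m → ℝ) =>
      S.D.f w.1 w.2.1 w.2.2.1 w.2.2.2.1 w.2.2.2.2 i := contDiff_pi.1 hD.f i

theorem contDiffOn_fp (hD : S.D.IsSmooth) (hx : S.IsTrajectory x₁ x₂) (i k : Fin n) :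
    ContDiffOn ℝ 1 (S.fp i k) S.C.posRegion :=
  (hx.contDiffOn_fderiv_jet (contDiff_f_apply hD i) _).congr fun _ _ =>
    pd_slot₃ ((contDiff_f_apply hD i).differentiable (by norm_num)) _ _ _ _ _ k

theorem contDiffOn_fq (hD : S.D.IsSmooth) (hx : S.IsTrajectory x₁ x₂) (i k : Fin n) :
    ContDiffOn ℝ 1 (S.fq i k) S.C.posRegion :=
  (hx.contDiffOn_fderiv_jet (contDiff_f_apply hD i) _).congr fun _ _ =>
    pd_slot₄ ((contDiff_f_apply hD i).differentiable (by norm_num)) _ _ _ _ _ k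

theorem contDiffOn_Φx (hD : S.D.IsSmooth) (hx : S.IsTrajectory x₁ x₂) (i : Fin n) :
    ContDiffOn ℝ 1 (S.Φx i) S.C.posRegion :=
  (hx.contDiffOn_fderiv_jet hD.Φ _).congr fun _ _ =>
    pd_slot₂ (hD.Φ.differentiable (by norm_num)) _ _ _ _ _ i

theorem contDiffOn_Φp (hD : S.D.IsSmooth) (hx : S.IsTrajectory x₁ x₂) (i : Fin n) :
    ContDiffOn ℝ 1 (S.Φp i) S.C.posRegion :=
  (hx.contDiffOn_fderiv_jet hD.Φ _).congr fun _ _ =>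
    pd_slot₃ (hD.Φ.differentiable (by norm_num)) _ _ _ _ _ i

theorem contDiffOn_Φq (hD : S.D.IsSmooth) (hx : S.IsTrajectory x₁ x₂) (i : Fin n) :
    ContDiffOn ℝ 1 (S.Φq i) S.C.posRegion :=
  (hx.contDiffOn_fderiv_jet hD.Φ _).congr fun _ _ =>
    pd_slot₄ (hD.Φ.differentiable (by norm_num)) _ _ _ _ _ i

theorem continuousOn_F (hD : S.D.IsSmooth) (hx : S.IsTrajectory x₁ x₂) (i : Fin n) :
    ContinuousOn (S.F i) S.C.posRegion :=
  ((contDiffOn_Φx hD hx i).continuousOn.sub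
    (contDiffOn_ds (l := 0) (contDiffOn_Φp hD hx i) (by norm_num)).continuousOn).sub
    (contDiffOn_dt (l := 0) (contDiffOn_Φq hD hx i) (by norm_num)).continuousOn

/-- On each arc, the density `F₁` extends continuously to the vertices. -/
theorem exists_continuousOn_F₁ (hD : S.D.IsSmooth) (hx : S.IsTrajectory x₁ x₂) (i : Fin n)
    (r : Fin (S.C.N + 1)) : ∃ g : ℝ → ℝ, ContinuousOn g (S.C.innerArc r) ∧
      ∀ ν ∈ Ioo (S.C.vert r.castSucc) (S.C.vert r.succ), S.F₁ i ν = g ν := by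
  set J := S.C.innerArc r with hJ
  -- Derivatives taken within the arc are continuous up to the vertices and agree with `deriv`
  -- between them; they are used to define the extension.
  have hu : UniqueDiffOn ℝ J := S.C.uniqueDiffOn_innerArc r
  have hL₁ : ContDiffOn ℝ 2 S.C.L₁ J := (S.C.contDiffOn_L₁ r).mono inter_subset_left
  have hL₂ : ContDiffOn ℝ 2 S.C.L₂ J := (S.C.contDiffOn_L₂ r).mono inter_subset_left
  have hd₁ : ContDiffOn ℝ 1 (derivWithin S.C.L₁ J) J := hL₁.derivWithin hu (by norm_num)
  have hd₂ : ContDiffOn ℝ 1 (derivWithin S.C.L₂ J) J := hL₂.derivWithin hu (by norm_num)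
  have hpt : ContDiffOn ℝ 1 S.C.point J := (hL₁.prodMk hL₂).of_le (by norm_num)
  have hmaps : MapsTo S.C.point J S.C.posRegion := fun ν hν => S.C.point_mem_posRegion hν.2
  have hη : ContDiffOn ℝ 1 (fun ν => derivWithin S.C.L₁ J ν • S.ds S.x (S.C.point ν)
      + derivWithin S.C.L₂ J ν • S.dt S.x (S.C.point ν)) J :=
    (hd₁.smul ((contDiffOn_ds hx.contDiffOn_pos (by norm_num)).comp hpt hmaps)).add
      (hd₂.smul ((contDiffOn_dt hx.contDiffOn_pos (by norm_num)).comp hpt hmaps))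
  set η : ℝ → (Fin n → ℝ) := fun ν => derivWithin S.C.L₁ J ν • S.ds S.x (S.C.point ν)
      + derivWithin S.C.L₂ J ν • S.dt S.x (S.C.point ν) with hηdef
  have hxp : ContDiffOn ℝ 1 (fun ν => S.x (S.C.point ν)) J :=
    (hx.contDiffOn_pos.of_le (by norm_num)).comp hpt hmaps
  set Ψ : (ℝ × ℝ) × (Fin n → ℝ) × (Fin n → ℝ) → ℝ := fun w => S.D.Φ₁ w.1 w.2.1 w.2.2 with hΨ
  have hΨs : ContDiff ℝ 2 Ψ := hD.Φ₁
  have hΨd : Differentiable ℝ Ψ := hΨs.differentiable (by norm_num)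
  have hpart : ∀ e, ContDiffOn ℝ 1
      (fun ν => fderiv ℝ Ψ (S.C.point ν, S.x (S.C.point ν), η ν) e) J := fun e =>
    ((hΨs.fderiv_right (m := 1) (by norm_num)).comp_contDiffOn
      (hpt.prodMk (hxp.prodMk hη))).clm_apply contDiffOn_const
  have hder : ∀ ν ∈ Ioo (S.C.vert r.castSucc) (S.C.vert r.succ),
      derivWithin S.C.L₁ J ν = deriv S.C.L₁ ν ∧ derivWithin S.C.L₂ J ν = deriv S.C.L₂ ν :=
    fun ν hν => ⟨derivWithin_of_mem_nhds (S.C.innerArc_mem_nhds hν),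
      derivWithin_of_mem_nhds (S.C.innerArc_mem_nhds hν)⟩
  have hxμ : ∀ ν ∈ Ioo (S.C.vert r.castSucc) (S.C.vert r.succ), S.xμ ν = η ν := by
    intro ν hν
    simp only [xμ, hηdef, BoundaryCurve.n₁, BoundaryCurve.n₂, (hder ν hν).1, (hder ν hν).2, neg_neg]
  refine ⟨fun ν => derivWithin S.C.L₂ J ν * S.Φp i (S.C.point ν)
    + -derivWithin S.C.L₁ J ν * S.Φq i (S.C.point ν)
    + fderiv ℝ Ψ (S.C.point ν, S.x (S.C.point ν), η ν) (0, Pi.single i 1, 0)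
    - derivWithin (fun ν => fderiv ℝ Ψ (S.C.point ν, S.x (S.C.point ν), η ν)
        (0, 0, Pi.single i 1)) J ν, ?_, fun ν hν => ?_⟩
  · refine ContinuousOn.sub (((hd₂.continuousOn.mul ?_).add (hd₁.continuousOn.neg.mul ?_)).add
      (hpart _).continuousOn) ?_
    · exact (contDiffOn_Φp hD hx i).continuousOn.comp hpt.continuousOn hmaps
    · exact (contDiffOn_Φq hD hx i).continuousOn.comp hpt.continuousOn hmaps
    · exact ((hpart _).derivWithin (m := 0) hu (by norm_num)).continuousOn
  · have hev : S.Φ₁η i =ᶠ[𝓝 ν] fun ν => fderiv ℝ Ψ (S.C.point ν, S.x (S.C.point ν), η ν)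
        (0, 0, Pi.single i 1) := by
      filter_upwards [isOpen_Ioo.mem_nhds hν] with ν' hν'
      rw [← hxμ ν' hν']
      exact pd_last hΨd _ _ _ i
    have hx1 : S.Φ₁x i ν = fderiv ℝ Ψ (S.C.point ν, S.x (S.C.point ν), η ν)
        (0, Pi.single i 1, 0) := by
      rw [← hxμ ν hν]
      exact pd_mid hΨd _ _ _ i
    simp only [F₁, hx1, hev.deriv_eq, BoundaryCurve.n₁, BoundaryCurve.n₂, derivWithin_of_mem_nhds (S.C.innerArc_mem_nhds hν), hJ]

/-! ### Passage to the abstract data -/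

/-- The data of the co-state formula of a controlled pair. -/
noncomputable def toData (S : ControlledPair n m) (R : ℝ × ℝ → ℝ × ℝ → Fin n → Fin n → ℝ) :
    CostateData n where
  L₁ ν := S.C.L₁ (S.C.clamp ν)
  L₂ ν := S.C.L₂ (S.C.clamp ν)
  N := S.C.N
  v r := S.C.vert r.succ.castSucc
  F := S.F
  F₁ := S.F₁
  F₀ i r := S.F₀ i r.succ.castSucc
  R := R
  A z i k := S.fq i k z
  B z i k := S.fp i k z

variable {R : ℝ × ℝ → ℝ × ℝ → Fin n → Fin n → ℝ}

theorem toData_γ (ν : ℝ) : (S.toData R).γ ν = S.C.point (S.C.clamp ν) := rfl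

theorem toData_γ_of_mem {ν : ℝ} (hν : ν ∈ Icc 0 S.C.len) : (S.toData R).γ ν = S.C.point ν := by
  rw [toData_γ, S.C.clamp_of_mem hν]

theorem toData_G : (S.toData R).G = S.C.posRegion := by
  ext w
  constructor
  · rintro ⟨h1, h2, ν, h3⟩
    exact ⟨⟨_, ⟨_, S.C.clamp_mem ν, rfl⟩, h1.le, h3.1, h2.le, h3.2⟩, h1, h2⟩
  · rintro ⟨⟨_, ⟨ν, hν, rfl⟩, hw⟩, h1, h2⟩
    exact ⟨h1, h2, ν, by rw [toData_γ_of_mem hν]; exact ⟨hw.2.1, hw.2.2.2⟩⟩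

/-- The substantial fields concern `F₁`: it is continuous between vertices, and bounded because on
each closed arc it has a continuous extension. -/
theorem toData_isRegular (hD : S.D.IsSmooth) (hx : S.IsTrajectory x₁ x₂)
    (hR : S.IsRiemannFunction R) : (S.toData R).IsRegular := by
  have hc₁ : Continuous (S.toData R).L₁ :=
    (S.C.continuousOn_of_arcs fun r => (S.C.contDiffOn_L₁ r).continuousOn).comp_continuous
      S.C.continuous_clamp S.C.clamp_mem
  have hc₂ : Continuous (S.toData R).L₂ :=
    (S.C.continuousOn_of_arcs fun r => (S.C.contDiffOn_L₂ r).continuousOn).comp_continuous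
      S.C.continuous_clamp S.C.clamp_mem
  have hIoo : ∀ ν, 0 < (S.toData R).L₁ ν → 0 < (S.toData R).L₂ ν → ν ∈ Ioo 0 S.C.len :=
    fun ν h₁ h₂ => S.C.mem_Ioo_of_pos h₁ h₂
  have hsubR : (S.toData R).T ⊆ {v | v.1 ∈ S.C.region ∧ v.2 ∈ quadRect v.1} := by
    rintro v ⟨h1, h2, h3, h4⟩
    rw [toData_G] at h4
    exact ⟨h4.1, h1.le, h3.1, h2.le, h3.2⟩
  exact {
    cont₁ := hc₁
    cont₂ := hc₂
    anti := fun a b h => S.C.antitone_L₁ (S.C.clamp_mem a) (S.C.clamp_mem b) (S.C.clamp_monotone h)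
    mono := fun a b h => S.C.monotone_L₂ (S.C.clamp_mem a) (S.C.clamp_mem b) (S.C.clamp_monotone h)
    bdd := Metric.isBounded_Ioo 0 S.C.len |>.subset fun ν hν => hIoo ν hν.1 hν.2
    F_cont := fun i => by
      rw [toData_G]
      exact continuousOn_F hD hx i
    F₁_cont := fun i ν h₁ h₂ hv => by
      have hν := hIoo ν h₁ h₂
      -- The marked parameters are only those of the inner vertices; the two end vertices are
      -- excluded because `ν` is interior.
      obtain ⟨r, hr⟩ := S.C.exists_mem_open_arc (Ioo_subset_Icc_self hν) (by
        intro r hr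
        induction r using Fin.cases with
        | zero =>
          rw [S.C.vert_zero] at hr
          exact hν.1.ne hr
        | succ r =>
          induction r using Fin.lastCases with
          | last =>
            rw [Fin.succ_last, S.C.vert_last] at hr
            exact hν.2.ne' hr
          | cast r => exact hv r hr)
      obtain ⟨g, hg, hFg⟩ := exists_continuousOn_F₁ hD hx i r
      refine (hg.continuousAt (S.C.innerArc_mem_nhds hr)).congr ?_
      filter_upwards [isOpen_Ioo.mem_nhds hr] with ν' hν' using (hFg ν' hν').symm
    F₁_bdd := fun i q h₁ h₂ => by
      have hK : IsCompact {ν | q ≤ (S.toData R).γ ν} :=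
        Metric.isCompact_of_isClosed_isBounded (isClosed_le continuous_const (hc₁.prodMk hc₂))
          ((Metric.isBounded_Ioo 0 S.C.len).subset fun ν hν =>
            hIoo ν (h₁.trans_le hν.1) (h₂.trans_le hν.2))
      have hsub : ∀ ν, q ≤ (S.toData R).γ ν → ν ∈ Ioo 0 S.C.len := fun ν hν =>
        hIoo ν (h₁.trans_le hν.1) (h₂.trans_le hν.2)
      have : ∀ r : Fin (S.C.N + 1), ∃ M, 0 ≤ M ∧ ∀ ν, q ≤ (S.toData R).γ ν →
          ν ∈ Ioo (S.C.vert r.castSucc) (S.C.vert r.succ) → |S.F₁ i ν| ≤ M := by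
        intro r
        obtain ⟨g, hg, hFg⟩ := exists_continuousOn_F₁ hD hx i r
        obtain ⟨M, hM⟩ := (hK.inter_right (isClosed_Icc (a := S.C.vert r.castSucc)
          (b := S.C.vert r.succ))).exists_bound_of_continuousOn
          (hg.mono fun ν hν => ⟨hν.2, hsub ν hν.1⟩)
        refine ⟨|M|, abs_nonneg _, fun ν hν hνr => ?_⟩
        rw [hFg ν hνr]
        exact (hM ν ⟨hν, Ioo_subset_Icc_self hνr⟩).trans (le_abs_self M)
      choose M hM0 hM using this
      -- At a vertex the value of `F₁` has no meaning, `deriv` possibly being a default there; these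
      -- finitely many values are simply added to the bound.
      refine ⟨∑ r, M r + ∑ r, |S.F₁ i (S.C.vert r)|, fun ν hν => ?_⟩
      change |S.F₁ i ν| ≤ _
      have hs1 : 0 ≤ ∑ r, M r := Finset.sum_nonneg fun r _ => hM0 r
      have hs2 : 0 ≤ ∑ r, |S.F₁ i (S.C.vert r)| := Finset.sum_nonneg fun r _ => abs_nonneg _
      by_cases hvert : ∃ r, S.C.vert r = ν
      · obtain ⟨r, rfl⟩ := hvert
        have := Finset.single_le_sum (f := fun r => |S.F₁ i (S.C.vert r)|)
          (fun _ _ => abs_nonneg _) (Finset.mem_univ r)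
        linarith
      · obtain ⟨r, hr⟩ := S.C.exists_mem_open_arc (Ioo_subset_Icc_self (hsub ν hν))
          fun r hr => hvert ⟨r, hr⟩
        have := Finset.single_le_sum (f := M) (fun r _ => hM0 r) (Finset.mem_univ r)
        linarith [hM r ν hν hr]
    R_smooth := fun i j => (hR.contDiffOn i j).mono hsubR
    A_cont := fun i k => by
      rw [toData_G]
      exact (contDiffOn_fq hD hx i k).continuousOn
    B_cont := fun i k => by
      rw [toData_G]
      exact (contDiffOn_fp hD hx i k).continuousOn
    char_s := fun z h₁ h₂ s hs hG i j => by
      rw [toData_G] at hG ⊢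
      exact (hR.char_s z h₁ h₂ s hs hG.1 i j).mono fun s' h => ⟨h.1, h.2.1⟩
    char_t := fun z h₁ h₂ s hs hG i j => by
      rw [toData_G] at hG ⊢
      exact (hR.char_t z h₁ h₂ s hs hG.1 i j).mono fun s' h => ⟨h.1, h.2.1⟩
    diag := fun z hz i j => by
      rw [toData_G] at hz
      exact hR.diag z hz.1 hz.2.1 hz.2.2 i j }

/-- Off the axes, whatever lies above `z` is itself off the axes. So removing the axes from `G` and
prolonging the parametrization change neither the sets of integration nor the vertex terms. -/
theorem costate_eq_toData (hD : S.D.IsSmooth) (hx : S.IsTrajectory x₁ x₂)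
    (hR : S.IsRiemannFunction R) {z : ℝ × ℝ} (h₁ : 0 < z.1) (h₂ : 0 < z.2) (j : Fin n) :
    S.costate R z j = (S.toData R).costate z j := by
  classical
  have hreg := toData_isRegular hD hx hR
  have hE : S.C.upperSet z = (S.toData R).E z := by
    ext w
    constructor
    · rintro ⟨hw, hz⟩
      refine ⟨?_, hz.2.1, hz.2.2.2⟩
      rw [toData_G]
      exact ⟨hw, h₁.trans_le hz.2.1, h₂.trans_le hz.2.2.2⟩
    · rintro ⟨hw, hz⟩
      rw [toData_G] at hw
      exact ⟨hw.1, h₁.le, hz.1, h₂.le, hz.2⟩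
  have harc : S.C.upperArc z = (S.toData R).arc z := by
    ext ν
    constructor
    · rintro ⟨hν, hz⟩
      rw [CostateData.mem_arc, toData_γ_of_mem hν]
      exact ⟨hz.2.1, hz.2.2.2⟩
    · intro hν
      have hν' := CostateData.mem_arc.1 hν
      have hmem : ν ∈ Icc 0 S.C.len :=
        Ioo_subset_Icc_self (S.C.mem_Ioo_of_pos (h₁.trans_le hν'.1) (h₂.trans_le hν'.2))
      rw [toData_γ_of_mem hmem] at hν'
      exact ⟨hmem, h₁.le, hν'.1, h₂.le, hν'.2⟩
  unfold costate CostateData.costate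
  rw [hE, harc]
  congr 1
  · congr 1
    refine setIntegral_congr_fun (hreg.measurableSet_arc z) fun ν hν => ?_
    rw [← harc] at hν
    simp only [CostateData.κ, toData_γ_of_mem hν.1]
    rfl
  · refine Finset.sum_congr rfl fun r _ => ?_
    have hγ : (S.toData R).γ ((S.toData R).v r) = S.C.vertex r.succ.castSucc :=
      toData_γ_of_mem ⟨S.C.vert_nonneg _, S.C.vert_le_len _⟩
    rw [hγ]
    refine if_congr ?_ rfl rfl
    exact ⟨fun h => ⟨h.2.1, h.2.2.2⟩, fun h => ⟨h₁.le, h.1, h₂.le, h.2⟩⟩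

/-- The co-state is held fixed in this derivative, and the Hamiltonian is affine in it. -/
theorem Hp_eq (hD : S.D.IsSmooth) (j : Fin n) (z : ℝ × ℝ) :
    S.Hp R j z = S.Φp j z + ∑ i, S.costate R z i * S.fp i j z := by
  have hc : ∀ {g : (ℝ × ℝ) × (Fin n → ℝ) × (Fin n → ℝ) × (Fin n → ℝ) × (Fin m → ℝ) → ℝ},
      ContDiff ℝ 2 g → DifferentiableAt ℝ (fun y => g (z, S.x z, y, S.dt S.x z, S.u z)) (S.ds S.x z) :=
    fun hg => (hg.differentiable (by norm_num)).differentiableAt.comp (S.ds S.x z) (by fun_prop)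
  have h1 := hc hD.Φ
  have h2 := fun i => hc (contDiff_f_apply hD i)
  simp only [Hp, pd, ControlData.H, Φp, fp]
  rw [fderiv_fun_add h1 (DifferentiableAt.fun_sum fun i _ => (h2 i).const_mul _),
    fderiv_fun_sum fun i _ => (h2 i).const_mul _]
  simp only [fderiv_const_mul (h2 _), add_apply, sum_apply, smul_apply, smul_eq_mul]

theorem Hq_eq (hD : S.D.IsSmooth) (j : Fin n) (z : ℝ × ℝ) :
    S.Hq R j z = S.Φq j z + ∑ i, S.costate R z i * S.fq i j z := by
  have hc : ∀ {g : (ℝ × ℝ) × (Fin n → ℝ) × (Fin n → ℝ) × (Fin n → ℝ) × (Fin m → ℝ) → ℝ},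
      ContDiff ℝ 2 g → DifferentiableAt ℝ (fun y => g (z, S.x z, S.ds S.x z, y, S.u z)) (S.dt S.x z) :=
    fun hg => (hg.differentiable (by norm_num)).differentiableAt.comp (S.dt S.x z) (by fun_prop)
  have h1 := hc hD.Φ
  have h2 := fun i => hc (contDiff_f_apply hD i)
  simp only [Hq, pd, ControlData.H, Φq, fq]
  rw [fderiv_fun_add h1 (DifferentiableAt.fun_sum fun i _ => (h2 i).const_mul _),
    fderiv_fun_sum fun i _ => (h2 i).const_mul _]
  simp only [fderiv_const_mul (h2 _), add_apply, sum_apply, smul_apply, smul_eq_mul]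

end ControlledPair

/-! ### Local geometry of flat and oblique parts -/

namespace BoundaryCurve

variable {C : BoundaryCurve} {r : Fin (C.N + 1)} {μ : ℝ}

theorem contDiffAt_L₁ {ν : ℝ} (h : ν ∈ Ioo (C.vert r.castSucc) (C.vert r.succ)) :
    ContDiffAt ℝ 2 C.L₁ ν := (C.contDiffOn_L₁ r).contDiffAt (Icc_mem_nhds h.1 h.2)

theorem contDiffAt_L₂ {ν : ℝ} (h : ν ∈ Ioo (C.vert r.castSucc) (C.vert r.succ)) :
    ContDiffAt ℝ 2 C.L₂ ν := (C.contDiffOn_L₂ r).contDiffAt (Icc_mem_nhds h.1 h.2)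

theorem clamp_eventuallyEq {ν : ℝ} (h : ν ∈ Ioo 0 C.len) : ∀ᶠ ν' in 𝓝 ν, C.clamp ν' = ν' := by
  filter_upwards [isOpen_Ioo.mem_nhds h] with ν' hν'
  exact C.clamp_of_mem (Ioo_subset_Icc_self hν')

/-- The prolonged function is monotone on all of `ℝ` and coincides with `L₁` near `ν`. -/
theorem deriv_L₁_nonpos {ν : ℝ} (h : ν ∈ Ioo 0 C.len) : deriv C.L₁ ν ≤ 0 := by
  have h1 : Antitone fun ν => C.L₁ (C.clamp ν) := fun a b hab =>
    C.antitone_L₁ (C.clamp_mem a) (C.clamp_mem b) (C.clamp_monotone hab)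
  have h2 : (fun ν => C.L₁ (C.clamp ν)) =ᶠ[𝓝 ν] C.L₁ :=
    (clamp_eventuallyEq h).mono fun ν' h' => by simp only [h']
  rw [← h2.deriv_eq]
  exact h1.deriv_nonpos

theorem deriv_L₂_nonneg {ν : ℝ} (h : ν ∈ Ioo 0 C.len) : 0 ≤ deriv C.L₂ ν := by
  have h1 : Monotone fun ν => C.L₂ (C.clamp ν) := fun a b hab =>
    C.monotone_L₂ (C.clamp_mem a) (C.clamp_mem b) (C.clamp_monotone hab)
  have h2 : (fun ν => C.L₂ (C.clamp ν)) =ᶠ[𝓝 ν] C.L₂ :=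
    (clamp_eventuallyEq h).mono fun ν' h' => by simp only [h']
  rw [← h2.deriv_eq]
  exact h1.deriv_nonneg

theorem eventually_point_mem (hμ : μ ∈ Ioo (C.vert r.castSucc) (C.vert r.succ)) {A : Set (ℝ × ℝ)}
    (hA : C.point μ ∈ C.relInterior A) : ∀ᶠ ν in 𝓝 μ, C.point ν ∈ A := by
  have h : Tendsto C.point (𝓝 μ) (𝓝[C.curve] (C.point μ)) := by
    refine tendsto_nhdsWithin_iff.2
      ⟨((contDiffAt_L₁ hμ).continuousAt.prodMk (contDiffAt_L₂ hμ).continuousAt).tendsto, ?_⟩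
    filter_upwards [isOpen_Ioo.mem_nhds hμ] with ν hν
    exact ⟨ν, C.arc_subset r (Ioo_subset_Icc_self hν), rfl⟩
  exact h.eventually hA.2

theorem eq_affine_of_deriv {f : ℝ → ℝ} {c δ : ℝ} (hδ : 0 < δ)
    (hf : ∀ ν ∈ Ioo (μ - δ) (μ + δ), DifferentiableAt ℝ f ν ∧ deriv f ν = c) :
    ∀ ν ∈ Ioo (μ - δ) (μ + δ), f ν = f μ + c * (ν - μ) := by
  have hlin : ∀ ν : ℝ, HasDerivAt (fun ν => f μ + c * (ν - μ)) c ν := fun ν => by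
    simpa using (((hasDerivAt_id ν).sub_const μ).const_mul c).const_add (f μ)
  refine isOpen_Ioo.eqOn_of_deriv_eq isPreconnected_Ioo
    (fun ν hν => (hf ν hν).1.differentiableWithinAt)
    (fun ν _ => (hlin ν).differentiableAt.differentiableWithinAt) (fun ν hν => ?_)
    (x := μ) ⟨by linarith, by linarith⟩ (by simp)
  rw [(hf ν hν).2, (hlin ν).deriv]

theorem exists_Ioo_of_eventually (hμ : μ ∈ Ioo (C.vert r.castSucc) (C.vert r.succ)) {p : ℝ → Prop}
    (hp : ∀ᶠ ν in 𝓝 μ, p ν) : ∃ δ > 0, ∀ ν ∈ Ioo (μ - δ) (μ + δ), p ν ∧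
      ν ∈ Ioo (C.vert r.castSucc) (C.vert r.succ) := by
  obtain ⟨δ, hδ0, hδ⟩ := Metric.eventually_nhds_iff.1
    (hp.and (show ∀ᶠ ν in 𝓝 μ, ν ∈ Ioo (C.vert r.castSucc) (C.vert r.succ) from
      isOpen_Ioo.mem_nhds hμ))
  refine ⟨δ, hδ0, fun ν hν => hδ ?_⟩
  rw [Real.dist_eq, abs_lt]
  constructor <;> linarith [hν.1, hν.2]

/-- Where `L₁` is locally constant, the curve is a vertical segment. -/
theorem vertical_of_eventually (hμ : μ ∈ Ioo (C.vert r.castSucc) (C.vert r.succ))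
    (h : ∀ᶠ ν in 𝓝 μ, C.L₁ ν = C.L₁ μ) : deriv C.L₁ μ = 0 ∧ deriv C.L₂ μ = 1 ∧
      ∃ δ > 0, ∀ ν ∈ Icc (μ - δ) (μ + δ), ν ∈ Ioo (C.vert r.castSucc) (C.vert r.succ) ∧
        C.L₁ ν = C.L₁ μ ∧ C.L₂ ν = C.L₂ μ + (ν - μ) := by
  obtain ⟨δ, hδ0, hδ⟩ := exists_Ioo_of_eventually hμ h
  have hd₁ : ∀ ν ∈ Ioo (μ - δ) (μ + δ), deriv C.L₁ ν = 0 := by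
    intro ν hν
    have : C.L₁ =ᶠ[𝓝 ν] fun _ => C.L₁ μ := by
      filter_upwards [isOpen_Ioo.mem_nhds hν] with ν' hν' using (hδ ν' hν').1
    rw [this.deriv_eq, deriv_const]
  have hd₂ : ∀ ν ∈ Ioo (μ - δ) (μ + δ), deriv C.L₂ ν = 1 := by
    intro ν hν
    -- Unit speed leaves `L₂' = 1` or `L₂' = -1`; monotonicity decides the sign.
    have h1 := C.arcLength r ν (hδ ν hν).2
    have h2 := deriv_L₂_nonneg (C.open_arc_subset r (hδ ν hν).2)
    rw [hd₁ ν hν] at h1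
    nlinarith
  have hμ' : μ ∈ Ioo (μ - δ) (μ + δ) := ⟨by linarith, by linarith⟩
  refine ⟨hd₁ μ hμ', hd₂ μ hμ', δ / 2, by linarith, fun ν hν => ?_⟩
  have hν' : ν ∈ Ioo (μ - δ) (μ + δ) := ⟨by linarith [hν.1], by linarith [hν.2]⟩
  refine ⟨(hδ ν hν').2, (hδ ν hν').1, ?_⟩
  have := eq_affine_of_deriv hδ0 (fun ν hν =>
    ⟨(contDiffAt_L₂ (hδ ν hν).2).differentiableAt (by norm_num), hd₂ ν hν⟩) ν hν'
  linarith

/-- Where `L₂` is locally constant, the curve is a horizontal segment. -/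
theorem horizontal_of_eventually (hμ : μ ∈ Ioo (C.vert r.castSucc) (C.vert r.succ))
    (h : ∀ᶠ ν in 𝓝 μ, C.L₂ ν = C.L₂ μ) : deriv C.L₂ μ = 0 ∧ deriv C.L₁ μ = -1 ∧
      ∃ δ > 0, ∀ ν ∈ Icc (μ - δ) (μ + δ), ν ∈ Ioo (C.vert r.castSucc) (C.vert r.succ) ∧
        C.L₂ ν = C.L₂ μ ∧ C.L₁ ν = C.L₁ μ - (ν - μ) := by
  obtain ⟨δ, hδ0, hδ⟩ := exists_Ioo_of_eventually hμ h
  have hd₂ : ∀ ν ∈ Ioo (μ - δ) (μ + δ), deriv C.L₂ ν = 0 := by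
    intro ν hν
    have : C.L₂ =ᶠ[𝓝 ν] fun _ => C.L₂ μ := by
      filter_upwards [isOpen_Ioo.mem_nhds hν] with ν' hν' using (hδ ν' hν').1
    rw [this.deriv_eq, deriv_const]
  have hd₁ : ∀ ν ∈ Ioo (μ - δ) (μ + δ), deriv C.L₁ ν = -1 := by
    intro ν hν
    have h1 := C.arcLength r ν (hδ ν hν).2
    have h2 := deriv_L₁_nonpos (C.open_arc_subset r (hδ ν hν).2)
    rw [hd₂ ν hν] at h1
    nlinarith
  have hμ' : μ ∈ Ioo (μ - δ) (μ + δ) := ⟨by linarith, by linarith⟩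
  refine ⟨hd₂ μ hμ', hd₁ μ hμ', δ / 2, by linarith, fun ν hν => ?_⟩
  have hν' : ν ∈ Ioo (μ - δ) (μ + δ) := ⟨by linarith [hν.1], by linarith [hν.2]⟩
  refine ⟨(hδ ν hν').2, (hδ ν hν').1, ?_⟩
  have := eq_affine_of_deriv hδ0 (fun ν hν =>
    ⟨(contDiffAt_L₁ (hδ ν hν).2).differentiableAt (by norm_num), hd₁ ν hν⟩) ν hν'
  linarith

/-- Points of a flat part have a common coordinate. -/
theorem IsAxisSegment.common_coordinate {A : Set (ℝ × ℝ)} (hA : IsAxisSegment A) :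
    (∃ c, ∀ w ∈ A, w.1 = c) ∨ ∃ c, ∀ w ∈ A, w.2 = c := by
  obtain ⟨p, q, -, h, rfl⟩ := hA
  rcases h with h | h
  · left
    refine ⟨p.1, ?_⟩
    rintro w ⟨a, b, -, -, hab, rfl⟩
    simp only [Prod.fst_add, Prod.smul_fst, smul_eq_mul, ← h]
    rw [← add_mul, hab, one_mul]
  · right
    refine ⟨p.2, ?_⟩
    rintro w ⟨a, b, -, -, hab, rfl⟩
    simp only [Prod.snd_add, Prod.smul_snd, smul_eq_mul, ← h]
    rw [← add_mul, hab, one_mul]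

/-- The curve is not stationary. -/
theorem not_both_const {ν₁ ν₂ : ℝ} (h : ν₁ < ν₂)
    (hI : Icc ν₁ ν₂ ⊆ Ioo (C.vert r.castSucc) (C.vert r.succ))
    (h₁ : C.L₁ ν₁ = C.L₁ ν₂) : C.L₂ ν₁ ≠ C.L₂ ν₂ := by
  intro h₂
  have hsub : Icc ν₁ ν₂ ⊆ Icc 0 C.len := fun ν hν => C.arc_subset r (Ioo_subset_Icc_self (hI hν))
  have hl := hsub ⟨le_rfl, h.le⟩
  have hr := hsub ⟨h.le, le_rfl⟩
  set ν := (ν₁ + ν₂) / 2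
  have hν : ν ∈ Ioo ν₁ ν₂ := ⟨left_lt_add_div_two.2 h, add_div_two_lt_right.2 h⟩
  have e₁ : C.L₁ =ᶠ[𝓝 ν] fun _ => C.L₁ ν₁ := by
    filter_upwards [isOpen_Ioo.mem_nhds hν] with ν' hν'
    have hm := hsub (Ioo_subset_Icc_self hν')
    exact le_antisymm (C.antitone_L₁ hl hm hν'.1.le) (h₁ ▸ C.antitone_L₁ hm hr hν'.2.le)
  have e₂ : C.L₂ =ᶠ[𝓝 ν] fun _ => C.L₂ ν₁ := by
    filter_upwards [isOpen_Ioo.mem_nhds hν] with ν' hν'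
    have hm := hsub (Ioo_subset_Icc_self hν')
    exact le_antisymm (h₂ ▸ C.monotone_L₂ hm hr hν'.2.le) (C.monotone_L₂ hl hm hν'.1.le)
  have := C.arcLength r ν (hI (Ioo_subset_Icc_self hν))
  rw [e₁.deriv_eq, e₂.deriv_eq] at this
  simp at this

/-- On an oblique part both coordinates are strictly monotone. -/
theorem strict_of_oblique (hμ : μ ∈ Ioo (C.vert r.castSucc) (C.vert r.succ)) {A : Set (ℝ × ℝ)}
    (hA : C.IsObliquePart A) (hμA : C.point μ ∈ C.relInterior A) :
    ∃ δ > 0, (∀ ν ∈ Icc (μ - δ) (μ + δ), ν ∈ Ioo (C.vert r.castSucc) (C.vert r.succ)) ∧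
      StrictAntiOn C.L₁ (Icc (μ - δ) (μ + δ)) ∧ StrictMonoOn C.L₂ (Icc (μ - δ) (μ + δ)) := by
  obtain ⟨δ, hδ0, hδ⟩ := exists_Ioo_of_eventually hμ (eventually_point_mem hμ hμA)
  have hsub : Icc (μ - δ / 2) (μ + δ / 2) ⊆ Ioo (μ - δ) (μ + δ) := fun ν hν =>
    ⟨by linarith [hν.1], by linarith [hν.2]⟩
  have harc : Icc (μ - δ / 2) (μ + δ / 2) ⊆ Ioo (C.vert r.castSucc) (C.vert r.succ) := fun ν hν =>
    (hδ ν (hsub hν)).2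
  have hlen : Icc (μ - δ / 2) (μ + δ / 2) ⊆ Icc 0 C.len := fun ν hν =>
    C.arc_subset r (Ioo_subset_Icc_self (harc hν))
  refine ⟨δ / 2, by linarith, harc, ?_, ?_⟩
  · intro ν₁ h₁ ν₂ h₂ h
    have hI : Icc ν₁ ν₂ ⊆ Icc (μ - δ / 2) (μ + δ / 2) := Icc_subset_Icc h₁.1 h₂.2
    refine lt_of_le_of_ne (C.antitone_L₁ (hlen h₁) (hlen h₂) h.le) fun heq => ?_
    -- If `L₁` repeats a value, it is constant in between while `L₂` varies. By the intermediate
    -- value theorem the curve then covers a whole vertical segment, which an oblique part excludes.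
    have hne := not_both_const h (hI.trans harc) heq.symm
    refine hA.2.2 (segment ℝ (C.point ν₁) (C.point ν₂))
      ⟨_, _, fun h3 => hne (congrArg Prod.snd h3), Or.inl heq.symm, rfl⟩ ?_
    rintro w ⟨a, b, ha, hb, hab, rfl⟩
    have hle := C.monotone_L₂ (hlen h₁) (hlen h₂) h.le
    have hmem : a * C.L₂ ν₁ + b * C.L₂ ν₂ ∈ Icc (C.L₂ ν₁) (C.L₂ ν₂) := by
      have ha' : a = 1 - b := by linarith
      subst ha'
      constructor <;> nlinarith
    obtain ⟨ν, hν, hνe⟩ := intermediate_value_Icc h.le (fun ν hν =>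
      (contDiffAt_L₂ (harc (hI hν))).continuousAt.continuousWithinAt) hmem
    have hc : C.L₁ ν = C.L₁ ν₁ := le_antisymm (C.antitone_L₁ (hlen h₁) (hlen (hI hν)) hν.1)
      (heq ▸ C.antitone_L₁ (hlen (hI hν)) (hlen h₂) hν.2)
    have : a • C.point ν₁ + b • C.point ν₂ = C.point ν := by
      refine Prod.ext ?_ hνe.symm
      simp only [point, Prod.fst_add, Prod.smul_fst, smul_eq_mul, hc, heq]
      rw [← add_mul, hab, one_mul]
    rw [this]
    exact (hδ ν (hsub (hI hν))).1
  · intro ν₁ h₁ ν₂ h₂ h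
    have hI : Icc ν₁ ν₂ ⊆ Icc (μ - δ / 2) (μ + δ / 2) := Icc_subset_Icc h₁.1 h₂.2
    refine lt_of_le_of_ne (C.monotone_L₂ (hlen h₁) (hlen h₂) h.le) fun heq => ?_
    have hne : C.L₁ ν₁ ≠ C.L₁ ν₂ := fun h3 => not_both_const h (hI.trans harc) h3 heq
    refine hA.2.2 (segment ℝ (C.point ν₁) (C.point ν₂))
      ⟨_, _, fun h3 => hne (congrArg Prod.fst h3), Or.inr heq, rfl⟩ ?_
    rintro w ⟨a, b, ha, hb, hab, rfl⟩
    have hle := C.antitone_L₁ (hlen h₁) (hlen h₂) h.le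
    have hmem : a * C.L₁ ν₁ + b * C.L₁ ν₂ ∈ Icc (C.L₁ ν₂) (C.L₁ ν₁) := by
      have ha' : a = 1 - b := by linarith
      subst ha'
      constructor <;> nlinarith
    obtain ⟨ν, hν, hνe⟩ := intermediate_value_Icc' h.le (fun ν hν =>
      (contDiffAt_L₁ (harc (hI hν))).continuousAt.continuousWithinAt) hmem
    have hc : C.L₂ ν = C.L₂ ν₁ := le_antisymm
      (heq ▸ C.monotone_L₂ (hlen (hI hν)) (hlen h₂) hν.2)
      (C.monotone_L₂ (hlen h₁) (hlen (hI hν)) hν.1)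
    have : a • C.point ν₁ + b • C.point ν₂ = C.point ν := by
      refine Prod.ext hνe.symm ?_
      simp only [point, Prod.snd_add, Prod.smul_snd, smul_eq_mul, hc, ← heq]
      rw [← add_mul, hab, one_mul]
    rw [this]
    exact (hδ ν (hsub (hI hν))).1

/-- Interior points of the region lie strictly below the curve. -/
theorem exists_lt_of_mem_interior {z : ℝ × ℝ} (hz : z ∈ interior C.region) :
    ∃ ν ∈ Icc 0 C.len, z.1 < C.L₁ ν ∧ z.2 < C.L₂ ν := by
  -- An interior point can be pushed a little along the diagonal without leaving the region, which
  -- makes both inequalities strict.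
  have h : Tendsto (fun ε : ℝ => (z.1 + ε, z.2 + ε)) (𝓝[>] 0) (𝓝 z) := by
    have : Continuous fun ε : ℝ => (z.1 + ε, z.2 + ε) := by fun_prop
    simpa using (this.tendsto 0).mono_left nhdsWithin_le_nhds
  obtain ⟨ε, hε, hε0⟩ :=
    ((h.eventually (mem_interior_iff_mem_nhds.1 hz)).and self_mem_nhdsWithin).exists
  obtain ⟨_, ⟨ν, hν, rfl⟩, hq⟩ := hε
  have hε0' : 0 < ε := hε0
  have h1 : z.1 + ε ≤ C.L₁ ν := hq.2.1
  have h2 : z.2 + ε ≤ C.L₂ ν := hq.2.2.2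
  exact ⟨ν, hν, by linarith, by linarith⟩

end BoundaryCurve

/-! ### The theorem for the original problem -/

namespace ControlledPair

variable {n m : ℕ} {S : ControlledPair n m} {R : ℝ × ℝ → ℝ × ℝ → Fin n → Fin n → ℝ}
  {x₁ x₂ : ℝ → (Fin n → ℝ)} {μ : ℝ} {r : Fin (S.C.N + 1)}

theorem toData_L_eq {ν : ℝ} (h : ν ∈ Icc 0 S.C.len) :
    (S.toData R).L₁ ν = S.C.L₁ ν ∧ (S.toData R).L₂ ν = S.C.L₂ ν := by
  simp only [toData, S.C.clamp_of_mem h, and_self]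

theorem toData_nhdsWithin_le (h : 0 < (S.C.point μ).1 ∧ 0 < (S.C.point μ).2) :
    𝓝[interior S.C.regularRegion] (S.C.point μ) ≤ 𝓝[(S.toData R).G] (S.C.point μ) := by
  rw [nhdsWithin_le_iff, toData_G]
  filter_upwards [self_mem_nhdsWithin,
    mem_nhdsWithin_of_mem_nhds (BoundaryCurve.isOpen_pos.mem_nhds h)] with z h1 h2
  exact ⟨(interior_subset h1).1, h2⟩

/-- Approach from the interior keeps `z` strictly below the curve, as the derivative formulas for
oblique parts require. -/
theorem toData_nhdsWithin_le' :
    𝓝[interior S.C.regularRegion] (S.C.point μ) ≤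
      𝓝[{z | ∃ ν, z.1 < (S.toData R).L₁ ν ∧ z.2 < (S.toData R).L₂ ν}] (S.C.point μ) := by
  refine nhdsWithin_mono _ fun z hz => ?_
  obtain ⟨ν, hν, h⟩ := BoundaryCurve.exists_lt_of_mem_interior
    (interior_mono (fun _ h => h.1) hz)
  refine ⟨ν, ?_⟩
  rwa [(toData_L_eq hν).1, (toData_L_eq hν).2]

theorem eventually_pos (h : 0 < (S.C.point μ).1 ∧ 0 < (S.C.point μ).2) :
    ∀ᶠ z in 𝓝[interior S.C.regularRegion] (S.C.point μ), 0 < z.1 ∧ 0 < z.2 :=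
  mem_nhdsWithin_of_mem_nhds (BoundaryCurve.isOpen_pos.mem_nhds h)

theorem costate_eventuallyEq (hD : S.D.IsSmooth) (hx : S.IsTrajectory x₁ x₂)
    (hR : S.IsRiemannFunction R) (hμ : μ ∈ Ioo 0 S.C.len) (j : Fin n) :
    (fun ν => S.costate R (S.C.point ν) j)
      =ᶠ[𝓝 μ] fun ν => (S.toData R).costate ((S.toData R).γ ν) j := by
  filter_upwards [isOpen_Ioo.mem_nhds hμ] with ν hν
  have h := S.C.pos ν hν
  rw [costate_eq_toData hD hx hR h.1 h.2, toData_γ_of_mem (Ioo_subset_Icc_self hν)]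

theorem vert_ne (hμ : μ ∈ Ioo (S.C.vert r.castSucc) (S.C.vert r.succ)) (k : Fin (S.C.N + 2)) :
    S.C.vert k ≠ μ := by
  rintro rfl
  have h1 : r.castSucc < k := S.C.vert_strictMono.lt_iff_lt.1 hμ.1
  have h2 : k < r.succ := S.C.vert_strictMono.lt_iff_lt.1 hμ.2
  exact absurd (Fin.castSucc_lt_iff_succ_le.1 h1) (not_le.2 h2)

theorem hasStrictDerivAt_toData_L₁ (hμ : μ ∈ Ioo (S.C.vert r.castSucc) (S.C.vert r.succ)) :
    (∀ᶠ ν in 𝓝 μ, HasStrictDerivAt (S.toData R).L₁ (deriv S.C.L₁ ν) ν) ∧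
      ContinuousAt (deriv S.C.L₁) μ := by
  constructor
  · filter_upwards [isOpen_Ioo.mem_nhds hμ] with ν hν
    refine ((BoundaryCurve.contDiffAt_L₁ hν).hasStrictDerivAt (by norm_num)).congr_of_eventuallyEq ?_
    filter_upwards [isOpen_Ioo.mem_nhds (S.C.open_arc_subset r hν)] with ν' hν'
    exact (toData_L_eq (Ioo_subset_Icc_self hν')).1.symm
  · exact (((S.C.contDiffOn_L₁ r).mono Ioo_subset_Icc_self).continuousOn_deriv_of_isOpen isOpen_Ioo
      (by norm_num)).continuousAt (isOpen_Ioo.mem_nhds hμ)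

theorem hasStrictDerivAt_toData_L₂ (hμ : μ ∈ Ioo (S.C.vert r.castSucc) (S.C.vert r.succ)) :
    (∀ᶠ ν in 𝓝 μ, HasStrictDerivAt (S.toData R).L₂ (deriv S.C.L₂ ν) ν) ∧
      ContinuousAt (deriv S.C.L₂) μ := by
  constructor
  · filter_upwards [isOpen_Ioo.mem_nhds hμ] with ν hν
    refine ((BoundaryCurve.contDiffAt_L₂ hν).hasStrictDerivAt (by norm_num)).congr_of_eventuallyEq ?_
    filter_upwards [isOpen_Ioo.mem_nhds (S.C.open_arc_subset r hν)] with ν' hν'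
    exact (toData_L_eq (Ioo_subset_Icc_self hν')).2.symm
  · exact (((S.C.contDiffOn_L₂ r).mono Ioo_subset_Icc_self).continuousOn_deriv_of_isOpen isOpen_Ioo
      (by norm_num)).continuousAt (isOpen_Ioo.mem_nhds hμ)

end ControlledPair

open ControlledPair in
theorem theorem4p1 {n m : ℕ} (S : ControlledPair n m) (hD : S.D.IsSmooth)
    (x₁ x₂ : ℝ → (Fin n → ℝ)) (hx : S.IsTrajectory x₁ x₂)
    (R : ℝ × ℝ → ℝ × ℝ → Fin n → Fin n → ℝ) (hR : S.IsRiemannFunction R)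
    (μ : ℝ) (hμ : μ ∈ Icc 0 S.C.len) (hP : S.C.point μ ∉ S.C.vertices) (j : Fin n) :
    (∀ A, S.C.IsFlatPart A → S.C.point μ ∈ S.C.relInterior A →
      Tendsto (fun z => S.costate R z j)
        (𝓝[interior S.C.regularRegion] (S.C.point μ)) (𝓝 (S.costate R (S.C.point μ) j)) ∧
      DifferentiableAt ℝ (fun ν => S.costate R (S.C.point ν) j) μ ∧
      (S.C.n₁ μ ^ 2 - S.C.n₂ μ ^ 2) * deriv (fun ν => S.costate R (S.C.point ν) j) μ
        + S.C.n₁ μ * S.Hp R j (S.C.point μ) + S.C.n₂ μ * S.Hq R j (S.C.point μ)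
        + S.Φ₁x j μ - deriv (S.Φ₁η j) μ = 0) ∧
    (∀ A, S.C.IsObliquePart A → S.C.point μ ∈ S.C.relInterior A →
      Tendsto (fun z => S.costate R z j)
        (𝓝[interior S.C.regularRegion] (S.C.point μ)) (𝓝 0) ∧
      (S.C.n₂ μ ≠ 0 →
        (∀ᶠ z in 𝓝[interior S.C.regularRegion] (S.C.point μ),
          DifferentiableAt ℝ (fun s => S.costate R (s, z.2) j) z.1) ∧
        Tendsto (fun z => S.C.n₂ μ * deriv (fun s => S.costate R (s, z.2) j) z.1)
          (𝓝[interior S.C.regularRegion] (S.C.point μ)) (𝓝 (-S.F₁ j μ))) ∧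
      (S.C.n₁ μ ≠ 0 →
        (∀ᶠ z in 𝓝[interior S.C.regularRegion] (S.C.point μ),
          DifferentiableAt ℝ (fun t => S.costate R (z.1, t) j) z.2) ∧
        Tendsto (fun z => S.C.n₁ μ * deriv (fun t => S.costate R (z.1, t) j) z.2)
          (𝓝[interior S.C.regularRegion] (S.C.point μ)) (𝓝 (-S.F₁ j μ)))) := by
  obtain ⟨r, hr⟩ := S.C.exists_mem_open_arc hμ fun r h => hP ⟨r, by rw [BoundaryCurve.vertex, h]⟩
  have hμ' := S.C.open_arc_subset r hr
  have hpos := S.C.pos μ hμ'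
  have hreg := toData_isRegular hD hx hR
  have hγ : (S.toData R).γ μ = S.C.point μ := toData_γ_of_mem hμ
  have hLμ := toData_L_eq (R := R) hμ
  have hpos' : 0 < (S.toData R).L₁ μ ∧ 0 < (S.toData R).L₂ μ := by
    rwa [hLμ.1, hLμ.2]
  have hv : ∀ k, (S.toData R).v k ≠ μ := fun k => vert_ne hr _
  have hψ : ∀ i, S.costate R (S.C.point μ) i = (S.toData R).costate (S.C.point μ) i := fun i =>
    costate_eq_toData hD hx hR hpos.1 hpos.2 i
  have hev := costate_eventuallyEq hD hx hR hμ' j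
  have hpe := eventually_pos hpos
  have hlim : ∀ {c : ℝ}, Tendsto (fun z => (S.toData R).costate z j)
      (𝓝[interior S.C.regularRegion] (S.C.point μ)) (𝓝 c) → Tendsto (fun z => S.costate R z j)
      (𝓝[interior S.C.regularRegion] (S.C.point μ)) (𝓝 c) := fun h => by
    refine h.congr' ?_
    filter_upwards [hpe] with z hz using (costate_eq_toData hD hx hR hz.1 hz.2 j).symm
  constructor
  · intro A hA hμA
    have hpt := BoundaryCurve.eventually_point_mem hr hμA
    -- A flat part fixes one coordinate, which is then locally constant along the curve.
    rcases hA.2.common_coordinate with ⟨c, hc⟩ | ⟨c, hc⟩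
    · obtain ⟨hd₁, hd₂, δ, hδ0, hδ⟩ := BoundaryCurve.vertical_of_eventually hr
        (hpt.mono fun ν h => (hc _ h).trans (hc _ hpt.self_of_nhds).symm)
      have hV : (S.toData R).IsVerticalAt μ := by
        refine ⟨hpos'.1, hpos'.2, hv, δ, hδ0, fun ν hν => ?_⟩
        have h := toData_L_eq (R := R) (S.C.arc_subset r (Ioo_subset_Icc_self (hδ ν hν).1))
        rw [h.1, h.2, hLμ.1, hLμ.2]
        exact (hδ ν hν).2
      have hder := (CostateData.vertical_hasDerivAt hreg hV j).congr_of_eventuallyEq hev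
      have ht := CostateData.vertical_tendsto hreg hV j
      rw [hγ] at ht hder
      refine ⟨?_, hder.differentiableAt, ?_⟩
      · rw [hψ]
        exact hlim (ht.mono_left (toData_nhdsWithin_le hpos))
      -- Here the normal is `(1, 0)`: the term with `Hq` drops out, and the rest cancels against the
      -- derivative of the co-state.
      · rw [hder.deriv, Hp_eq hD]
        simp only [BoundaryCurve.n₁, BoundaryCurve.n₂, hd₁, hd₂, toData, F₁]
        simp only [hψ, toData]
        ring
    · obtain ⟨hd₂, hd₁, δ, hδ0, hδ⟩ := BoundaryCurve.horizontal_of_eventually hr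
        (hpt.mono fun ν h => (hc _ h).trans (hc _ hpt.self_of_nhds).symm)
      have hH : (S.toData R).IsHorizontalAt μ := by
        refine ⟨hpos'.1, hpos'.2, hv, δ, hδ0, fun ν hν => ?_⟩
        have h := toData_L_eq (R := R) (S.C.arc_subset r (Ioo_subset_Icc_self (hδ ν hν).1))
        rw [h.1, h.2, hLμ.1, hLμ.2]
        exact (hδ ν hν).2
      have hder := (CostateData.horizontal_hasDerivAt hreg hH j).congr_of_eventuallyEq hev
      have ht := CostateData.horizontal_tendsto hreg hH j
      rw [hγ] at ht hder
      refine ⟨?_, hder.differentiableAt, ?_⟩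
      · rw [hψ]
        exact hlim (ht.mono_left (toData_nhdsWithin_le hpos))
      · rw [hder.deriv, Hq_eq hD]
        simp only [BoundaryCurve.n₁, BoundaryCurve.n₂, hd₁, hd₂, toData, F₁]
        simp only [hψ, toData]
        ring
  · intro A hA hμA
    obtain ⟨δ, hδ0, hδ, hδ₁, hδ₂⟩ := BoundaryCurve.strict_of_oblique hr hA hμA
    have hO : (S.toData R).IsObliqueAt μ := by
      have h := fun ν (hν : ν ∈ Icc (μ - δ) (μ + δ)) =>
        toData_L_eq (R := R) (S.C.arc_subset r (Ioo_subset_Icc_self (hδ ν hν)))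
      exact ⟨hpos'.1, hpos'.2, hv, δ, hδ0, hδ₁.congr fun ν hν => (h ν hν).1.symm,
        hδ₂.congr fun ν hν => (h ν hν).2.symm⟩
    refine ⟨?_, fun hn => ?_, fun hn => ?_⟩
    · have ht := CostateData.oblique_tendsto hreg hO j
      rw [hγ] at ht
      exact hlim (ht.mono_left nhdsWithin_le_nhds)
    · have hd := hasStrictDerivAt_toData_L₁ (R := R) hr
      have hd0 : deriv S.C.L₁ μ ≠ 0 := fun h => hn (by rw [BoundaryCurve.n₂, h, neg_zero])
      have ht := CostateData.oblique_tendsto_deriv hreg hO j hd.1 hd0 hd.2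
      rw [hγ] at ht
      have heq : ∀ z : ℝ × ℝ, 0 < z.1 → 0 < z.2 → (fun s => S.costate R (s, z.2) j)
          =ᶠ[𝓝 z.1] fun s => (S.toData R).costate (s, z.2) j := fun z h1 h2 => by
        filter_upwards [lt_mem_nhds h1] with s hs
        exact costate_eq_toData hD hx hR (z := (s, z.2)) hs h2 j
      constructor
      · filter_upwards [ht.1.filter_mono toData_nhdsWithin_le', hpe] with z h1 h2
        exact h1.congr_of_eventuallyEq (heq z h2.1 h2.2)
      · have hlim' := (ht.2.mono_left toData_nhdsWithin_le').const_mul (S.C.n₂ μ)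
        -- As `n₂ = -L₁'`, the factor cancels the reciprocal and leaves the sign.
        have hval : S.C.n₂ μ * ((S.toData R).F₁ j μ * (deriv S.C.L₁ μ)⁻¹) = -S.F₁ j μ := by
          simp only [BoundaryCurve.n₂, toData]
          field_simp
        rw [hval] at hlim'
        refine hlim'.congr' ?_
        filter_upwards [hpe] with z hz
        rw [(heq z hz.1 hz.2).deriv_eq]
    · have hd := hasStrictDerivAt_toData_L₂ (R := R) hr
      have ht := CostateData.oblique_tendsto_deriv_snd hreg hO j hd.1 hn hd.2
      rw [hγ] at ht
      have heq : ∀ z : ℝ × ℝ, 0 < z.1 → 0 < z.2 → (fun t => S.costate R (z.1, t) j)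
          =ᶠ[𝓝 z.2] fun t => (S.toData R).costate (z.1, t) j := fun z h1 h2 => by
        filter_upwards [lt_mem_nhds h2] with s hs
        exact costate_eq_toData hD hx hR (z := (z.1, s)) h1 hs j
      constructor
      · filter_upwards [ht.1.filter_mono toData_nhdsWithin_le', hpe] with z h1 h2
        exact h1.congr_of_eventuallyEq (heq z h2.1 h2.2)
      · have hlim' := (ht.2.mono_left toData_nhdsWithin_le').const_mul (S.C.n₁ μ)
        have hval : S.C.n₁ μ * -((S.toData R).F₁ j μ * (deriv S.C.L₂ μ)⁻¹) = -S.F₁ j μ := by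
          have hn' : deriv S.C.L₂ μ ≠ 0 := hn
          simp only [BoundaryCurve.n₁, toData]
          field_simp
        rw [hval] at hlim'
        refine hlim'.congr' ?_
        filter_upwards [hpe] with z hz
        rw [(heq z hz.1 hz.2).deriv_eq]
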